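/- **Notation.** For a matrix $A$, $\|A\|$ is the operator norm. For $x\in\mathbb R^n$ let $\sigma_s(x)_1=\inf\{\|x-z\|_1: z\in\mathbb R^n \text{ has at most } s \text{ nonzero entries}\}$. For $1\le s\le n$ and $0<\gamma<1$ let $$S_\gamma=\Big\{v\in\mathbb R^n:\ \|v\|_2=1,\ \|v_T\|_2\ge \tfrac{\gamma}{\sqrt s}\|v_{T^c}\|_1\ \text{for some } T\subset\{1,\dots,n\},\ |T|=s\Big\}.$$ A matrix $M$ with $n$ columns has the *robust null space property* (robust NSP) of order $s$ with constants $\gamma,\tau>0$ if $\inf_{v\in S_\gamma}\|Mv\|_2\ge 1/\tau$. Given $\Phi\in\mathbb R^{m\times d}$, $D\in\mathbb R^{d\times n}$, $y\in\mathbb R^m$ and $\varepsilon\ge0$, an output of *$\ell_1$-synthesis* is a pair $(\hat x,\hat z)$, where $\hat x$ is a minimizer of $\|x\|_1$ subject to $\|\Phi Dx-y\|_2\le\varepsilon$, and $\hat z=D\hat x$. **Random model.** Let $A^*,c_0,\lambda,K,\sigma>0$. * $\Phi\in\mathbb R^{m\times d}$ has i.i.d. rows distributed as $\varphi/\sqrt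 m$, where $\mathbb E\varphi=0$, $\inf_{\|x\|_2=1}\mathbb P(|\langle\varphi,x\rangle|\ge A^*)\ge c_0$, and every entry of $\varphi$ has $L^2$-norm at most $\lambda$. * $D=(d^{-1/2}a_{ij})\in\mathbb R^{d\times n}$ is independent of $\Phi$. The $a_{ij}$ are i.i.d. and centered, with variance at least $\sigma^2$ and $\|a_{ij}\|_{L^p}\le K\sqrt p$ for all real $1\le p\le\log n$. **Theorem.** There is an absolute constant $C_0>0$, and for all $A^*,c_0,\lambda,K,\sigma>0$ there is $\tau>0$ depending only on these parameters, such that for all $\gamma,\theta\in(0,1)$ there are $C,c>0$ (depending only on $A^*,c_0,\lambda,K,\sigma,\gamma,\theta$) with the following property. Let $n\ge 8$, $1\le s\le\theta n$, $$d\ge C\,s\log(n/s),\qquad m\ge C\,s\log(n/s),$$ and let $\Phi$, $D$ be as above. Then $\mathbb E\|D\|<\infty$ and there is an event $E$ with $\mathbb P(E)\ge 1-e^{-cd}-e^{-cm}$ such that: 1. On $E$, both $D$ and $\Phi D$ satisfy the robust NSP of order $s$ with constants $\gamma$ and $\tau$. 2. On $E$, for every $x_0\in\mathbb R^n$, $z_0=Dx_0$,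 every $e\in\mathbb R^m$ with $\|e\|_2\le\varepsilon$, and $y=\Phi z_0+e$, the $\ell_1$-synthesis method has an output, and every output $(\hat x,\hat z)$ satisfies $$\|\hat x-x_0\|_2\le C_0\Big(\frac{\sigma_s(x_0)_1}{\sqrt s}+\tau\varepsilon\Big),\qquad \|\hat z-z_0\|_2\le C_0\|D\|\Big(\frac{\sigma_s(x_0)_1}{\sqrt s}+\tau\varepsilon\Big).$$ 3. In particular, for fixed $x_0$ and $\varepsilon\ge 0$, any (possibly random) noise $e$ with $\|e\|_2\le\varepsilon$ on $E$, and any choice of outputs $(\hat x,\hat z)$ on $E$ for the data $y=\Phi z_0+e$, where $z_0=Dx_0$, $$\mathbb E\big[\|\hat z-z_0\|_2\,\mathbf 1_E\big]\le C_0\,\mathbb E[\|D\|]\Big(\frac{\sigma_s(x_0)_1}{\sqrt s}+\tau\varepsilon\Big).$$ -/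

import Mathlib

open MeasureTheory ProbabilityTheory

namespace DictSparse

/-- The continuous linear map `ℝᵇ → ℝᵃ` (Euclidean norms) given by a matrix; its norm is the
standard operator norm of the matrix. -/
noncomputable def mulCLM {a b : ℕ} (A : Matrix (Fin a) (Fin b) ℝ) :
    EuclideanSpace ℝ (Fin b) →L[ℝ] EuclideanSpace ℝ (Fin a) :=
  LinearMap.toContinuousLinearMap (Matrix.toEuclideanLin A)

/-- The `ℓ¹`-norm. -/
def l1Norm {n : ℕ} (x : EuclideanSpace ℝ (Fin n)) : ℝ := ∑ i, |x i|

/-- `x` has at most `s` nonzero coordinates. -/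
def IsSparse {n : ℕ} (s : ℕ) (x : EuclideanSpace ℝ (Fin n)) : Prop :=
  {i | x i ≠ 0}.ncard ≤ s

/-- The `ℓ¹`-error `σ_s(x)₁` of the best `s`-term approximation of `x`. -/
noncomputable def bestApproxErr {n : ℕ} (s : ℕ) (x : EuclideanSpace ℝ (Fin n)) : ℝ :=
  sInf {r : ℝ | ∃ z : EuclideanSpace ℝ (Fin n), IsSparse s z ∧ r = l1Norm (x - z)}

/-- The set `S_γ` of unit vectors `v` such that `‖v_T‖₂ ≥ (γ / √s) ‖v_{Tᶜ}‖₁` for some index set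
`T` with `s` elements. -/
def nspSet (n s : ℕ) (γ : ℝ) : Set (EuclideanSpace ℝ (Fin n)) :=
  {v | ‖v‖ = 1 ∧ ∃ T : Finset (Fin n), T.card = s ∧
    γ / √(s : ℝ) * ∑ i ∈ Tᶜ, |v i| ≤ √(∑ i ∈ T, v i ^ 2)}

/-- The robust null space property of order `s` with constants `γ` and `τ`:
`inf_{v ∈ S_γ} ‖A v‖₂ ≥ 1 / τ`. -/
def RobustNSP {k n : ℕ} (A : Matrix (Fin k) (Fin n) ℝ) (s : ℕ) (γ τ : ℝ) : Prop :=
  ∀ v ∈ nspSet n s γ, 1 / τ ≤ ‖mulCLM A v‖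

/-- `xhat` is an output of the `ℓ¹`-synthesis method with measurement matrix `Φ`, dictionary `D`,
data `y` and noise level `ε`: it minimizes `‖x‖₁` subject to `‖Φ D x - y‖₂ ≤ ε`. The recovered
signal is then `D xhat`. -/
def IsL1Synthesis {m d n : ℕ} (Φ : Matrix (Fin m) (Fin d) ℝ) (D : Matrix (Fin d) (Fin n) ℝ)
    (y : EuclideanSpace ℝ (Fin m)) (ε : ℝ) (xhat : EuclideanSpace ℝ (Fin n)) : Prop :=
  ‖mulCLM (Φ * D) xhat - y‖ ≤ ε ∧
    ∀ x : EuclideanSpace ℝ (Fin n), ‖mulCLM (Φ * D) x - y‖ ≤ ε → l1Norm xhat ≤ l1Norm x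

variable {Ω : Type*} [MeasurableSpace Ω]

/-- `φ₁, …, φ_m` are i.i.d. copies of a centered random vector in `ℝᵈ` which satisfies the
small-ball condition `P(|⟨φ, x⟩| ≥ A) ≥ c` for all unit vectors `x`, and whose coordinates have
`L²`-norm at most `lam`. -/
structure IsSmallBallFamily {m d : ℕ} (P : Measure Ω)
    (φ : Fin m → Ω → EuclideanSpace ℝ (Fin d)) (A c lam : ℝ) : Prop where
  measurable : ∀ i, Measurable (φ i)
  indep : iIndepFun φ P
  identDistrib : ∀ i i', IdentDistrib (φ i) (φ i') P P
  centered : ∀ i k, ∫ ω, φ i ω k ∂P = 0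
  smallBall : ∀ i, ∀ x : EuclideanSpace ℝ (Fin d), ‖x‖ = 1 →
    c ≤ P.real {ω | A ≤ |inner ℝ (φ i ω) x|}
  variance_le : ∀ i k, eLpNorm (fun ω => φ i ω k) 2 P ≤ ENNReal.ofReal lam

/-- The measurement matrix with rows `φᵢ / √m`. -/
noncomputable def measMatrix {m d : ℕ} (φ : Fin m → Ω → EuclideanSpace ℝ (Fin d)) (ω : Ω) :
    Matrix (Fin m) (Fin d) ℝ :=
  Matrix.of fun i k => φ i ω k / √(m : ℝ)

/-- The `a i j` are i.i.d. centered real random variables with variance at least `σ ^ 2`, whose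
first `log n` moments are sub-Gaussian: `‖a i j‖_{L^p} ≤ K √p` for all real `1 ≤ p ≤ log n`. -/
structure IsLogSubgaussianFamily {d n : ℕ} (P : Measure Ω)
    (a : Fin d → Fin n → Ω → ℝ) (K σ : ℝ) : Prop where
  measurable : ∀ i j, Measurable (a i j)
  indep : iIndepFun (fun (ij : Fin d × Fin n) => a ij.1 ij.2) P
  identDistrib : ∀ i j i' j', IdentDistrib (a i j) (a i' j') P P
  centered : ∀ i j, ∫ ω, a i j ω ∂P = 0
  variance_ge : ∀ i j, σ ^ 2 ≤ variance (a i j) P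
  moment_le : ∀ i j, ∀ p : ℝ, 1 ≤ p → p ≤ Real.log n →
    eLpNorm (a i j) (ENNReal.ofReal p) P ≤ ENNReal.ofReal (K * √p)

/-- The dictionary with entries `a i j / √d`. -/
noncomputable def dictMatrix {d n : ℕ} (a : Fin d → Fin n → Ω → ℝ) (ω : Ω) :
    Matrix (Fin d) (Fin n) ℝ :=
  Matrix.of fun i j => a i j ω / √(d : ℝ)

end DictSparse

/-! Recovery is deterministic. Let `h` be the difference between an output and the true
coefficients. Minimality of the `ℓ¹`-norm puts `h` in a cone: its mass off some `s`-set is at most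
its mass on that set, up to twice the error of sparse approximation. Either the direction of `h`
lies in the null space set, and then `‖h‖ ≤ τ ‖ΦDh‖ ≤ 2τε`, or every `s`-block of `h` is small
relative to the rest. For `γ ≤ 1/2` the cone condition then forces `h` to be small
(`RobustNSP.norm_le`). The estimate for the signal costs one operator norm.

Both null space properties come from the small ball method (`measureReal_exists_mem_lt`): if each
linear form `⟨y, x⟩`, `x ∈ T`, has size at least `2u` with probability at least `c`, and the mean of
`sup |⟨∑ yᵢ, x - w⟩|` is a small multiple of the number of samples, then all sums `∑ ⟨yᵢ, x⟩²` are
large except with exponentially small probability. Its proof combines bounded differences,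
symmetrization by an independent copy and contraction. Contraction sees only differences, so the
centre `w` is free.

For `D` the samples are its rows. Their small ball estimate follows from the decay of characteristic
functions, for which moments of some order above 2 are needed; `log n ≥ log 8 > 2` supplies them.
Entries are truncated at a multiple of `√(log n)`. The truncated (light) part has all its even
moments sub-Gaussian, and soft thresholding at a level `t` with `exp (-c t²) = s / n` gives the
width `√(s log (n/s))`. The removed (heavy) part has variance smaller than a prescribed power of
`1/n`.

For `ΦD` the dictionary is frozen and the samples are the rows of `Φ`; the property of `D` transfers
the small ball condition to the vectors `Dv`. The light part is treated as before, now along the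
random direction of the sum of the rows. The heavy columns are controlled only in second moment,
which would give weak probabilities in a direct estimate. Instead the unit cube is cut into cells
whose mesh in coordinate `j` is inverse to the energy of the `j`-th heavy column, and the small ball
method is applied in each cell with its own centre `w`. The number of cells is a product over
independent columns with mean at most `e`, so Markov's inequality bounds it by `exp (c₀² m / 16)`
outside an exponentially rare event, and the union bound costs only half of the exponent
(`HasBoundedCoordinates.measureReal_exists_lt`,
`IsLogSubgaussianFamily.measureReal_prod_energy_le`). -/

namespace DictSparse

set_option linter.unusedSectionVars false

/-! ### Deterministic recovery from the robust null space property -/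

variable {n : ℕ}

/-- There is a set of `s` coordinates on which `x` is largest. -/
theorem exists_largest_coords (x : Fin n → ℝ) {s : ℕ} (hs : s ≤ n) :
    ∃ T : Finset (Fin n), T.card = s ∧ ∀ i ∈ T, ∀ j ∉ T, |x j| ≤ |x i| := by
  classical
  have hne : (Finset.univ.powersetCard s : Finset (Finset (Fin n))).Nonempty :=
    Finset.powersetCard_nonempty.2 (by simpa using hs)
  -- Exchange argument: in a set of maximal total absolute value, swapping `i` for `j` cannot help.
  obtain ⟨T, hT, hmax⟩ := Finset.exists_max_image _ (fun T => ∑ i ∈ T, |x i|) hne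
  rw [Finset.mem_powersetCard_univ] at hT
  refine ⟨T, hT, fun i hi j hj => ?_⟩
  have hj' : j ∉ T.erase i := fun h => hj (Finset.mem_of_mem_erase h)
  have hc : (insert j (T.erase i)).card = s := by
    rw [Finset.card_insert_of_notMem hj', Finset.card_erase_of_mem hi, hT]
    have : 0 < T.card := Finset.card_pos.2 ⟨i, hi⟩
    omega
  have h := hmax _ (Finset.mem_powersetCard_univ.2 hc)
  rw [Finset.sum_insert hj', ← Finset.add_sum_erase T _ hi] at h
  linarith

theorem l1Norm_nonneg (x : EuclideanSpace ℝ (Fin n)) : 0 ≤ l1Norm x :=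
  Finset.sum_nonneg fun _ _ => abs_nonneg _

theorem norm_le_l1Norm (x : EuclideanSpace ℝ (Fin n)) : ‖x‖ ≤ l1Norm x := by
  rw [EuclideanSpace.norm_eq]
  refine Real.sqrt_le_iff.2 ⟨l1Norm_nonneg x, ?_⟩
  simpa [l1Norm] using Finset.sum_sq_le_sq_sum_of_nonneg (s := Finset.univ) (f := fun i => |x i|)
    (fun i _ => abs_nonneg _)

theorem continuous_l1Norm : Continuous (l1Norm : EuclideanSpace ℝ (Fin n) → ℝ) := by
  unfold l1Norm
  fun_prop

theorem l1Norm_split (x : EuclideanSpace ℝ (Fin n)) (T : Finset (Fin n)) :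
    ∑ i ∈ T, |x i| + ∑ i ∈ Tᶜ, |x i| = l1Norm x :=
  Finset.sum_add_sum_compl T _

theorem sum_abs_le_sqrt_card (x : EuclideanSpace ℝ (Fin n)) (T : Finset (Fin n)) :
    ∑ i ∈ T, |x i| ≤ √(T.card : ℝ) * √(∑ i ∈ T, x i ^ 2) := by
  have h := Real.sum_mul_le_sqrt_mul_sqrt T (fun _ => (1 : ℝ)) (fun i => |x i|)
  simpa using h

/-- Vectors that violate the null space condition on every index set are dominated by their
`ℓ¹`-norm. -/
theorem norm_le_of_forall_card {s : ℕ} (hs : 1 ≤ s) (hsn : s ≤ n) (h : EuclideanSpace ℝ (Fin n))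
    {B : ℝ} (hB : ∀ T : Finset (Fin n), T.card = s → √(∑ i ∈ T, h i ^ 2) ≤ B) :
    ‖h‖ ≤ B + l1Norm h / √(s : ℝ) := by
  obtain ⟨T, hT, hmax⟩ := exists_largest_coords (fun i => h i) hsn
  have hs0 : (0 : ℝ) < s := by exact_mod_cast hs
  have hout : ∀ j ∈ Tᶜ, |h j| ≤ l1Norm h / s := by
    intro j hj
    rw [le_div_iff₀ hs0]
    have h1 : ∑ i ∈ T, |h j| ≤ ∑ i ∈ T, |h i| :=
      Finset.sum_le_sum fun i hi => hmax i hi j (Finset.mem_compl.1 hj)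
    rw [Finset.sum_const, hT, nsmul_eq_mul] at h1
    have h2 := l1Norm_split h T
    have h3 : 0 ≤ ∑ i ∈ Tᶜ, |h i| := Finset.sum_nonneg fun _ _ => abs_nonneg _
    linarith
  have hl := l1Norm_nonneg h
  have h2 : ∑ j ∈ Tᶜ, h j ^ 2 ≤ (l1Norm h / √(s : ℝ)) ^ 2 := by
    calc ∑ j ∈ Tᶜ, h j ^ 2 ≤ ∑ j ∈ Tᶜ, |h j| * (l1Norm h / s) := by
          refine Finset.sum_le_sum fun j hj => ?_
          rw [← sq_abs, sq]
          exact mul_le_mul_of_nonneg_left (hout j hj) (abs_nonneg _)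
      _ = (∑ j ∈ Tᶜ, |h j|) * (l1Norm h / s) := by rw [Finset.sum_mul]
      _ ≤ l1Norm h * (l1Norm h / s) := by
          refine mul_le_mul_of_nonneg_right ?_ (by positivity)
          have := l1Norm_split h T
          have h3 : 0 ≤ ∑ i ∈ T, |h i| := Finset.sum_nonneg fun _ _ => abs_nonneg _
          linarith
      _ = (l1Norm h / √(s : ℝ)) ^ 2 := by
          rw [div_pow, Real.sq_sqrt hs0.le]; ring
  have h1 : ∑ i ∈ T, h i ^ 2 ≤ B ^ 2 := by
    have h0 : 0 ≤ ∑ i ∈ T, h i ^ 2 := Finset.sum_nonneg fun _ _ => sq_nonneg _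
    have := hB T hT
    exact (Real.sqrt_le_left ((Real.sqrt_nonneg _).trans this)).1 this
  have hB0 : 0 ≤ B := (Real.sqrt_nonneg _).trans (hB T hT)
  have hC0 : 0 ≤ l1Norm h / √(s : ℝ) := by positivity
  rw [EuclideanSpace.norm_eq]
  refine Real.sqrt_le_iff.2 ⟨by positivity, ?_⟩
  have h3 : ∑ i, ‖h i‖ ^ 2 = ∑ i ∈ T, h i ^ 2 + ∑ i ∈ Tᶜ, h i ^ 2 := by
    rw [Finset.sum_add_sum_compl]
    simp
  rw [h3]
  nlinarith [mul_nonneg hB0 hC0]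

/-- The null space set shrinks as `γ` grows. Recovery needs `γ ≤ 1/2`, so the property is produced
for `min γ (1/2)` and weakened to `γ` afterwards. -/
theorem RobustNSP.mono {k s : ℕ} {A : Matrix (Fin k) (Fin n) ℝ} {γ γ' τ : ℝ} (hγ : γ ≤ γ')
    (h : RobustNSP A s γ τ) : RobustNSP A s γ' τ := by
  rintro v ⟨hv, T, hT, hle⟩
  refine h v ⟨hv, T, hT, le_trans ?_ hle⟩
  gcongr

/-- Under the robust null space property, vectors of small measurement whose `ℓ¹`-mass is
controlled by their largest part are small. -/
theorem RobustNSP.norm_le {k s : ℕ} (hs : 1 ≤ s) (hsn : s ≤ n) {A : Matrix (Fin k) (Fin n) ℝ}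
    {γ τ : ℝ} (hγ0 : 0 < γ) (hγ : γ ≤ 1 / 2) (hτ : 0 < τ) (hA : RobustNSP A s γ τ)
    (h : EuclideanSpace ℝ (Fin n)) {r η : ℝ} (hr : 0 ≤ r) (hη : ‖mulCLM A h‖ ≤ η)
    (hT : ∃ T : Finset (Fin n), T.card = s ∧ ∑ i ∈ Tᶜ, |h i| ≤ ∑ i ∈ T, |h i| + 2 * r) :
    ‖h‖ ≤ 9 * (r / √(s : ℝ)) + τ * η := by
  have hs0 : (0 : ℝ) < s := by exact_mod_cast hs
  have hss : (0 : ℝ) < √(s : ℝ) := Real.sqrt_pos.2 hs0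
  have hη0 : 0 ≤ η := (norm_nonneg _).trans hη
  -- Dichotomy: the direction of `h` belongs to the null space set, or the defining inequality fails
  -- on every `s`-set.
  by_cases hall : ∃ T : Finset (Fin n), T.card = s ∧
      γ / √(s : ℝ) * ∑ i ∈ Tᶜ, |h i| ≤ √(∑ i ∈ T, h i ^ 2)
  · obtain ⟨T, hTc, hTle⟩ := hall
    by_cases h0 : h = 0
    · subst h0; rw [norm_zero]; positivity
    have hn : 0 < ‖h‖ := norm_pos_iff.2 h0
    have hmem : (‖h‖⁻¹ • h) ∈ nspSet n s γ := by
      refine ⟨by rw [norm_smul, norm_inv, norm_norm, inv_mul_cancel₀ hn.ne'], T, hTc, ?_⟩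
      have e1 : ∑ i ∈ Tᶜ, |(‖h‖⁻¹ • h) i| = ‖h‖⁻¹ * ∑ i ∈ Tᶜ, |h i| := by
        rw [Finset.mul_sum]
        refine Finset.sum_congr rfl fun i _ => ?_
        simp [abs_mul]
      have e2 : √(∑ i ∈ T, (‖h‖⁻¹ • h) i ^ 2) = ‖h‖⁻¹ * √(∑ i ∈ T, h i ^ 2) := by
        have : ∑ i ∈ T, (‖h‖⁻¹ • h) i ^ 2 = ‖h‖⁻¹ ^ 2 * ∑ i ∈ T, h i ^ 2 := by
          rw [Finset.mul_sum]
          refine Finset.sum_congr rfl fun i _ => ?_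
          simp [mul_pow]
        rw [this, Real.sqrt_mul (sq_nonneg _), Real.sqrt_sq (by positivity)]
      rw [e1, e2]
      calc _ = ‖h‖⁻¹ * (γ / √(s : ℝ) * ∑ i ∈ Tᶜ, |h i|) := by ring
        _ ≤ _ := by gcongr
    have h1 := hA _ hmem
    rw [map_smul, norm_smul, norm_inv, norm_norm] at h1
    have h2 : ‖h‖ ≤ τ * ‖mulCLM A h‖ := by
      rw [inv_mul_eq_div, div_le_div_iff₀ hτ hn] at h1
      linarith
    have h3 : 0 ≤ 9 * (r / √(s : ℝ)) := by positivity
    nlinarith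
  · push Not at hall
    obtain ⟨T, hTc, hTle⟩ := hT
    have hkey : ∀ T : Finset (Fin n), T.card = s →
        ∑ i ∈ T, |h i| ≤ γ * ∑ i ∈ Tᶜ, |h i| := by
      intro T hTc
      have h1 := sum_abs_le_sqrt_card h T
      rw [hTc] at h1
      have h2 := (hall T hTc).le
      calc ∑ i ∈ T, |h i| ≤ √(s : ℝ) * √(∑ i ∈ T, h i ^ 2) := h1
        _ ≤ √(s : ℝ) * (γ / √(s : ℝ) * ∑ i ∈ Tᶜ, |h i|) := by gcongr
        _ = _ := by field_simp
    have hc0 : ∀ T : Finset (Fin n), 0 ≤ ∑ i ∈ Tᶜ, |h i| :=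
      fun T => Finset.sum_nonneg fun _ _ => abs_nonneg _
    have h1 := hkey T hTc
    -- With `γ ≤ 1/2` the mass on `T` is at most half of the mass off `T` and is absorbed. The
    -- totals `4r + 2r = 6r` and then `γ · 6r ≤ 3r` lead to the final constant `9 = 3 + 6`.
    have h2 : ∑ i ∈ Tᶜ, |h i| ≤ 4 * r := by nlinarith [hc0 T]
    have h3 : l1Norm h ≤ 6 * r := by
      rw [← l1Norm_split h T]; nlinarith [hc0 T]
    have h4 : ∀ T : Finset (Fin n), T.card = s → √(∑ i ∈ T, h i ^ 2) ≤ 3 * r / √(s : ℝ) := by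
      intro T hTc
      refine (hall T hTc).le.trans ?_
      have h5 : ∑ i ∈ Tᶜ, |h i| ≤ 6 * r := by
        have h6 : 0 ≤ ∑ i ∈ T, |h i| := Finset.sum_nonneg fun _ _ => abs_nonneg _
        linarith [l1Norm_split h T]
      rw [div_mul_eq_mul_div]
      refine div_le_div_of_nonneg_right ?_ hss.le
      nlinarith [hc0 T]
    have h5 := norm_le_of_forall_card hs hsn h h4
    have h6 : l1Norm h / √(s : ℝ) ≤ 6 * r / √(s : ℝ) := by gcongr
    have h7 : 0 ≤ τ * η := by positivity
    calc ‖h‖ ≤ 3 * r / √(s : ℝ) + 6 * r / √(s : ℝ) := by linarith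
      _ = 9 * (r / √(s : ℝ)) := by ring
      _ ≤ _ := by linarith

theorem bestApproxErr_nonneg (s : ℕ) (x : EuclideanSpace ℝ (Fin n)) : 0 ≤ bestApproxErr s x := by
  refine Real.sInf_nonneg ?_
  rintro r ⟨z, -, rfl⟩
  exact l1Norm_nonneg _

/-- If `x'` has `ℓ¹`-norm at most that of `x`, and `z` is `s`-sparse, then the difference
`x' - x` is concentrated on an `s`-element set up to twice the error `‖x - z‖₁`. -/
theorem exists_cone_of_l1Norm_le {s : ℕ} (hsn : s ≤ n) {x x' z : EuclideanSpace ℝ (Fin n)}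
    (hle : l1Norm x' ≤ l1Norm x) (hz : IsSparse s z) :
    ∃ T : Finset (Fin n), T.card = s ∧
      ∑ i ∈ Tᶜ, |(x' - x) i| ≤ ∑ i ∈ T, |(x' - x) i| + 2 * l1Norm (x - z) := by
  classical
  have hcard : (Finset.univ.filter fun i => z i ≠ 0).card ≤ s := by
    have : {i | z i ≠ 0} = ((Finset.univ.filter fun i => z i ≠ 0 : Finset (Fin n)) : Set _) := by
      ext; simp
    unfold IsSparse at hz
    rwa [this, Set.ncard_coe_finset] at hz
  obtain ⟨T, hsub, hT⟩ := Finset.exists_superset_card_eq hcard (by simpa using hsn)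
  refine ⟨T, hT, ?_⟩
  have h1 : ∑ i ∈ Tᶜ, |x i| ≤ l1Norm (x - z) := by
    rw [← l1Norm_split _ T]
    have h2 : ∑ i ∈ Tᶜ, |(x - z) i| = ∑ i ∈ Tᶜ, |x i| := by
      refine Finset.sum_congr rfl fun i hi => ?_
      have : z i = 0 := by
        by_contra h
        exact (Finset.mem_compl.1 hi) (hsub (by simp [h]))
      simp [this]
    rw [h2]
    have : 0 ≤ ∑ i ∈ T, |(x - z) i| := Finset.sum_nonneg fun _ _ => abs_nonneg _
    linarith
  have h3 : ∑ i ∈ T, |x i| ≤ ∑ i ∈ T, |x' i| + ∑ i ∈ T, |(x' - x) i| := by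
    rw [← Finset.sum_add_distrib]
    refine Finset.sum_le_sum fun i _ => ?_
    have := abs_sub_abs_le_abs_sub (x i) (x' i)
    rw [abs_sub_comm] at this
    simp only [PiLp.sub_apply]
    linarith
  have h4 : ∑ i ∈ Tᶜ, |(x' - x) i| ≤ ∑ i ∈ Tᶜ, |x' i| + ∑ i ∈ Tᶜ, |x i| := by
    rw [← Finset.sum_add_distrib]
    refine Finset.sum_le_sum fun i _ => ?_
    simp only [PiLp.sub_apply]
    exact abs_sub _ _
  have h5 := l1Norm_split x T
  have h6 := l1Norm_split x' T
  linarith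

theorem mulCLM_mul {k d : ℕ} (Φ : Matrix (Fin k) (Fin d) ℝ) (D : Matrix (Fin d) (Fin n) ℝ)
    (x : EuclideanSpace ℝ (Fin n)) : mulCLM (Φ * D) x = mulCLM Φ (mulCLM D x) := by
  simp [mulCLM, Matrix.toLpLin_apply, Matrix.mulVec_mulVec]

/-- Stability and robustness of `ℓ¹`-synthesis in the coefficients. -/
theorem norm_sub_le_of_isL1Synthesis {m d s : ℕ} (hs : 1 ≤ s) (hsn : s ≤ n)
    {Φ : Matrix (Fin m) (Fin d) ℝ} {D : Matrix (Fin d) (Fin n) ℝ} {γ τ ε : ℝ} (hγ0 : 0 < γ)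
    (hγ : γ ≤ 1 / 2) (hτ : 0 < τ) (hA : RobustNSP (Φ * D) s γ τ)
    {x₀ xhat : EuclideanSpace ℝ (Fin n)} {e : EuclideanSpace ℝ (Fin m)} (he : ‖e‖ ≤ ε)
    (hx : IsL1Synthesis Φ D (mulCLM Φ (mulCLM D x₀) + e) ε xhat) :
    ‖xhat - x₀‖ ≤ 9 * (bestApproxErr s x₀ / √(s : ℝ) + τ * ε) := by
  have hs0 : (0 : ℝ) < √(s : ℝ) := Real.sqrt_pos.2 (by exact_mod_cast hs)
  have hε : 0 ≤ ε := (norm_nonneg _).trans he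
  have hfeas : ‖mulCLM (Φ * D) x₀ - (mulCLM Φ (mulCLM D x₀) + e)‖ ≤ ε := by
    rw [mulCLM_mul, sub_add_cancel_left, norm_neg]; exact he
  have hmeas : ‖mulCLM (Φ * D) (xhat - x₀)‖ ≤ 2 * ε := by
    rw [map_sub]
    have := norm_sub_le (mulCLM (Φ * D) xhat - (mulCLM Φ (mulCLM D x₀) + e))
      (mulCLM (Φ * D) x₀ - (mulCLM Φ (mulCLM D x₀) + e))
    rw [sub_sub_sub_cancel_right] at this
    linarith [hx.1]
  have hle := hx.2 x₀ hfeas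
  -- The infimum in `bestApproxErr` is not known to be attained. Solved for it, the claim says that
  -- the left side is a lower bound for all admissible errors.
  suffices h : (‖xhat - x₀‖ - 9 * (τ * ε)) / 9 * √(s : ℝ) ≤ bestApproxErr s x₀ by
    rw [← le_div_iff₀ hs0] at h
    linarith
  refine le_csInf ⟨_, 0, by simp [IsSparse], rfl⟩ ?_
  rintro r ⟨z, hz, rfl⟩
  have h := hA.norm_le hs hsn hγ0 hγ hτ (xhat - x₀) (l1Norm_nonneg _) hmeas
    (exists_cone_of_l1Norm_le hsn hle hz)
  rw [← le_div_iff₀ hs0]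
  have : 0 ≤ τ * ε := by positivity
  linarith

/-- Compactness: the feasible set may be cut down to the Euclidean ball of radius `‖x₀‖₁`, since a
point outside it already has larger `ℓ¹`-norm than the feasible `x₀`. -/
theorem exists_isL1Synthesis {m d : ℕ} (Φ : Matrix (Fin m) (Fin d) ℝ)
    (D : Matrix (Fin d) (Fin n) ℝ) (y : EuclideanSpace ℝ (Fin m)) (ε : ℝ)
    (x₀ : EuclideanSpace ℝ (Fin n)) (hx₀ : ‖mulCLM (Φ * D) x₀ - y‖ ≤ ε) :
    ∃ xhat, IsL1Synthesis Φ D y ε xhat := by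
  let K : Set (EuclideanSpace ℝ (Fin n)) :=
    {x | ‖mulCLM (Φ * D) x - y‖ ≤ ε} ∩ Metric.closedBall 0 (l1Norm x₀)
  have hK : IsCompact K :=
    (isCompact_closedBall _ _).inter_left (isClosed_le (by fun_prop) continuous_const)
  have hmem : x₀ ∈ K := ⟨hx₀, by simpa using norm_le_l1Norm x₀⟩
  obtain ⟨xhat, hxK, hmin⟩ := hK.exists_isMinOn ⟨x₀, hmem⟩ continuous_l1Norm.continuousOn
  refine ⟨xhat, hxK.1, fun x hx => ?_⟩
  by_cases h : x ∈ Metric.closedBall (0 : EuclideanSpace ℝ (Fin n)) (l1Norm x₀)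
  · exact hmin ⟨hx, h⟩
  · rw [mem_closedBall_zero_iff, not_le] at h
    exact (hmin hmem).trans (h.le.trans (norm_le_l1Norm x))

/-- The vectors of the null space cone have `ℓ¹`-norm at most a multiple of `√s`. -/
theorem l1Norm_le_of_mem_nspSet {s : ℕ} (hs : 1 ≤ s) {γ : ℝ} (hγ : 0 < γ)
    {v : EuclideanSpace ℝ (Fin n)} (hv : v ∈ nspSet n s γ) :
    l1Norm v ≤ (1 + 1 / γ) * √(s : ℝ) := by
  obtain ⟨hv1, T, hT, hle⟩ := hv
  have hs0 : (0 : ℝ) < √(s : ℝ) := Real.sqrt_pos.2 (by exact_mod_cast hs)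
  have h1 : √(∑ i ∈ T, v i ^ 2) ≤ 1 := by
    rw [← hv1, EuclideanSpace.norm_eq]
    refine Real.sqrt_le_sqrt ?_
    simp only [Real.norm_eq_abs, sq_abs]
    exact Finset.sum_le_univ_sum_of_nonneg fun i => sq_nonneg _
  have h2 := sum_abs_le_sqrt_card v T
  rw [hT] at h2
  have h3 : ∑ i ∈ Tᶜ, |v i| ≤ √(s : ℝ) / γ := by
    rw [le_div_iff₀ hγ]
    have h4 := hle.trans h1
    rw [div_mul_eq_mul_div, div_le_one hs0] at h4
    linarith
  rw [← l1Norm_split v T]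
  have h5 : √(s : ℝ) * √(∑ i ∈ T, v i ^ 2) ≤ √(s : ℝ) * 1 := by gcongr
  calc _ ≤ √(s : ℝ) * 1 + √(s : ℝ) / γ := by linarith
    _ = _ := by ring

/-! ### The bounded difference inequality -/

section BoundedDifferences

variable {X : Type*} [MeasurableSpace X] {m : ℕ}

/-- Measure preserving splitting of the first coordinate. -/
theorem measurePreserving_cons (μ : Measure X) [IsProbabilityMeasure μ] (m : ℕ) :
    MeasurePreserving (fun p : X × (Fin m → X) => (Fin.cons p.1 p.2 : Fin (m + 1) → X))
      (μ.prod (Measure.pi fun _ => μ)) (Measure.pi fun _ => μ) := by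
  have h := (measurePreserving_piFinSuccAbove (fun _ : Fin (m + 1) => μ) 0).symm
  convert h using 1
  ext p i
  simp [MeasurableEquiv.piFinSuccAbove, Fin.insertNthEquiv]

theorem measurableEmbedding_cons (m : ℕ) :
    MeasurableEmbedding (fun p : X × (Fin m → X) => (Fin.cons p.1 p.2 : Fin (m + 1) → X)) := by
  have h := (MeasurableEquiv.piFinSuccAbove (fun _ : Fin (m + 1) => X) 0).symm.measurableEmbedding
  convert h using 1
  ext p i
  simp [MeasurableEquiv.piFinSuccAbove, Fin.insertNthEquiv]

theorem integral_pi_succ (μ : Measure X) [IsProbabilityMeasure μ] (F : (Fin (m + 1) → X) → ℝ) :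
    ∫ y, F y ∂(Measure.pi fun _ => μ) =
      ∫ p : X × (Fin m → X), F (Fin.cons p.1 p.2) ∂(μ.prod (Measure.pi fun _ => μ)) :=
  ((measurePreserving_cons μ m).integral_comp (measurableEmbedding_cons m) F).symm

/-- Changing one coordinate increases `f` by at most one. -/
def BoundedDiff (f : (Fin m → X) → ℝ) : Prop :=
  ∀ (y : Fin m → X) (i : Fin m) (z : X), f (Function.update y i z) ≤ f y + 1

theorem BoundedDiff.cons {f : (Fin (m + 1) → X) → ℝ} (hf : BoundedDiff f) (x : X) :
    BoundedDiff fun y : Fin m → X => f (Fin.cons x y) := by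
  intro y i z
  have := hf (Fin.cons x y) i.succ z
  rwa [← Fin.cons_update] at this

theorem BoundedDiff.cons_le {f : (Fin (m + 1) → X) → ℝ} (hf : BoundedDiff f) (x x' : X)
    (y : Fin m → X) : f (Fin.cons x y) ≤ f (Fin.cons x' y) + 1 := by
  have := hf (Fin.cons x' y) 0 x
  rwa [Fin.update_cons_zero] at this

theorem BoundedDiff.le_add {f : (Fin m → X) → ℝ} (hf : BoundedDiff f) (y y' : Fin m → X) :
    f y ≤ f y' + m := by
  induction m with
  | zero => simp [Subsingleton.elim y y']
  | succ m ih =>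
    rw [← Fin.cons_self_tail y, ← Fin.cons_self_tail y']
    have h1 := ih (hf.cons (y 0)) (Fin.tail y) (Fin.tail y')
    have h2 := hf.cons_le (y 0) (y' 0) (Fin.tail y')
    push_cast
    linarith

theorem BoundedDiff.exists_bound [Nonempty X] {f : (Fin m → X) → ℝ} (hf : BoundedDiff f) :
    ∃ B, ∀ y, |f y| ≤ B := by
  let y₀ : Fin m → X := fun _ => Classical.arbitrary X
  refine ⟨|f y₀| + m, fun y => ?_⟩
  have h1 := hf.le_add y y₀
  have h2 := hf.le_add y₀ y
  rw [abs_le]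
  constructor <;> linarith [neg_abs_le (f y₀), le_abs_self (f y₀)]

theorem integrable_of_forall_abs_le {Y : Type*} [MeasurableSpace Y] {ν : Measure Y}
    [IsFiniteMeasure ν] {f : Y → ℝ} (hf : Measurable f) {B : ℝ} (hB : ∀ y, |f y| ≤ B) :
    Integrable f ν :=
  Integrable.of_bound hf.aestronglyMeasurable B (Filter.Eventually.of_forall hB)

/-- Hoeffding's lemma for a variable with oscillation at most one. -/
theorem integral_exp_le_of_oscillation {μ : Measure X} [IsProbabilityMeasure μ] {g : X → ℝ}
    (hg : Measurable g) (hosc : ∀ x x', g x ≤ g x' + 1) (t : ℝ) :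
    ∫ x, Real.exp (t * g x) ∂μ ≤ Real.exp (t * (∫ x, g x ∂μ) + t ^ 2 / 8) := by
  have hne : Nonempty X := μ.nonempty_of_neZero
  have hbdd : BddBelow (Set.range g) := by
    refine ⟨g (Classical.arbitrary X) - 1, ?_⟩
    rintro _ ⟨x, rfl⟩
    linarith [hosc (Classical.arbitrary X) x]
  have hmem : ∀ x, g x ∈ Set.Icc (⨅ x, g x) ((⨅ x, g x) + 1) := by
    intro x
    refine ⟨ciInf_le hbdd x, ?_⟩
    rw [← sub_le_iff_le_add]
    exact le_ciInf fun x' => by linarith [hosc x x']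
  have h := (hasSubgaussianMGF_of_mem_Icc hg.aemeasurable
    (Filter.Eventually.of_forall hmem : ∀ᵐ x ∂μ, _)).mgf_le t
  simp only [mgf, add_sub_cancel_left] at h
  have h1 : ∀ x, Real.exp (t * g x) =
      Real.exp (t * ∫ x, g x ∂μ) * Real.exp (t * (g x - ∫ x, g x ∂μ)) := fun x => by
    rw [← Real.exp_add]; ring_nf
  simp_rw [h1]
  rw [integral_const_mul, Real.exp_add]
  refine mul_le_mul_of_nonneg_left (h.trans (le_of_eq ?_)) (Real.exp_nonneg _)
  congr 1
  simp
  ring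

/-- Exponential moment form of the bounded difference inequality. -/
theorem BoundedDiff.integral_exp_le (μ : Measure X) [IsProbabilityMeasure μ]
    {f : (Fin m → X) → ℝ} (hf : BoundedDiff f) (hm : Measurable f) (t : ℝ) :
    ∫ y, Real.exp (t * f y) ∂(Measure.pi fun _ => μ) ≤
      Real.exp (t * (∫ y, f y ∂(Measure.pi fun _ => μ)) + m * t ^ 2 / 8) := by
  have hne : Nonempty X := μ.nonempty_of_neZero
  induction m with
  | zero =>
    have h : ∀ y, f y = f default := fun y => by rw [Subsingleton.elim y default]
    simp_rw [h]
    simp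
  | succ m ih =>
    have hmc : Measurable fun p : X × (Fin m → X) => f (Fin.cons p.1 p.2) :=
      hm.comp (measurePreserving_cons μ m).measurable
    obtain ⟨B, hB⟩ := hf.exists_bound
    rw [integral_pi_succ, integral_pi_succ]
    have hint : Integrable (fun p : X × (Fin m → X) => f (Fin.cons p.1 p.2))
        (μ.prod (Measure.pi fun _ => μ)) := integrable_of_forall_abs_le hmc fun p => hB _
    have hexp : Integrable (fun p : X × (Fin m → X) => Real.exp (t * f (Fin.cons p.1 p.2)))
        (μ.prod (Measure.pi fun _ => μ)) := by
      refine integrable_of_forall_abs_le (B := Real.exp (|t| * B))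
        (Real.measurable_exp.comp (hmc.const_mul t)) fun p => ?_
      rw [abs_of_nonneg (Real.exp_nonneg _)]
      refine Real.exp_le_exp.2 ((le_abs_self _).trans ?_)
      rw [abs_mul]
      exact mul_le_mul_of_nonneg_left (hB _) (abs_nonneg _)
    rw [integral_prod_symm _ hint, integral_prod_symm _ hexp]
    -- The mean over the first coordinate inherits bounded differences, so the induction hypothesis
    -- applies to it. Hoeffding's lemma in the first coordinate contributes one factor `exp (t² /
    -- 8)`.
    set g : (Fin m → X) → ℝ := fun y => ∫ x, f (Fin.cons x y) ∂μ with hg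
    have hgm : Measurable g := by
      have : Measurable fun p : (Fin m → X) × X => f (Fin.cons p.2 p.1) := hmc.comp measurable_swap
      exact this.stronglyMeasurable.integral_prod_right.measurable
    have hsec : ∀ y : Fin m → X, Measurable fun x => f (Fin.cons x y) := fun y =>
      hmc.comp (measurable_id.prodMk measurable_const)
    have hgd : BoundedDiff g := by
      intro y i z
      have h1 : ∫ x, (f (Fin.cons x y) + 1) ∂μ = g y + 1 := by
        rw [integral_add (integrable_of_forall_abs_le (hsec y) fun _ => hB _)
          (integrable_const _)]
        simp [hg]
      rw [← h1]
      refine integral_mono (integrable_of_forall_abs_le (hsec _) fun _ => hB _)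
        ((integrable_of_forall_abs_le (hsec y) fun _ => hB _).add (integrable_const _)) fun x => ?_
      exact hf.cons x y i z
    obtain ⟨B', hB'⟩ := hgd.exists_bound
    have hexpg : Integrable (fun y => Real.exp (t * g y)) (Measure.pi fun _ : Fin m => μ) := by
      refine integrable_of_forall_abs_le (B := Real.exp (|t| * B')) (by fun_prop) fun p => ?_
      rw [abs_of_nonneg (Real.exp_nonneg _)]
      refine Real.exp_le_exp.2 ((le_abs_self _).trans ?_)
      rw [abs_mul]
      exact mul_le_mul_of_nonneg_left (hB' _) (abs_nonneg _)
    calc ∫ y, ∫ x, Real.exp (t * f (Fin.cons x y)) ∂μ ∂(Measure.pi fun _ => μ)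
        ≤ ∫ y, Real.exp (t ^ 2 / 8) * Real.exp (t * g y) ∂(Measure.pi fun _ => μ) := by
          refine integral_mono hexp.integral_prod_right (hexpg.const_mul _) fun y => ?_
          have := integral_exp_le_of_oscillation (hsec y) (fun x x' => hf.cons_le x x' y) t (μ := μ)
          refine this.trans (le_of_eq ?_)
          rw [← Real.exp_add, add_comm (t ^ 2 / 8)]
      _ = Real.exp (t ^ 2 / 8) * ∫ y, Real.exp (t * g y) ∂(Measure.pi fun _ => μ) :=
          integral_const_mul _ _
      _ ≤ Real.exp (t ^ 2 / 8) *
            Real.exp (t * (∫ y, g y ∂(Measure.pi fun _ => μ)) + m * t ^ 2 / 8) :=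
          mul_le_mul_of_nonneg_left (ih hgd hgm) (Real.exp_nonneg _)
      _ = _ := by
          rw [← Real.exp_add]
          congr 1
          push_cast
          ring

/-- The bounded difference inequality. -/
theorem BoundedDiff.measureReal_le (μ : Measure X) [IsProbabilityMeasure μ]
    {f : (Fin m → X) → ℝ} (hf : BoundedDiff f) (hm : Measurable f) {r : ℝ} (hr : 0 ≤ r)
    (hmpos : 0 < m) :
    (Measure.pi fun _ => μ).real
      {y | (∫ y, f y ∂(Measure.pi fun _ => μ)) + r ≤ f y} ≤ Real.exp (-(2 * r ^ 2 / m)) := by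
  have hne : Nonempty X := μ.nonempty_of_neZero
  obtain ⟨B, hB⟩ := hf.exists_bound
  have hm0 : (0 : ℝ) < m := by exact_mod_cast hmpos
  -- The minimizer of `-t r + m t² / 8`.
  set t : ℝ := 4 * r / m with ht
  have ht0 : 0 ≤ t := by positivity
  have hexp : Integrable (fun y => Real.exp (t * f y)) (Measure.pi fun _ : Fin m => μ) := by
    refine integrable_of_forall_abs_le (B := Real.exp (|t| * B)) (by fun_prop) fun p => ?_
    rw [abs_of_nonneg (Real.exp_nonneg _)]
    refine Real.exp_le_exp.2 ((le_abs_self _).trans ?_)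
    rw [abs_mul]
    exact mul_le_mul_of_nonneg_left (hB _) (abs_nonneg _)
  have h1 := measure_ge_le_exp_mul_mgf (μ := Measure.pi fun _ : Fin m => μ) (X := f)
    ((∫ y, f y ∂(Measure.pi fun _ => μ)) + r) ht0 hexp
  refine h1.trans ?_
  have h2 := hf.integral_exp_le μ hm t
  unfold mgf
  refine (mul_le_mul_of_nonneg_left h2 (Real.exp_nonneg _)).trans (le_of_eq ?_)
  rw [← Real.exp_add]
  congr 1
  rw [ht]
  field_simp
  ring

end BoundedDifferences

/-! ### Maxima of finite families and contraction -/

section Maximum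

variable {ι : Type*} [Fintype ι] [Nonempty ι]

/-- The maximum of a finite family of reals. -/
noncomputable def vmax (f : ι → ℝ) : ℝ := Finset.univ.sup' Finset.univ_nonempty f

theorem le_vmax (f : ι → ℝ) (a : ι) : f a ≤ vmax f := Finset.le_sup' f (Finset.mem_univ a)

theorem vmax_le {f : ι → ℝ} {B : ℝ} (h : ∀ a, f a ≤ B) : vmax f ≤ B :=
  Finset.sup'_le _ _ fun a _ => h a

theorem exists_eq_vmax (f : ι → ℝ) : ∃ a, vmax f = f a := by
  obtain ⟨a, -, ha⟩ := Finset.exists_mem_eq_sup' (Finset.univ_nonempty (α := ι)) f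
  exact ⟨a, ha⟩

theorem continuous_vmax : Continuous (vmax : (ι → ℝ) → ℝ) := by
  unfold vmax
  exact Continuous.finset_sup'_apply _ fun i _ => continuous_apply i

theorem abs_vmax_le (f : ι → ℝ) : |vmax f| ≤ ∑ a, |f a| := by
  obtain ⟨a, ha⟩ := exists_eq_vmax f
  rw [ha]
  exact Finset.single_le_sum (f := fun a => |f a|) (fun _ _ => abs_nonneg _) (Finset.mem_univ a)

variable {Y : Type*} [MeasurableSpace Y] {ν : Measure Y}

theorem integrable_vmax {h : ι → Y → ℝ} (hh : ∀ a, Integrable (h a) ν) :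
    Integrable (fun y => vmax fun a => h a y) ν := by
  refine Integrable.mono' (integrable_finsetSum Finset.univ fun a _ => (hh a).abs) ?_
    (Filter.Eventually.of_forall fun y => abs_vmax_le _)
  exact continuous_vmax.comp_aestronglyMeasurable
    (aemeasurable_pi_iff.2 fun a => (hh a).aestronglyMeasurable.aemeasurable).aestronglyMeasurable

/-- Jensen's inequality for the maximum and a centered perturbation. -/
theorem vmax_le_integral [IsProbabilityMeasure ν] (u : ι → ℝ) {g : ι → Y → ℝ}
    (hg : ∀ a, Integrable (g a) ν) (h0 : ∀ a, ∫ z, g a z ∂ν = 0) :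
    vmax u ≤ ∫ z, vmax (fun a => u a + g a z) ∂ν := by
  have hi : ∀ a, Integrable (fun z => u a + g a z) ν := fun a => (integrable_const _).add (hg a)
  refine vmax_le fun a => ?_
  calc u a = ∫ z, (u a + g a z) ∂ν := by
        rw [integral_add (integrable_const _) (hg a), h0]; simp
    _ ≤ _ := integral_mono (hi a) (integrable_vmax hi) fun z => le_vmax (fun a => u a + g a z) a

/-- The contraction principle for one coordinate. At the two maximizers the left side contains `ψ a
- ψ b ≤ |l a - l b|`; according to the sign of `l a - l b`, the same points, in this order or
swapped, are test points on the right. -/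
theorem vmax_add_vmax_contraction (t ψ l : ι → ℝ) (h : ∀ a b, |ψ a - ψ b| ≤ |l a - l b|) :
    vmax (fun a => t a + 2 * ψ a) + vmax (fun a => t a - 2 * ψ a) ≤
      vmax (fun a => t a + 2 * l a) + vmax (fun a => t a - 2 * l a) := by
  obtain ⟨a, ha⟩ := exists_eq_vmax fun a => t a + 2 * ψ a
  obtain ⟨b, hb⟩ := exists_eq_vmax fun a => t a - 2 * ψ a
  rw [ha, hb]
  have h1 := (le_abs_self _).trans (h a b)
  rcases le_total 0 (l a - l b) with h2 | h2
  · rw [abs_of_nonneg h2] at h1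
    have := le_vmax (fun a => t a + 2 * l a) a
    have := le_vmax (fun a => t a - 2 * l a) b
    linarith
  · rw [abs_of_nonpos h2] at h1
    have := le_vmax (fun a => t a + 2 * l a) b
    have := le_vmax (fun a => t a - 2 * l a) a
    linarith

end Maximum

/-! ### Symmetrization and the small ball method -/

section SmallBall

variable {ι X : Type*} [Fintype ι] [Nonempty ι] [MeasurableSpace X] {μ : Measure X}
  [IsProbabilityMeasure μ] {ψ l : ι → X → ℝ}

/-- Symmetrization and contraction in one coordinate. -/
theorem integral_vmax_step (t : ι → ℝ) (hψ : ∀ a, Integrable (ψ a) μ)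
    (hl : ∀ a, Integrable (l a) μ) (hl0 : ∀ a, ∫ x, l a x ∂μ = 0)
    (hc : ∀ x a b, |ψ a x - ψ b x| ≤ |l a x - l b x|) :
    ∫ y, vmax (fun a => t a + (∫ x, ψ a x ∂μ - ψ a y)) ∂μ ≤
      ∫ p : X × X, vmax (fun a => t a + 2 * (l a p.1 - l a p.2)) ∂(μ.prod μ) := by
  have hc' : ∀ r : ℝ, Integrable (fun _ : X => r) μ := fun r => integrable_const r
  have i1 : Integrable (fun z => vmax fun a => t a + 2 * ψ a z) μ :=
    integrable_vmax fun a => (hc' _).add ((hψ a).const_mul 2)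
  have i2 : Integrable (fun z => vmax fun a => t a - 2 * ψ a z) μ :=
    integrable_vmax fun a => (hc' _).sub ((hψ a).const_mul 2)
  have i3 : Integrable (fun z => vmax fun a => t a + 2 * l a z) μ :=
    integrable_vmax fun a => (hc' _).add ((hl a).const_mul 2)
  have i4 : Integrable (fun z => vmax fun a => t a - 2 * l a z) μ :=
    integrable_vmax fun a => (hc' _).sub ((hl a).const_mul 2)
  have i5 : Integrable (fun p : X × X => vmax fun a => t a + 2 * (l a p.1 - l a p.2))
      (μ.prod μ) := integrable_vmax fun a => (integrable_const _).add
        ((((hl a).comp_fst μ).sub ((hl a).comp_snd μ)).const_mul 2)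
  -- The mean of `ψ` is an integral over an independent copy `z`. The maximum of `t + ψ(z) - ψ(y)`
  -- is at most the average of the maxima of `t + 2ψ(z)` and `t - 2ψ(y)`, which decouples the copies
  -- without random signs.
  have s1 : ∀ y, vmax (fun a => t a + (∫ x, ψ a x ∂μ - ψ a y)) ≤
      (∫ z, vmax (fun a => t a + 2 * ψ a z) ∂μ) / 2 + vmax (fun a => t a - 2 * ψ a y) / 2 := by
    intro y
    have h1 := vmax_le_integral (ν := μ) (fun a => t a + (∫ x, ψ a x ∂μ - ψ a y))
      (g := fun a z => ψ a z - ∫ x, ψ a x ∂μ) (fun a => (hψ a).sub (hc' _))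
      (fun a => by rw [integral_sub (hψ a) (hc' _)]; simp)
    refine h1.trans ?_
    have h2 : (∫ z, vmax (fun a => t a + 2 * ψ a z) ∂μ) / 2 + vmax (fun a => t a - 2 * ψ a y) / 2
        = ∫ z, (vmax (fun a => t a + 2 * ψ a z) / 2 + vmax (fun a => t a - 2 * ψ a y) / 2) ∂μ := by
      rw [integral_add (i1.div_const 2) (hc' _), integral_div]; simp
    rw [h2]
    refine integral_mono (integrable_vmax fun a => (hc' _).add ((hψ a).sub (hc' _)))
      ((i1.div_const 2).add (hc' _)) fun z => ?_
    refine vmax_le fun a => ?_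
    have := le_vmax (fun a => t a + 2 * ψ a z) a
    have := le_vmax (fun a => t a - 2 * ψ a y) a
    linarith
  -- The decoupled maxima of the centered `l` are recombined: by Jensen, inserting an independent
  -- copy of mean zero can only increase the mean of the maximum.
  have s2 : ∫ z, vmax (fun a => t a + 2 * l a z) ∂μ ≤
      ∫ p : X × X, vmax (fun a => t a + 2 * (l a p.1 - l a p.2)) ∂(μ.prod μ) := by
    rw [integral_prod _ i5]
    refine integral_mono i3 i5.integral_prod_left fun z => ?_
    have h1 := vmax_le_integral (ν := μ) (fun a => t a + 2 * l a z)
      (g := fun a z' => -(2 * l a z')) (fun a => ((hl a).const_mul 2).neg)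
      (fun a => by rw [integral_neg, integral_const_mul, hl0]; simp)
    refine h1.trans (le_of_eq ?_)
    congr 1; ext z'; congr 1; ext a; ring
  have s3 : ∫ z, vmax (fun a => t a - 2 * l a z) ∂μ ≤
      ∫ p : X × X, vmax (fun a => t a + 2 * (l a p.1 - l a p.2)) ∂(μ.prod μ) := by
    rw [integral_prod_symm _ i5]
    refine integral_mono i4 i5.integral_prod_right fun z => ?_
    have h1 := vmax_le_integral (ν := μ) (fun a => t a - 2 * l a z)
      (g := fun a z' => 2 * l a z') (fun a => (hl a).const_mul 2)
      (fun a => by rw [integral_const_mul, hl0]; simp)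
    refine h1.trans (le_of_eq ?_)
    congr 1; ext z'; congr 1; ext a; ring
  have s4 : ∫ z, vmax (fun a => t a + 2 * ψ a z) ∂μ + ∫ z, vmax (fun a => t a - 2 * ψ a z) ∂μ ≤
      ∫ z, vmax (fun a => t a + 2 * l a z) ∂μ + ∫ z, vmax (fun a => t a - 2 * l a z) ∂μ := by
    rw [← integral_add i1 i2, ← integral_add i3 i4]
    exact integral_mono (i1.add i2) (i3.add i4) fun z =>
      vmax_add_vmax_contraction t (fun a => ψ a z) (fun a => l a z) (hc z)
  have s5 : ∫ y, vmax (fun a => t a + (∫ x, ψ a x ∂μ - ψ a y)) ∂μ ≤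
      (∫ z, vmax (fun a => t a + 2 * ψ a z) ∂μ) / 2 +
        (∫ z, vmax (fun a => t a - 2 * ψ a z) ∂μ) / 2 := by
    have h2 : (∫ z, vmax (fun a => t a + 2 * ψ a z) ∂μ) / 2 +
        (∫ z, vmax (fun a => t a - 2 * ψ a z) ∂μ) / 2 =
        ∫ y, ((∫ z, vmax (fun a => t a + 2 * ψ a z) ∂μ) / 2 +
          vmax (fun a => t a - 2 * ψ a y) / 2) ∂μ := by
      rw [integral_add (hc' _) (i2.div_const 2)]; simp [integral_div]
    rw [h2]
    exact integral_mono (integrable_vmax fun a => (hc' _).add ((hc' _).sub (hψ a)))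
      ((hc' _).add (i2.div_const 2)) s1
  linarith

theorem integrable_comp_eval {m : ℕ} {f : X → ℝ} (hf : Integrable f μ) (i : Fin m) :
    Integrable (fun y : Fin m → X => f (y i)) (Measure.pi fun _ => μ) :=
  (measurePreserving_eval (fun _ => μ) i).integrable_comp_of_integrable hf

/-- Symmetrization and contraction. -/
theorem integral_vmax_sum_le (m : ℕ) (t : ι → ℝ) (hψ : ∀ a, Integrable (ψ a) μ)
    (hl : ∀ a, Integrable (l a) μ) (hl0 : ∀ a, ∫ x, l a x ∂μ = 0)
    (hc : ∀ x a b, |ψ a x - ψ b x| ≤ |l a x - l b x|) :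
    ∫ y : Fin m → X, vmax (fun a => t a + ∑ i, (∫ x, ψ a x ∂μ - ψ a (y i)))
        ∂(Measure.pi fun _ => μ) ≤
      ∫ p : Fin m → X × X, vmax (fun a => t a + ∑ i, 2 * (l a (p i).1 - l a (p i).2))
        ∂(Measure.pi fun _ => μ.prod μ) := by
  induction m generalizing t with
  | zero => simp
  | succ m ih =>
    have iψ : ∀ a, Integrable (fun y => ∫ x, ψ a x ∂μ - ψ a y) μ :=
      fun a => (integrable_const _).sub (hψ a)
    have il : ∀ a, Integrable (fun p : X × X => 2 * (l a p.1 - l a p.2)) (μ.prod μ) :=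
      fun a => (((hl a).comp_fst μ).sub ((hl a).comp_snd μ)).const_mul 2
    have iψs : ∀ a, Integrable (fun y : Fin m → X => ∑ i, (∫ x, ψ a x ∂μ - ψ a (y i)))
        (Measure.pi fun _ => μ) :=
      fun a => integrable_finsetSum _ fun i _ => integrable_comp_eval (iψ a) i
    have ils : ∀ a, Integrable (fun p : Fin m → X × X => ∑ i, 2 * (l a (p i).1 - l a (p i).2))
        (Measure.pi fun _ => μ.prod μ) :=
      fun a => integrable_finsetSum _ fun i _ => integrable_comp_eval (il a) i
    rw [integral_pi_succ, integral_pi_succ]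
    simp only [Fin.sum_univ_succ, Fin.cons_zero, Fin.cons_succ]
    have I1 : Integrable (fun p : X × (Fin m → X) => vmax fun a => t a +
        ((∫ x, ψ a x ∂μ - ψ a p.1) + ∑ i, (∫ x, ψ a x ∂μ - ψ a (p.2 i))))
        (μ.prod (Measure.pi fun _ => μ)) :=
      integrable_vmax fun a => (integrable_const _).add
        (((iψ a).comp_fst _).add ((iψs a).comp_snd _))
    have I2 : Integrable (fun p : (X × X) × (Fin m → X × X) => vmax fun a => t a +
        (2 * (l a p.1.1 - l a p.1.2) + ∑ i, 2 * (l a (p.2 i).1 - l a (p.2 i).2)))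
        ((μ.prod μ).prod (Measure.pi fun _ => μ.prod μ)) :=
      integrable_vmax fun a => (integrable_const _).add
        (((il a).comp_fst _).add ((ils a).comp_snd _))
    have I3 : Integrable (fun p : (X × X) × (Fin m → X) => vmax fun a =>
        (t a + ∑ i, (∫ x, ψ a x ∂μ - ψ a (p.2 i))) + 2 * (l a p.1.1 - l a p.1.2))
        ((μ.prod μ).prod (Measure.pi fun _ => μ)) :=
      integrable_vmax fun a => ((integrable_const _).add ((iψs a).comp_snd _)).add
        ((il a).comp_fst _)
    rw [integral_prod_symm _ I1, integral_prod _ I2]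
    calc ∫ y : Fin m → X, ∫ x, vmax (fun a => t a +
            ((∫ x, ψ a x ∂μ - ψ a x) + ∑ i, (∫ x, ψ a x ∂μ - ψ a (y i)))) ∂μ
            ∂(Measure.pi fun _ => μ)
        ≤ ∫ y : Fin m → X, ∫ p : X × X, vmax (fun a =>
            (t a + ∑ i, (∫ x, ψ a x ∂μ - ψ a (y i))) + 2 * (l a p.1 - l a p.2)) ∂(μ.prod μ)
            ∂(Measure.pi fun _ => μ) := by
          refine integral_mono I1.integral_prod_right I3.integral_prod_right fun y => ?_
          refine (le_of_eq ?_).trans (integral_vmax_step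
            (fun a => t a + ∑ i, (∫ x, ψ a x ∂μ - ψ a (y i))) hψ hl hl0 hc)
          congr 1; ext x; congr 1; ext a; ring
      _ = ∫ p : X × X, ∫ y : Fin m → X, vmax (fun a =>
            (t a + ∑ i, (∫ x, ψ a x ∂μ - ψ a (y i))) + 2 * (l a p.1 - l a p.2))
            ∂(Measure.pi fun _ => μ) ∂(μ.prod μ) := by
          rw [← integral_prod_symm _ I3, integral_prod _ I3]
      _ ≤ _ := by
          refine integral_mono I3.integral_prod_left I2.integral_prod_left fun p => ?_
          refine (le_of_eq ?_).trans ((ih fun a => t a + 2 * (l a p.1 - l a p.2)).trans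
            (le_of_eq ?_))
          · congr 1; ext y; congr 1; ext a; ring
          · congr 1; ext y; congr 1; ext a; ring

/-- After contraction only the linear sums remain. The factor 4 is the factor 2 from decoupling
times the two copies. -/
theorem integral_vmax_le_of_bound {m : ℕ} (hψ : ∀ a, Integrable (ψ a) μ)
    (hl : ∀ a, Integrable (l a) μ) (hl0 : ∀ a, ∫ x, l a x ∂μ = 0)
    (hc : ∀ x a b, |ψ a x - ψ b x| ≤ |l a x - l b x|) {Γ : (Fin m → X) → ℝ}
    (hΓ : Integrable Γ (Measure.pi fun _ => μ)) (hle : ∀ y a, |∑ i, l a (y i)| ≤ Γ y) :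
    ∫ y : Fin m → X, vmax (fun a => ∑ i, (∫ x, ψ a x ∂μ - ψ a (y i))) ∂(Measure.pi fun _ => μ) ≤
      4 * ∫ y, Γ y ∂(Measure.pi fun _ => μ) := by
  have h1 := integral_vmax_sum_le m (fun _ => 0) hψ hl hl0 hc
  simp only [zero_add] at h1
  refine h1.trans ?_
  have m1 : MeasurePreserving (fun (p : Fin m → X × X) i => (p i).1)
      (Measure.pi fun _ => μ.prod μ) (Measure.pi fun _ => μ) :=
    measurePreserving_pi _ _ fun _ => measurePreserving_fst
  have m2 : MeasurePreserving (fun (p : Fin m → X × X) i => (p i).2)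
      (Measure.pi fun _ => μ.prod μ) (Measure.pi fun _ => μ) :=
    measurePreserving_pi _ _ fun _ => measurePreserving_snd
  have i1 := m1.integrable_comp_of_integrable hΓ
  have i2 := m2.integrable_comp_of_integrable hΓ
  have e1 : ∫ p : Fin m → X × X, Γ (fun i => (p i).1) ∂(Measure.pi fun _ => μ.prod μ) =
      ∫ y, Γ y ∂(Measure.pi fun _ => μ) := by
    rw [← m1.map_eq, integral_map m1.measurable.aemeasurable]
    rw [m1.map_eq]; exact hΓ.aestronglyMeasurable
  have e2 : ∫ p : Fin m → X × X, Γ (fun i => (p i).2) ∂(Measure.pi fun _ => μ.prod μ) =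
      ∫ y, Γ y ∂(Measure.pi fun _ => μ) := by
    rw [← m2.map_eq, integral_map m2.measurable.aemeasurable]
    rw [m2.map_eq]; exact hΓ.aestronglyMeasurable
  calc _ ≤ ∫ p : Fin m → X × X, (2 * Γ (fun i => (p i).1) + 2 * Γ (fun i => (p i).2))
        ∂(Measure.pi fun _ => μ.prod μ) := by
        refine integral_mono (integrable_vmax fun a => integrable_finsetSum _ fun i _ =>
          integrable_comp_eval ((((hl a).comp_fst μ).sub ((hl a).comp_snd μ)).const_mul 2) i)
          ((i1.const_mul 2).add (i2.const_mul 2)) fun p => ?_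
        refine vmax_le fun a => ?_
        have h2 := abs_le.1 (hle (fun i => (p i).1) a)
        have h3 := abs_le.1 (hle (fun i => (p i).2) a)
        rw [← Finset.mul_sum, Finset.sum_sub_distrib]
        linarith
    _ = _ := by
        refine (integral_add (i1.const_mul 2) (i2.const_mul 2)).trans ?_
        rw [integral_const_mul, integral_const_mul]
        simp only [Function.comp_def]
        rw [e1, e2]; ring

/-- The small ball method for a finite family of functions. -/
theorem measureReal_exists_sum_le {m : ℕ} (hm : 0 < m) (hψm : ∀ a, Measurable (ψ a))
    (hψ0 : ∀ a x, 0 ≤ ψ a x) (hψ1 : ∀ a x, ψ a x ≤ 1)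
    (hl : ∀ a, Integrable (l a) μ) (hl0 : ∀ a, ∫ x, l a x ∂μ = 0)
    (hc : ∀ x a b, |ψ a x - ψ b x| ≤ |l a x - l b x|) {Γ : (Fin m → X) → ℝ}
    (hΓ : Integrable Γ (Measure.pi fun _ => μ)) (hle : ∀ y a, |∑ i, l a (y i)| ≤ Γ y)
    {c : ℝ} (hc0 : 0 ≤ c) (hcψ : ∀ a, c ≤ ∫ x, ψ a x ∂μ)
    (hΓc : ∫ y, Γ y ∂(Measure.pi fun _ => μ) ≤ c * m / 16) :
    (Measure.pi fun _ => μ).real {y : Fin m → X | ∃ a, ∑ i, ψ a (y i) ≤ c * m / 2} ≤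
      Real.exp (-(c ^ 2 * m / 8)) := by
  have hm0 : (0 : ℝ) < m := by exact_mod_cast hm
  have hψ : ∀ a, Integrable (ψ a) μ := fun a => integrable_of_forall_abs_le (hψm a) (B := 1)
    fun x => abs_le.2 ⟨by linarith [hψ0 a x], hψ1 a x⟩
  -- The largest deficit of the empirical sums below their means. Its mean is at most `4 · cm/16 =
  -- cm/4`, and a deviation by another `cm/4` leaves at least `cm/2` of the mean `cm`.
  set Z : (Fin m → X) → ℝ := fun y => vmax fun a => ∑ i, (∫ x, ψ a x ∂μ - ψ a (y i)) with hZ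
  have hZm : Measurable Z := by
    refine continuous_vmax.measurable.comp (measurable_pi_iff.2 fun a => ?_)
    exact Finset.measurable_sum _ fun i _ =>
      measurable_const.sub ((hψm a).comp (measurable_pi_apply i))
  have hZd : BoundedDiff Z := by
    intro y i z
    refine vmax_le fun a => le_trans ?_ (add_le_add_left (le_vmax _ a) 1)
    rw [← Finset.add_sum_erase _ _ (Finset.mem_univ i),
      ← Finset.add_sum_erase _ (fun i => ∫ x, ψ a x ∂μ - ψ a (y i)) (Finset.mem_univ i)]
    have : ∑ j ∈ Finset.univ.erase i, (∫ x, ψ a x ∂μ - ψ a (Function.update y i z j)) =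
        ∑ j ∈ Finset.univ.erase i, (∫ x, ψ a x ∂μ - ψ a (y j)) :=
      Finset.sum_congr rfl fun j hj => by
        rw [Function.update_of_ne (Finset.ne_of_mem_erase hj)]
    rw [this, Function.update_self]
    linarith [hψ0 a z, hψ1 a (y i)]
  have hEZ := integral_vmax_le_of_bound hψ hl hl0 hc hΓ hle
  have hdev := hZd.measureReal_le μ hZm (r := c * m / 4) (by positivity) hm
  refine le_trans (measureReal_mono fun y hy => ?_) (hdev.trans (le_of_eq ?_))
  · obtain ⟨a, ha⟩ := hy
    have h1 : ∑ i, (∫ x, ψ a x ∂μ - ψ a (y i)) ≤ Z y :=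
      le_vmax (fun a => ∑ i, (∫ x, ψ a x ∂μ - ψ a (y i))) a
    rw [Finset.sum_sub_distrib, Finset.sum_const, Finset.card_univ, Fintype.card_fin,
      nsmul_eq_mul] at h1
    have h2 := mul_le_mul_of_nonneg_left (hcψ a) hm0.le
    change (∫ y, Z y ∂(Measure.pi fun _ => μ)) + c * m / 4 ≤ Z y
    have h3 : ∫ y, Z y ∂(Measure.pi fun _ => μ) ≤ c * m / 4 := by
      refine hEZ.trans ?_; linarith
    linarith
  · congr 1
    field_simp
    ring

end SmallBall

/-- A Lipschitz substitute for the indicator of `{t | u ≤ |t|}`. -/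
noncomputable def ramp (u t : ℝ) : ℝ := min 1 (max 0 (|t| / u - 1))

theorem ramp_nonneg (u t : ℝ) : 0 ≤ ramp u t := le_min zero_le_one (le_max_left _ _)

theorem ramp_le_one (u t : ℝ) : ramp u t ≤ 1 := min_le_left _ _

theorem continuous_ramp (u : ℝ) : Continuous (ramp u) := by unfold ramp; fun_prop

theorem ramp_eq_one {u t : ℝ} (hu : 0 < u) (h : 2 * u ≤ |t|) : ramp u t = 1 := by
  have : 2 ≤ |t| / u := by rwa [le_div_iff₀ hu]
  rw [ramp, max_eq_right (by linarith), min_eq_left (by linarith)]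

/-- Returns from ramps to squares: lower bounds for sums of ramps become lower bounds for quadratic
sums. -/
theorem ramp_mul_sq_le {u : ℝ} (hu : 0 < u) (t : ℝ) : ramp u t * u ^ 2 ≤ t ^ 2 := by
  rcases le_total (|t|) u with h | h
  · have h1 : |t| / u ≤ 1 := by rwa [div_le_one hu]
    rw [ramp, max_eq_left (by linarith), min_eq_right zero_le_one, zero_mul]
    positivity
  · have h1 : u ^ 2 ≤ t ^ 2 := by rw [← sq_abs t]; gcongr
    nlinarith [ramp_le_one u t, ramp_nonneg u t]

/-- The Lipschitz bound that contraction requires. Unlike an indicator, the ramp is compared with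
the linear form divided by `u`. -/
theorem abs_ramp_sub_le (u t t' : ℝ) :
    |ramp u t - ramp u t'| ≤ |(t - t') / u| := by
  unfold ramp
  have h1 := abs_min_sub_min_le_max 1 (max 0 (|t| / u - 1)) 1 (max 0 (|t'| / u - 1))
  have h2 := abs_max_sub_max_le_max 0 (|t| / u - 1) 0 (|t'| / u - 1)
  simp only [sub_self, abs_zero] at h1 h2
  refine h1.trans (max_le (abs_nonneg _) (h2.trans (max_le (abs_nonneg _) ?_)))
  rw [sub_sub_sub_cancel_right, ← sub_div, abs_div, abs_div]
  exact div_le_div_of_nonneg_right (abs_abs_sub_abs_le_abs_sub t t') (abs_nonneg _)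

/-! ### The small ball method for sets of vectors -/

section VectorSmallBall

variable {E : Type*} [NormedAddCommGroup E] [InnerProductSpace ℝ E] [MeasurableSpace E]
  [BorelSpace E] [SecondCountableTopology E] {μ : Measure E} [IsProbabilityMeasure μ]

/-- Contraction involves only differences of linear forms, so all vectors may be shifted by a common
centre `w` in the linear process, while the small ball condition and the conclusion concern the
unshifted vectors. -/
theorem measureReal_exists_fin_lt {m : ℕ} (hm : 0 < m) (hμ : ∀ x, Integrable (fun y => inner ℝ y x) μ)
    (hμ0 : ∀ x, ∫ y, inner ℝ y x ∂μ = 0) {ι : Type*} [Fintype ι] [Nonempty ι] (x : ι → E) (w : E)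
    {u c : ℝ} (hu : 0 < u) (hc : 0 ≤ c) (hsb : ∀ a, c ≤ μ.real {y | 2 * u ≤ |inner ℝ y (x a)|})
    {G : (Fin m → E) → ℝ} (hG : Integrable G (Measure.pi fun _ => μ))
    (hle : ∀ y a, |inner ℝ (∑ i, y i) (x a - w)| ≤ G y)
    (hGc : ∫ y, G y ∂(Measure.pi fun _ => μ) ≤ u * c * m / 16) :
    (Measure.pi fun _ => μ).real
      {y : Fin m → E | ∃ a, ∑ i, inner ℝ (y i) (x a) ^ 2 < u ^ 2 * (c * m / 2)} ≤
      Real.exp (-(c ^ 2 * m / 8)) := by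
  have hmeas : ∀ a, Measurable fun y => ramp u (inner ℝ y (x a)) := fun a =>
    (continuous_ramp u).measurable.comp (by fun_prop)
  have h := measureReal_exists_sum_le (μ := μ) (m := m) hm
    (ψ := fun a y => ramp u (inner ℝ y (x a))) (l := fun a y => inner ℝ y (x a - w) / u)
    hmeas (fun a y => ramp_nonneg _ _) (fun a y => ramp_le_one _ _)
    (fun a => (hμ _).div_const u) (fun a => by rw [integral_div, hμ0, zero_div])
    (fun y a b => by
      refine (abs_ramp_sub_le u _ _).trans (le_of_eq ?_)
      rw [← sub_div, ← inner_sub_right, ← inner_sub_right, sub_sub_sub_cancel_right])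
    (Γ := fun y => G y / u) (hG.div_const u)
    (fun y a => by
      rw [← Finset.sum_div, abs_div, abs_of_pos hu, ← sum_inner]
      exact div_le_div_of_nonneg_right (hle y a) hu.le)
    hc (fun a => by
      have hset : MeasurableSet {y : E | 2 * u ≤ |inner ℝ y (x a)|} :=
        measurableSet_le measurable_const (by fun_prop)
      refine (hsb a).trans ?_
      rw [← integral_indicator_one hset]
      refine integral_mono ((integrable_const (1 : ℝ)).indicator hset)
        (integrable_of_forall_abs_le (hmeas a) (B := 1) fun y => by
          rw [abs_of_nonneg (ramp_nonneg _ _)]; exact ramp_le_one _ _) fun y => ?_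
      by_cases hy : 2 * u ≤ |inner ℝ y (x a)|
      · rw [Set.indicator_of_mem (by exact hy)]
        exact (ramp_eq_one hu hy).ge
      · rw [Set.indicator_of_notMem (by exact hy)]
        exact ramp_nonneg _ _)
    (by rw [integral_div, div_le_iff₀ hu]; linarith)
  refine (measureReal_mono fun y hy => ?_).trans h
  obtain ⟨a, ha⟩ := hy
  refine ⟨a, ?_⟩
  have h1 : (∑ i, ramp u (inner ℝ (y i) (x a))) * u ^ 2 ≤ ∑ i, inner ℝ (y i) (x a) ^ 2 := by
    rw [Finset.sum_mul]
    exact Finset.sum_le_sum fun i _ => ramp_mul_sq_le hu _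
  have hu2 : 0 < u ^ 2 := by positivity
  nlinarith

/-- The small ball method for an arbitrary set of vectors. -/
theorem measureReal_exists_mem_lt {m : ℕ} (hm : 0 < m)
    (hμ : ∀ x, Integrable (fun y => inner ℝ y x) μ)
    (hμ0 : ∀ x, ∫ y, inner ℝ y x ∂μ = 0) (T : Set E) (w : E)
    {u c : ℝ} (hu : 0 < u) (hc : 0 ≤ c)
    (hsb : ∀ x ∈ T, c ≤ μ.real {y | 2 * u ≤ |inner ℝ y x|})
    {G : (Fin m → E) → ℝ} (hG : Integrable G (Measure.pi fun _ => μ))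
    (hle : ∀ y, ∀ x ∈ T, |inner ℝ (∑ i, y i) (x - w)| ≤ G y)
    (hGc : ∫ y, G y ∂(Measure.pi fun _ => μ) ≤ u * c * m / 16) :
    (Measure.pi fun _ => μ).real
      {y : Fin m → E | ∃ x ∈ T, ∑ i, inner ℝ (y i) x ^ 2 < u ^ 2 * (c * m / 2)} ≤
      Real.exp (-(c ^ 2 * m / 8)) := by
  rcases T.eq_empty_or_nonempty with rfl | hT
  · simp [Real.exp_nonneg]
  have hne : Nonempty T := hT.to_subtype
  -- The quadratic sum is continuous in the vector and the inequality is strict, so violations are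
  -- detected on a dense sequence. The finite case covers its initial segments with a bound
  -- independent of their length.
  let x : ℕ → T := TopologicalSpace.denseSeq T
  let A : ℕ → Set (Fin m → E) := fun N =>
    {y | ∃ a : Fin (N + 1), ∑ i, inner ℝ (y i) (x a : E) ^ 2 < u ^ 2 * (c * m / 2)}
  have hmono : Monotone A := by
    intro N M hNM y hy
    obtain ⟨a, ha⟩ := hy
    exact ⟨⟨a, by omega⟩, ha⟩
  have hsub : {y : Fin m → E | ∃ x ∈ T, ∑ i, inner ℝ (y i) x ^ 2 < u ^ 2 * (c * m / 2)} ⊆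
      ⋃ N, A N := by
    rintro y ⟨z, hz, hlt⟩
    have hopen : IsOpen {z : T | ∑ i, inner ℝ (y i) (z : E) ^ 2 < u ^ 2 * (c * m / 2)} :=
      isOpen_lt (by fun_prop) continuous_const
    obtain ⟨_, hmem, N, rfl⟩ := (TopologicalSpace.denseRange_denseSeq T).exists_mem_open hopen
      ⟨⟨z, hz⟩, hlt⟩ |>.elim fun N h => (⟨_, h, N, rfl⟩ : ∃ z', z' ∈ {z : T |
        ∑ i, inner ℝ (y i) (z : E) ^ 2 < u ^ 2 * (c * m / 2)} ∧ ∃ N, x N = z')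
    exact Set.mem_iUnion.2 ⟨N, ⟨N, by omega⟩, hmem⟩
  have hA : ∀ N, (Measure.pi fun _ : Fin m => μ) (A N) ≤
      ENNReal.ofReal (Real.exp (-(c ^ 2 * m / 8))) := by
    intro N
    rw [← ofReal_measureReal]
    exact ENNReal.ofReal_le_ofReal (measureReal_exists_fin_lt hm hμ hμ0
      (fun a : Fin (N + 1) => (x a : E)) w hu hc (fun a => hsb _ (x a).2) hG
      (fun y a => hle y _ (x a).2) hGc)
  refine ENNReal.toReal_le_of_le_ofReal (Real.exp_nonneg _) ?_
  refine (measure_mono hsub).trans ?_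
  rw [hmono.measure_iUnion]
  exact iSup_le hA

end VectorSmallBall

/-! ### Small ball estimate for the rows of the dictionary -/

section Moments

variable {Ω : Type*} [MeasurableSpace Ω] {P : Measure Ω} [IsProbabilityMeasure P] {X : Ω → ℝ}

/-- Reading off a moment bound from an `L^p`-norm bound. -/
theorem integrable_and_integral_rpow_le (hX : Measurable X) {p B : ℝ} (hp : 0 < p) (hB : 0 ≤ B)
    (h : eLpNorm X (ENNReal.ofReal p) P ≤ ENNReal.ofReal B) :
    Integrable (fun ω => |X ω| ^ p) P ∧ ∫ ω, |X ω| ^ p ∂P ≤ B ^ p := by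
  have hmem : MemLp X (ENNReal.ofReal p) P :=
    ⟨hX.aestronglyMeasurable, h.trans_lt ENNReal.ofReal_lt_top⟩
  have hp0 : ENNReal.ofReal p ≠ 0 := by simpa using hp
  have hi := hmem.integrable_norm_rpow hp0 ENNReal.ofReal_ne_top
  rw [ENNReal.toReal_ofReal hp.le] at hi
  refine ⟨hi, ?_⟩
  rw [hmem.eLpNorm_eq_integral_rpow_norm hp0 ENNReal.ofReal_ne_top,
    ENNReal.toReal_ofReal hp.le, ENNReal.ofReal_le_ofReal_iff hB] at h
  have h0 : 0 ≤ ∫ ω, ‖X ω‖ ^ p ∂P := integral_nonneg fun ω => by positivity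
  have h2 := Real.rpow_le_rpow (by positivity) h hp.le
  rwa [← Real.rpow_mul h0, inv_mul_cancel₀ hp.ne', Real.rpow_one] at h2

/-- This is where `n ≥ 8` matters: moments of order `log n` then exceed the second by a fixed
margin. -/
theorem log_eight_gt : (2.07 : ℝ) < Real.log 8 := by
  have : Real.log 8 = 3 * Real.log 2 := by
    rw [show (8 : ℝ) = 2 ^ 3 by norm_num, Real.log_pow]; norm_num
  rw [this]
  linarith [Real.log_two_gt_d9]

theorem log_eight_lt : Real.log 8 < 2.1 := by
  have : Real.log 8 = 3 * Real.log 2 := by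
    rw [show (8 : ℝ) = 2 ^ 3 by norm_num, Real.log_pow]; norm_num
  rw [this]
  linarith [Real.log_two_lt_d9]

theorem two_div_pi_sq_gt : (1 / 5 : ℝ) ≤ 2 / Real.pi ^ 2 := by
  rw [div_le_div_iff₀ (by norm_num) (by positivity)]
  nlinarith [Real.pi_lt_d2, Real.pi_gt_three]

/-- On `[-π, π]` the quadratic bound for the cosine holds by itself; beyond it `|x| ^ p` dominates
`x²`. An error of order `p` uses no more moments than are available. -/
theorem cos_le_of_rpow {p : ℝ} (hp : 2 ≤ p) (x : ℝ) :
    Real.cos x ≤ 1 - x ^ 2 / 5 + |x| ^ p := by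
  have h0 : 0 ≤ |x| ^ p := by positivity
  rcases le_total (|x|) Real.pi with h | h
  · have h1 := Real.cos_le_one_sub_mul_cos_sq h
    have := mul_le_mul_of_nonneg_right two_div_pi_sq_gt (sq_nonneg x)
    linarith
  · have h1 : 1 ≤ |x| := by linarith [Real.pi_gt_three]
    have h2 : |x| ^ (2 : ℝ) ≤ |x| ^ p := Real.rpow_le_rpow_of_exponent_le h1 hp
    rw [Real.rpow_two, sq_abs] at h2
    nlinarith [Real.cos_le_one x, sq_nonneg x]

/-- The cubic Taylor error near zero is weakened to order `p ≤ 3`; for `|x| ≥ 1` the trivial bound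
`1 + |x|` suffices. -/
theorem abs_sub_sin_le_rpow {p : ℝ} (hp : 2 ≤ p) (hp3 : p ≤ 3) (x : ℝ) :
    |Real.sin x - x| ≤ 2 * |x| ^ p := by
  rcases le_total (|x|) 1 with h | h
  · rw [abs_sub_comm]
    have h1 := Real.abs_sub_sin_le x
    rcases (abs_nonneg x).eq_or_lt with h0 | h0
    · have hx : x = 0 := abs_eq_zero.1 h0.symm
      have h2 : (0 : ℝ) ≤ 0 ^ p := Real.rpow_nonneg le_rfl _
      subst hx
      simpa using h2
    have h2 : |x| ^ (3 : ℝ) ≤ |x| ^ p := Real.rpow_le_rpow_of_exponent_ge h0 h hp3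
    have h3 : |x| ^ (3 : ℝ) = |x| ^ 3 := by
      rw [← Real.rpow_natCast]; norm_num
    rw [h3] at h2
    have : 0 ≤ |x| ^ 3 := by positivity
    linarith
  · have h1 : |x| ^ (1 : ℝ) ≤ |x| ^ p := Real.rpow_le_rpow_of_exponent_le h (by linarith)
    rw [Real.rpow_one] at h1
    have h2 := abs_sub (Real.sin x) x
    linarith [Real.abs_sin_le_one x]

/-- The characteristic function of a centered variable near the origin. -/
theorem norm_charFun_le (hX : Measurable X) (h0 : ∫ ω, X ω ∂P = 0) {p B σ b : ℝ} (hp : 2 ≤ p)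
    (hp3 : p ≤ 3) (hi2 : Integrable (fun ω => X ω ^ 2) P) (hb : ∫ ω, X ω ^ 2 ∂P ≤ b)
    (hσ : σ ^ 2 ≤ ∫ ω, X ω ^ 2 ∂P)
    (hip : Integrable (fun ω => |X ω| ^ p) P) (hB : ∫ ω, |X ω| ^ p ∂P ≤ B)
    {t : ℝ} (ht : t ^ 2 * b ≤ 2) (htp : 3 * (|t| ^ p * B) ≤ t ^ 2 * σ ^ 2 / 10) :
    ‖∫ ω, Complex.exp ((t * X ω : ℝ) * Complex.I) ∂P‖ ≤ Real.exp (-(t ^ 2 * σ ^ 2 / 10)) := by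
  have hi1 : Integrable X P := by
    refine Integrable.mono' (hi2.add (integrable_const 1)) hX.aestronglyMeasurable
      (Filter.Eventually.of_forall fun ω => ?_)
    rw [Real.norm_eq_abs, Pi.add_apply, abs_le]
    constructor <;> nlinarith [sq_nonneg (X ω - 1), sq_nonneg (X ω + 1)]
  have icos : Integrable (fun ω => Real.cos (t * X ω)) P :=
    integrable_of_forall_abs_le (by fun_prop) (B := 1) fun ω => Real.abs_cos_le_one _
  have isin : Integrable (fun ω => Real.sin (t * X ω)) P :=
    integrable_of_forall_abs_le (by fun_prop) (B := 1) fun ω => Real.abs_sin_le_one _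
  have hsplit : ∫ ω, Complex.exp ((t * X ω : ℝ) * Complex.I) ∂P =
      ((∫ ω, Real.cos (t * X ω) ∂P : ℝ) : ℂ) + ((∫ ω, Real.sin (t * X ω) ∂P : ℝ) : ℂ) *
        Complex.I := by
    have : ∀ ω, Complex.exp ((t * X ω : ℝ) * Complex.I) =
        ((Real.cos (t * X ω) : ℝ) : ℂ) + ((Real.sin (t * X ω) : ℝ) : ℂ) * Complex.I := fun ω => by
      rw [Complex.exp_mul_I, Complex.ofReal_cos, Complex.ofReal_sin]
    simp_rw [this]
    rw [integral_add icos.ofReal (isin.ofReal.mul_const _), integral_mul_const,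
      integral_complex_ofReal, integral_complex_ofReal]
  have hpow : ∀ ω, |t * X ω| ^ p = |t| ^ p * |X ω| ^ p := fun ω => by
    rw [abs_mul, Real.mul_rpow (abs_nonneg _) (abs_nonneg _)]
  have htB : |t| ^ p * ∫ ω, |X ω| ^ p ∂P ≤ |t| ^ p * B :=
    mul_le_mul_of_nonneg_left hB (by positivity)
  have hcos1 : ∫ ω, Real.cos (t * X ω) ∂P ≤ 1 - t ^ 2 * σ ^ 2 / 5 + |t| ^ p * B := by
    have i1 : Integrable (fun ω => 1 - t ^ 2 / 5 * X ω ^ 2) P :=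
      (integrable_const _).sub (hi2.const_mul _)
    calc ∫ ω, Real.cos (t * X ω) ∂P
        ≤ ∫ ω, (1 - t ^ 2 / 5 * X ω ^ 2 + |t| ^ p * |X ω| ^ p) ∂P := by
          refine integral_mono icos (((integrable_const _).sub (hi2.const_mul _)).add
            (hip.const_mul _)) fun ω => ?_
          have := cos_le_of_rpow hp (t * X ω)
          rw [hpow] at this
          refine this.trans (le_of_eq ?_)
          ring
      _ = 1 - t ^ 2 / 5 * ∫ ω, X ω ^ 2 ∂P + |t| ^ p * ∫ ω, |X ω| ^ p ∂P := by
          rw [integral_add i1 (hip.const_mul _), integral_sub (integrable_const _) (hi2.const_mul _), integral_const_mul,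
            integral_const_mul]
          simp
      _ ≤ _ := by
          have := mul_le_mul_of_nonneg_left hσ (by positivity : 0 ≤ t ^ 2 / 5)
          linarith
  -- The condition `t² b ≤ 2` keeps the real part nonnegative, so that its upper bound also bounds
  -- its absolute value.
  have hcos0 : 0 ≤ ∫ ω, Real.cos (t * X ω) ∂P := by
    calc (0 : ℝ) ≤ 1 - t ^ 2 / 2 * ∫ ω, X ω ^ 2 ∂P := by
          have := mul_le_mul_of_nonneg_left hb (by positivity : 0 ≤ t ^ 2 / 2)
          linarith
      _ = ∫ ω, (1 - t ^ 2 / 2 * X ω ^ 2) ∂P := by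
          rw [integral_sub (integrable_const _) (hi2.const_mul _), integral_const_mul]
          simp
      _ ≤ _ := by
          refine integral_mono ((integrable_const _).sub (hi2.const_mul _)) icos fun ω => ?_
          have := Real.one_sub_sq_div_two_le_cos (x := t * X ω)
          refine le_trans (le_of_eq ?_) this
          ring
  -- Centering removes the linear term of the sine.
  have hsin : |∫ ω, Real.sin (t * X ω) ∂P| ≤ 2 * (|t| ^ p * B) := by
    have h1 : ∫ ω, Real.sin (t * X ω) ∂P = ∫ ω, (Real.sin (t * X ω) - t * X ω) ∂P := by
      rw [integral_sub isin (hi1.const_mul _), integral_const_mul, h0]; simp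
    rw [h1]
    refine (abs_integral_le_integral_abs).trans ?_
    calc ∫ ω, |Real.sin (t * X ω) - t * X ω| ∂P ≤ ∫ ω, 2 * (|t| ^ p * |X ω| ^ p) ∂P := by
          refine integral_mono (isin.sub (hi1.const_mul _)).abs
            ((hip.const_mul _).const_mul _) fun ω => ?_
          have := abs_sub_sin_le_rpow hp hp3 (t * X ω)
          rwa [hpow] at this
      _ = 2 * (|t| ^ p * ∫ ω, |X ω| ^ p ∂P) := by
          rw [integral_const_mul, integral_const_mul]
      _ ≤ _ := by linarith
  rw [hsplit]
  refine (norm_add_le _ _).trans ?_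
  rw [norm_mul, Complex.norm_I, mul_one, Complex.norm_real, Complex.norm_real, Real.norm_eq_abs,
    Real.norm_eq_abs, abs_of_nonneg hcos0]
  have := Real.add_one_le_exp (-(t ^ 2 * σ ^ 2 / 10))
  linarith

/-- A small ball estimate from the decay of the characteristic function. -/
theorem smallBall_of_charFun {S : Ω → ℝ} (hS : Measurable S) {t ζ : ℝ} (ht : 0 < t) (hζ : 0 ≤ ζ)
    (h : ‖∫ ω, Complex.exp ((t * S ω : ℝ) * Complex.I) ∂P‖ ≤ 1 - 2 * ζ) :
    ζ / 2 ≤ P.real {ω | 2 * (√(ζ / 2) / t) ≤ |S ω|} := by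
  set u := √(ζ / 2) / t with hu
  have hset : MeasurableSet {ω | 2 * u ≤ |S ω|} := measurableSet_le measurable_const (by fun_prop)
  have icos : Integrable (fun ω => Real.cos (t * S ω)) P :=
    integrable_of_forall_abs_le (by fun_prop) (B := 1) fun ω => Real.abs_cos_le_one _
  have hre : ∫ ω, Real.cos (t * S ω) ∂P ≤ 1 - 2 * ζ := by
    refine le_trans (le_of_eq ?_) ((Complex.re_le_norm _).trans h)
    have hint : Integrable (fun ω => Complex.exp ((t * S ω : ℝ) * Complex.I)) P := by
      refine Integrable.of_bound (by fun_prop) 1 (Filter.Eventually.of_forall fun ω => ?_)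
      rw [Complex.norm_exp_ofReal_mul_I]
    have h1 := integral_re hint
    simp only [RCLike.re_to_complex] at h1
    rw [← h1]
    congr 1; ext ω
    rw [Complex.exp_ofReal_mul_I_re]
  -- Where `|S| < 2u` one has `1 - cos (tS) ≤ (2ut)² / 2 = ζ`, which determines `u`; elsewhere the
  -- bound is 2.
  have hkey : ∫ ω, (1 - Real.cos (t * S ω)) ∂P ≤
      ∫ ω, (2 * ({ω | 2 * u ≤ |S ω|}.indicator 1 ω) + ζ) ∂P := by
    refine integral_mono ((integrable_const _).sub icos)
      ((((integrable_const (1 : ℝ)).indicator hset).const_mul 2).add (integrable_const _))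
      fun ω => ?_
    by_cases hω : 2 * u ≤ |S ω|
    · simp only [Set.indicator_of_mem (show ω ∈ {ω | 2 * u ≤ |S ω|} from hω), Pi.one_apply]
      linarith [Real.neg_one_le_cos (t * S ω)]
    · simp only [Set.indicator_of_notMem (show ω ∉ {ω | 2 * u ≤ |S ω|} from hω)]
      have h1 := Real.one_sub_sq_div_two_le_cos (x := t * S ω)
      have h2 : (t * S ω) ^ 2 ≤ (t * (2 * u)) ^ 2 := by
        rw [← sq_abs (t * S ω), abs_mul, abs_of_pos ht]
        push Not at hω
        gcongr
      have h3 : (t * (2 * u)) ^ 2 = 2 * ζ := by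
        have : t * (2 * u) = 2 * √(ζ / 2) := by rw [hu]; field_simp
        rw [this, mul_pow, Real.sq_sqrt (by positivity)]; ring
      linarith
  have i1 : Integrable (fun ω => 2 * ({ω | 2 * u ≤ |S ω|}.indicator (1 : Ω → ℝ) ω)) P :=
    ((integrable_const (1 : ℝ)).indicator hset).const_mul 2
  rw [integral_sub (integrable_const _) icos, integral_add i1 (integrable_const _),
    integral_const_mul, integral_indicator_one hset] at hkey
  simp only [integral_const, probReal_univ, smul_eq_mul, mul_one] at hkey
  linarith

/-- By independence the characteristic function of the weighted sum factors, and the factor at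
frequency `t vⱼ` is at most `exp (-(t vⱼ)² σ² / 10)`. As `∑ vⱼ² = 1`, the product is bounded away
from 1 uniformly in `n` and `v`. The order `p = log 8 > 2` makes the error `|t vⱼ| ^ p` negligible
against `(t vⱼ)²` for small `t`. -/
theorem exists_smallBall_constants (K σ : ℝ) (hK : 0 < K) (hσ : 0 < σ) :
    ∃ u c : ℝ, 0 < u ∧ 0 < c ∧ ∀ {Ω : Type*} [MeasurableSpace Ω] (P : Measure Ω)
      [IsProbabilityMeasure P] {n : ℕ} (X : Fin n → Ω → ℝ), (∀ j, Measurable (X j)) →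
      iIndepFun X P → (∀ j, ∫ ω, X j ω ∂P = 0) → (∀ j, σ ^ 2 ≤ variance (X j) P) →
      (∀ j, ∀ p : ℝ, 1 ≤ p → p ≤ Real.log 8 →
        eLpNorm (X j) (ENNReal.ofReal p) P ≤ ENNReal.ofReal (K * √p)) →
      ∀ v : EuclideanSpace ℝ (Fin n), ‖v‖ = 1 →
        c ≤ P.real {ω | 2 * u ≤ |∑ j, X j ω * v j|} := by
  set p := Real.log 8 with hp
  have hp2 : 2.07 < p := log_eight_gt
  have hp3 : p < 2.1 := log_eight_lt
  set B := (K * √p) ^ p with hB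
  have hB0 : 0 < B := by positivity
  set b := (K * √2) ^ (2 : ℝ) with hb
  have hb0 : 0 < b := by positivity
  -- the frequency at which the characteristic functions are evaluated
  set r := σ ^ 2 / (30 * B) with hr
  have hr0 : 0 < r := by positivity
  set t := min (√(2 / b)) (r ^ (1 / (p - 2))) with ht
  have ht0 : 0 < t := lt_min (by positivity) (by positivity)
  set ζ := (1 - Real.exp (-(t ^ 2 * σ ^ 2 / 10))) / 2 with hζ
  have hζ0 : 0 < ζ := by
    have : Real.exp (-(t ^ 2 * σ ^ 2 / 10)) < 1 := by
      rw [Real.exp_lt_one_iff]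
      have : 0 < t ^ 2 * σ ^ 2 / 10 := by positivity
      linarith
    rw [hζ]; linarith
  refine ⟨√(ζ / 2) / t, ζ / 2, by positivity, by positivity, ?_⟩
  intro Ω _ P _ n X hXm hind h0 hvar hmom v hv
  have hS : Measurable fun ω => ∑ j, X j ω * v j := by fun_prop
  refine smallBall_of_charFun hS ht0 hζ0.le ?_
  have hprod : ∫ ω, Complex.exp ((t * ∑ j, X j ω * v j : ℝ) * Complex.I) ∂P =
      ∏ j, ∫ ω, Complex.exp (((t * v j) * X j ω : ℝ) * Complex.I) ∂P := by
    rw [← hind.integral_fun_prod_comp (fun j => (hXm j).aemeasurable)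
      (f := fun j x => Complex.exp (((t * v j) * x : ℝ) * Complex.I)) (fun j => by fun_prop)]
    congr 1; ext ω
    rw [← Complex.exp_sum, ← Finset.sum_mul]
    congr 2
    rw [Finset.mul_sum, Complex.ofReal_sum]
    refine Finset.sum_congr rfl fun j _ => ?_
    congr 1; ring
  rw [hprod, norm_prod]
  have hvs : ∑ j, v j ^ 2 = 1 := by
    have := EuclideanSpace.norm_sq_eq v
    rw [hv] at this
    simpa using this.symm
  have hv1 : ∀ j, |v j| ≤ 1 := fun j => by
    rw [← hv]; exact PiLp.norm_apply_le v j
  have hfac : ∀ j, ‖∫ ω, Complex.exp (((t * v j) * X j ω : ℝ) * Complex.I) ∂P‖ ≤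
      Real.exp (-((t * v j) ^ 2 * σ ^ 2 / 10)) := by
    intro j
    have hm2 := integrable_and_integral_rpow_le (hXm j) (by norm_num : (0 : ℝ) < 2)
      (by positivity) (hmom j 2 (by norm_num) (by linarith))
    have hmp := integrable_and_integral_rpow_le (hXm j) (by linarith : 0 < p)
      (by positivity) (hmom j p (by linarith) le_rfl)
    simp only [Real.rpow_two, sq_abs] at hm2
    have hv2 : ∫ ω, X j ω ^ 2 ∂P = variance (X j) P :=
      (variance_of_integral_eq_zero (hXm j).aemeasurable (h0 j)).symm
    refine norm_charFun_le (hXm j) (h0 j) (by linarith : 2 ≤ p) (by linarith) hm2.1 (b := b)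
      (by rw [hb, Real.rpow_two]; exact hm2.2) (hv2 ▸ hvar j) hmp.1 hmp.2 ?_ ?_
    · have h1 : (t * v j) ^ 2 ≤ 2 / b := by
        calc (t * v j) ^ 2 = t ^ 2 * |v j| ^ 2 := by rw [sq_abs]; ring
          _ ≤ (√(2 / b)) ^ 2 * 1 ^ 2 := by
              gcongr
              · exact min_le_left _ _
              · exact hv1 j
          _ = 2 / b := by rw [Real.sq_sqrt (by positivity)]; ring
      rwa [le_div_iff₀ hb0] at h1
    · have habs : |t * v j| ≤ t := by
        rw [abs_mul, abs_of_pos ht0]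
        exact mul_le_of_le_one_right ht0.le (hv1 j)
      have h1 : |t * v j| ^ p = |t * v j| ^ (p - 2) * (t * v j) ^ 2 := by
        have hpp : p = (p - 2) + 2 := by ring
        rcases (abs_nonneg (t * v j)).eq_or_lt with h0 | h0
        · rw [← sq_abs, ← h0, Real.zero_rpow (by linarith)]; norm_num
        · conv_lhs => rw [hpp, Real.rpow_add h0, Real.rpow_two, sq_abs]
      have h2 : |t * v j| ^ (p - 2) ≤ r := by
        calc |t * v j| ^ (p - 2) ≤ (r ^ (1 / (p - 2))) ^ (p - 2) :=
              Real.rpow_le_rpow (abs_nonneg _) (habs.trans (min_le_right _ _)) (by linarith)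
          _ = r := by
              rw [← Real.rpow_mul hr0.le, one_div, inv_mul_cancel₀ (by linarith), Real.rpow_one]
      rw [h1]
      calc 3 * (|t * v j| ^ (p - 2) * (t * v j) ^ 2 * B) ≤ 3 * (r * (t * v j) ^ 2 * B) := by gcongr
        _ = (t * v j) ^ 2 * σ ^ 2 / 10 := by rw [hr]; field_simp; ring
  calc ∏ j, ‖∫ ω, Complex.exp (((t * v j) * X j ω : ℝ) * Complex.I) ∂P‖
      ≤ ∏ j, Real.exp (-((t * v j) ^ 2 * σ ^ 2 / 10)) :=
        Finset.prod_le_prod (fun _ _ => norm_nonneg _) fun j _ => hfac j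
    _ = Real.exp (-(t ^ 2 * σ ^ 2 / 10)) := by
        rw [← Real.exp_sum]
        congr 1
        calc ∑ j, -((t * v j) ^ 2 * σ ^ 2 / 10) = -(t ^ 2 * σ ^ 2 / 10) * ∑ j, v j ^ 2 := by
              rw [Finset.mul_sum]
              refine Finset.sum_congr rfl fun j _ => ?_
              ring
          _ = _ := by rw [hvs, mul_one]
    _ = 1 - 2 * ζ := by rw [hζ]; ring

end Moments

/-! ### Even moments of sums of independent variables -/

theorem sum_range_even {M : Type*} [AddCommMonoid M] (g : ℕ → M) (h : ∀ j, g (2 * j + 1) = 0)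
    (k : ℕ) : ∑ i ∈ Finset.range (2 * k + 1), g i = ∑ j ∈ Finset.range (k + 1), g (2 * j) := by
  induction k with
  | zero => simp
  | succ k ih =>
    rw [show 2 * (k + 1) + 1 = 2 * k + 1 + 1 + 1 by ring, Finset.sum_range_succ,
      Finset.sum_range_succ, ih, h, add_zero, Finset.sum_range_succ _ (k + 1)]
    rfl

theorem half_add_pow_sub_pow (s x : ℝ) (k : ℕ) :
    ((s + x) ^ (2 * k) + (s - x) ^ (2 * k)) / 2 =
      ∑ j ∈ Finset.range (k + 1), ((2 * k).choose (2 * j) : ℝ) * s ^ (2 * (k - j)) * x ^ (2 * j) := by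
  rw [add_comm s x, sub_eq_neg_add, add_pow, add_pow, ← Finset.sum_add_distrib, Finset.sum_div,
    sum_range_even]
  · refine Finset.sum_congr rfl fun j hj => ?_
    rw [Even.neg_pow ⟨j, by ring⟩, Nat.mul_sub]
    ring
  · intro j
    rw [Odd.neg_pow ⟨j, rfl⟩]
    ring

/-- Tangent line inequality for an even power, reduced by homogeneity to Bernoulli's inequality. -/
theorem pow_even_tangent (s y : ℝ) (k : ℕ) :
    s ^ (2 * k) + (2 * k : ℕ) * s ^ (2 * k - 1) * (y - s) ≤ y ^ (2 * k) := by
  rcases Nat.eq_zero_or_pos k with rfl | hk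
  · simp
  by_cases hs : s = 0
  · subst hs
    rw [zero_pow (by omega), zero_pow (by omega)]
    have : 0 ≤ y ^ (2 * k) := Even.pow_nonneg ⟨k, by ring⟩ y
    simpa using this
  have hb : 1 + ((2 * k : ℕ) : ℝ) * ((y - s) / s) ≤ (1 + (y - s) / s) ^ (2 * k) := by
    rcases le_total (-2) ((y - s) / s) with h | h
    · exact one_add_mul_le_pow h _
    · have h1 : 0 ≤ (1 + (y - s) / s) ^ (2 * k) := Even.pow_nonneg ⟨k, by ring⟩ _
      have h2 : (1 : ℝ) ≤ ((2 * k : ℕ) : ℝ) := by exact_mod_cast (by omega : 1 ≤ 2 * k)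
      nlinarith
  have hsp : 0 < s ^ (2 * k) := Even.pow_pos ⟨k, by ring⟩ hs
  have h1 := mul_le_mul_of_nonneg_left hb hsp.le
  rw [← mul_pow] at h1
  have e1 : s * (1 + (y - s) / s) = y := by field_simp; ring
  have e2 : s ^ (2 * k) = s ^ (2 * k - 1) * s := by
    rw [← pow_succ]; congr 1; omega
  rw [e1] at h1
  refine le_trans (le_of_eq ?_) h1
  rw [mul_add, mul_one]
  congr 1
  rw [e2]
  field_simp

/-- Symmetrization of an even power, up to a term that is linear in `x`. -/
theorem add_pow_even_le (s x : ℝ) (k : ℕ) :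
    (s + x) ^ (2 * k) ≤
      ∑ j ∈ Finset.range (k + 1), ((2 * k).choose (2 * j) : ℝ) * s ^ (2 * (k - j)) *
        (2 * x) ^ (2 * j) + (2 * k : ℕ) * (s ^ (2 * k - 1) * x) := by
  rw [← half_add_pow_sub_pow]
  -- The point `s + x` is the midpoint of `s + 2x` and `s`. Then `s` is traded for `s - 2x` along
  -- the tangent at `s`, at a cost linear in `x`, which vanishes in mean for independent centered
  -- `x`.
  have h1 : (s + x) ^ (2 * k) ≤ (s + 2 * x) ^ (2 * k) / 2 + s ^ (2 * k) / 2 := by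
    have hc := (Even.convexOn_pow (𝕜 := ℝ) (⟨k, by ring⟩ : Even (2 * k))).2
      (Set.mem_univ (s + 2 * x)) (Set.mem_univ s) (by norm_num : (0 : ℝ) ≤ 1 / 2)
      (by norm_num : (0 : ℝ) ≤ 1 / 2) (by norm_num)
    simp only [smul_eq_mul] at hc
    have e : 1 / 2 * (s + 2 * x) + 1 / 2 * s = s + x := by ring
    rw [e] at hc
    linarith
  have h2 := pow_even_tangent s (s - 2 * x) k
  have h3 : ((2 * k : ℕ) : ℝ) * s ^ (2 * k - 1) * (s - 2 * x - s) =
      -2 * ((2 * k : ℕ) * (s ^ (2 * k - 1) * x)) := by ring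
  rw [h3] at h2
  linarith

section EvenMoments

variable {Ω : Type*} [MeasurableSpace Ω] {P : Measure Ω} [IsProbabilityMeasure P]

/-- A bounded random variable whose even moments are at most those of a centered Gaussian
of variance `2 u`. -/
structure SubGaussMoments (P : Measure Ω) (X : Ω → ℝ) (u : ℝ) : Prop where
  measurable : Measurable X
  bounded : ∃ B, ∀ ω, |X ω| ≤ B
  moment : ∀ k : ℕ, ∫ ω, X ω ^ (2 * k) ∂P ≤ ((2 * k).factorial : ℝ) / k.factorial * u ^ k

theorem integrable_pow_of_bounded {X : Ω → ℝ} (hX : Measurable X) (hB : ∃ B, ∀ ω, |X ω| ≤ B)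
    (k : ℕ) : Integrable (fun ω => X ω ^ k) P := by
  obtain ⟨B, hB⟩ := hB
  refine integrable_of_forall_abs_le (by fun_prop) (B := B ^ k) fun ω => ?_
  rw [abs_pow]
  exact pow_le_pow_left₀ (abs_nonneg _) (hB ω) k

theorem SubGaussMoments.const_mul {X : Ω → ℝ} {u : ℝ} (h : SubGaussMoments P X u) (b : ℝ) :
    SubGaussMoments P (fun ω => b * X ω) (b ^ 2 * u) where
  measurable := h.measurable.const_mul b
  bounded := by
    obtain ⟨B, hB⟩ := h.bounded
    refine ⟨|b| * B, fun ω => ?_⟩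
    rw [abs_mul]
    exact mul_le_mul_of_nonneg_left (hB ω) (abs_nonneg _)
  moment k := by
    simp_rw [mul_pow]
    rw [integral_const_mul]
    have h1 := mul_le_mul_of_nonneg_left (h.moment k)
      (Even.pow_nonneg ⟨k, by ring⟩ b : 0 ≤ b ^ (2 * k))
    refine h1.trans (le_of_eq ?_)
    rw [← pow_mul]; ring

/-- The identity that makes the weights `(2k)!/k!` reproduce themselves: products of two moment
bounds sum to a binomial expansion. -/
theorem choose_mul_factorials {k j : ℕ} (hj : j ≤ k) :
    ((2 * k).choose (2 * j) : ℝ) * (((2 * (k - j)).factorial : ℝ) / (k - j).factorial) *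
      (((2 * j).factorial : ℝ) / j.factorial) =
      ((2 * k).factorial : ℝ) / k.factorial * k.choose j := by
  have h1 := Nat.choose_mul_factorial_mul_factorial (show 2 * j ≤ 2 * k by omega)
  have h2 := Nat.choose_mul_factorial_mul_factorial hj
  rw [← Nat.mul_sub] at h1
  have h1' : ((2 * k).choose (2 * j) : ℝ) * (2 * j).factorial * (2 * (k - j)).factorial =
      (2 * k).factorial := by exact_mod_cast h1
  have h2' : (k.choose j : ℝ) * j.factorial * (k - j).factorial = k.factorial := by
    exact_mod_cast h2
  have p1 : (j.factorial : ℝ) ≠ 0 := by exact_mod_cast j.factorial_ne_zero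
  have p2 : ((k - j).factorial : ℝ) ≠ 0 := by exact_mod_cast (k - j).factorial_ne_zero
  have p3 : (k.choose j : ℝ) ≠ 0 := by exact_mod_cast (Nat.choose_pos hj).ne'
  rw [← h1', ← h2']
  field_simp

/-- After the symmetrized expansion only even powers of both variables survive, although `X` need
not be symmetric. The replacement of `X` by `2X` is the factor 4. -/
theorem SubGaussMoments.add {S X : Ω → ℝ} {u v : ℝ} (hS : SubGaussMoments P S u)
    (hX : SubGaussMoments P X v) (hu : 0 ≤ u) (hind : IndepFun S X P)
    (h0 : ∫ ω, X ω ∂P = 0) :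
    SubGaussMoments P (fun ω => S ω + X ω) (u + 4 * v) where
  measurable := hS.measurable.add hX.measurable
  bounded := by
    obtain ⟨B, hB⟩ := hS.bounded
    obtain ⟨B', hB'⟩ := hX.bounded
    exact ⟨B + B', fun ω => (abs_add_le _ _).trans (add_le_add (hB ω) (hB' ω))⟩
  moment k := by
    have iS := fun i => integrable_pow_of_bounded (P := P) hS.measurable hS.bounded i
    have iX := fun i => integrable_pow_of_bounded (P := P) hX.measurable hX.bounded i
    have hprod : ∀ i j, Integrable (fun ω => S ω ^ i * X ω ^ j) P ∧
        ∫ ω, S ω ^ i * X ω ^ j ∂P = (∫ ω, S ω ^ i ∂P) * ∫ ω, X ω ^ j ∂P := by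
      intro i j
      have hij : IndepFun (fun ω => S ω ^ i) (fun ω => X ω ^ j) P :=
        hind.comp (measurable_id.pow_const i) (measurable_id.pow_const j)
      exact ⟨hij.integrable_mul (iS i) (iX j), hij.integral_fun_mul_eq_mul_integral
        (iS i).aestronglyMeasurable (iX j).aestronglyMeasurable⟩
    have iSX : Integrable (fun ω => S ω ^ (2 * k - 1) * X ω) P := by
      simpa using (hprod (2 * k - 1) 1).1
    have eSX : ∫ ω, S ω ^ (2 * k - 1) * X ω ∂P = 0 := by
      have := (hprod (2 * k - 1) 1).2
      simpa [h0] using this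
    have hterm : ∀ j, Integrable (fun ω => ((2 * k).choose (2 * j) : ℝ) * S ω ^ (2 * (k - j)) *
        (2 * X ω) ^ (2 * j)) P := by
      intro j
      refine ((hprod (2 * (k - j)) (2 * j)).1.const_mul
        (((2 * k).choose (2 * j) : ℝ) * 2 ^ (2 * j))).congr (Filter.Eventually.of_forall fun ω => ?_)
      simp only [mul_pow]; ring
    have hsum : Integrable (fun ω => ∑ j ∈ Finset.range (k + 1), ((2 * k).choose (2 * j) : ℝ) *
        S ω ^ (2 * (k - j)) * (2 * X ω) ^ (2 * j)) P :=
      integrable_finsetSum _ fun j _ => hterm j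
    calc ∫ ω, (S ω + X ω) ^ (2 * k) ∂P
        ≤ ∫ ω, (∑ j ∈ Finset.range (k + 1), ((2 * k).choose (2 * j) : ℝ) *
            S ω ^ (2 * (k - j)) * (2 * X ω) ^ (2 * j) +
            (2 * k : ℕ) * (S ω ^ (2 * k - 1) * X ω)) ∂P := by
          refine integral_mono_of_nonneg (Filter.Eventually.of_forall fun ω =>
            Even.pow_nonneg ⟨k, by ring⟩ _) (hsum.add (iSX.const_mul _))
            (Filter.Eventually.of_forall fun ω => add_pow_even_le _ _ k)
      _ = ∑ j ∈ Finset.range (k + 1), ((2 * k).choose (2 * j) : ℝ) * 4 ^ j *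
            ((∫ ω, S ω ^ (2 * (k - j)) ∂P) * ∫ ω, X ω ^ (2 * j) ∂P) := by
          rw [integral_add hsum (iSX.const_mul _), integral_const_mul, eSX, mul_zero, add_zero,
            integral_finsetSum _ fun j _ => hterm j]
          refine Finset.sum_congr rfl fun j _ => ?_
          rw [← (hprod _ _).2, ← integral_const_mul]
          congr 1; ext ω
          rw [mul_pow 2, pow_mul 2]; norm_num; ring
      _ ≤ ∑ j ∈ Finset.range (k + 1), ((2 * k).choose (2 * j) : ℝ) * 4 ^ j *
            ((((2 * (k - j)).factorial : ℝ) / (k - j).factorial * u ^ (k - j)) *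
              (((2 * j).factorial : ℝ) / j.factorial * v ^ j)) := by
          refine Finset.sum_le_sum fun j _ => mul_le_mul_of_nonneg_left ?_ (by positivity)
          refine mul_le_mul (hS.moment _) (hX.moment _) ?_ (by positivity)
          exact integral_nonneg fun ω => Even.pow_nonneg ⟨j, by ring⟩ _
      _ = ((2 * k).factorial : ℝ) / k.factorial * (u + 4 * v) ^ k := by
          rw [add_comm u, add_pow, Finset.mul_sum]
          refine Finset.sum_congr rfl fun j hj => ?_
          have := choose_mul_factorials (Nat.lt_succ_iff.1 (Finset.mem_range.1 hj))
          rw [mul_pow]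
          linear_combination (u ^ (k - j) * v ^ j * 4 ^ j) * this

/-- The new summand is always the one multiplied by 4 in the induction, so the factor does not
accumulate. -/
theorem SubGaussMoments.sum {ι : Type*} {X : ι → Ω → ℝ} {u : ℝ} (hu : 0 ≤ u)
    (hX : ∀ i, SubGaussMoments P (X i) u) (hind : iIndepFun X P) (h0 : ∀ i, ∫ ω, X i ω ∂P = 0)
    (b : ι → ℝ) (s : Finset ι) :
    SubGaussMoments P (fun ω => ∑ i ∈ s, b i * X i ω) (4 * u * ∑ i ∈ s, b i ^ 2) := by
  classical
  induction s using Finset.induction_on with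
  | empty =>
    refine ⟨by simp, ⟨0, by simp⟩, fun k => ?_⟩
    rcases Nat.eq_zero_or_pos k with rfl | hk
    · simp
    · simp [hk.ne']
  | insert i s hi ih =>
    have hind' : iIndepFun (fun i ω => b i * X i ω) P :=
      hind.comp (fun i x => b i * x) fun i => measurable_const_mul _
    have hm : ∀ i, Measurable fun ω => b i * X i ω := fun i => (hX i).measurable.const_mul _
    have hsi : IndepFun (fun ω => ∑ j ∈ s, b j * X j ω) (fun ω => b i * X i ω) P := by
      have := hind'.indepFun_finsetSum_of_notMem hm hi
      convert this using 1
      ext ω; simp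
    have h := ih.add ((hX i).const_mul (b i)) (by positivity) hsi
      (by rw [integral_const_mul, h0, mul_zero])
    convert h using 1
    · ext ω; rw [Finset.sum_insert hi, add_comm]
    · rw [Finset.sum_insert hi]; ring

/-- Exponential integrability of the square. -/
theorem SubGaussMoments.integral_exp_sq_le {X : Ω → ℝ} {u c : ℝ} (hX : SubGaussMoments P X u)
    (hu : 0 ≤ u) (hc : 0 ≤ c) (hcu : 8 * c * u ≤ 1) : ∫ ω, Real.exp (c * X ω ^ 2) ∂P ≤ 2 := by
  have iX := fun i => integrable_pow_of_bounded (P := P) hX.measurable hX.bounded i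
  set F : ℕ → Ω → ℝ := fun k ω => (c ^ k / k.factorial) * X ω ^ (2 * k) with hF
  have hF0 : ∀ k ω, 0 ≤ F k ω := fun k ω =>
    mul_nonneg (by positivity) (Even.pow_nonneg ⟨k, by ring⟩ _)
  have hFi : ∀ k, Integrable (F k) P := fun k => (iX (2 * k)).const_mul _
  -- The moment bound turns the `k`-th term into `(2k choose k) (cu)^k ≤ (4cu)^k`; hence the
  -- hypothesis `8cu ≤ 1` and the geometric sum 2.
  have hFb : ∀ k, ∫ ω, F k ω ∂P ≤ (1 / 2) ^ k := by
    intro k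
    rw [integral_const_mul]
    refine (mul_le_mul_of_nonneg_left (hX.moment k) (by positivity)).trans ?_
    have h1 : c ^ k / k.factorial * (((2 * k).factorial : ℝ) / k.factorial * u ^ k) =
        ((2 * k).choose k : ℝ) * (c * u) ^ k := by
      rw [Nat.cast_choose ℝ (by omega : k ≤ 2 * k), show 2 * k - k = k by omega, mul_pow]
      field_simp
    rw [h1]
    have h2 : ((2 * k).choose k : ℝ) ≤ 4 ^ k := by
      have := Nat.choose_le_two_pow (2 * k) k
      rw [pow_mul] at this
      exact_mod_cast this
    calc ((2 * k).choose k : ℝ) * (c * u) ^ k ≤ 4 ^ k * (c * u) ^ k := by gcongr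
      _ = (4 * (c * u)) ^ k := (mul_pow _ _ _).symm
      _ ≤ _ := by gcongr; linarith
  have hnorm : ∀ k, ∫ ω, ‖F k ω‖ ∂P = ∫ ω, F k ω ∂P := fun k => by
    congr 1; ext ω; rw [Real.norm_of_nonneg (hF0 k ω)]
  have hgeo : Summable fun k : ℕ => (1 / 2 : ℝ) ^ k :=
    summable_geometric_of_lt_one (by norm_num) (by norm_num)
  have hsum : Summable fun k => ∫ ω, ‖F k ω‖ ∂P := by
    simp_rw [hnorm]
    exact Summable.of_nonneg_of_le (fun k => integral_nonneg (hF0 k)) hFb hgeo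
  have h := hasSum_integral_of_summable_integral_norm hFi hsum
  have hexp : ∀ ω, ∑' k, F k ω = Real.exp (c * X ω ^ 2) := by
    intro ω
    rw [Real.exp_eq_exp_ℝ, NormedSpace.exp_eq_tsum_div]
    congr 1; ext k
    simp only [hF]
    rw [mul_pow, ← pow_mul]; ring
  simp_rw [hexp] at h
  rw [← h.tsum_eq]
  calc ∑' k, ∫ ω, F k ω ∂P ≤ ∑' k : ℕ, (1 / 2 : ℝ) ^ k := h.summable.tsum_le_tsum hFb hgeo
    _ = 2 := tsum_geometric_two

end EvenMoments

/-! ### Truncation of the entries -/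

/-- Truncation at level `M`. -/
noncomputable def trunc (M x : ℝ) : ℝ := if |x| ≤ M then x else 0

theorem measurable_trunc (M : ℝ) : Measurable (trunc M) :=
  Measurable.ite (measurableSet_le (by fun_prop) measurable_const) measurable_id measurable_const

theorem abs_trunc_le {M : ℝ} (hM : 0 ≤ M) (x : ℝ) : |trunc M x| ≤ M := by
  unfold trunc
  split_ifs with h
  · exact h
  · simpa using hM

theorem abs_trunc_le_abs (M x : ℝ) : |trunc M x| ≤ |x| := by
  unfold trunc
  split_ifs with h
  · exact le_rfl
  · simp

/-- Where truncation acts, `|x| > M`, and the surplus power `|x| ^ (L - 2)` is at least `M ^ (L -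
2)`. -/
theorem sq_sub_trunc_le {M L : ℝ} (hM : 0 < M) (hL : 2 ≤ L) (x : ℝ) :
    (x - trunc M x) ^ 2 ≤ M ^ (2 - L) * |x| ^ L := by
  unfold trunc
  split_ifs with h
  · rw [sub_self, zero_pow two_ne_zero]; positivity
  · push Not at h
    have hx : 0 < |x| := hM.trans h
    rw [sub_zero, ← sq_abs, ← Real.rpow_two]
    have h1 : |x| ^ (2 - L) ≤ M ^ (2 - L) :=
      Real.rpow_le_rpow_of_nonpos hM h.le (by linarith)
    calc |x| ^ (2 : ℝ) = |x| ^ (2 - L) * |x| ^ L := by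
          rw [← Real.rpow_add hx]; congr 1; ring
      _ ≤ _ := by gcongr

/-- Converts moment bounds of the form `k ^ k` into the Gaussian weights of `SubGaussMoments`. -/
theorem pow_self_le_factorial_div (k : ℕ) :
    (k : ℝ) ^ k ≤ ((2 * k).factorial : ℝ) / k.factorial := by
  rw [le_div_iff₀ (by positivity)]
  have h := Nat.factorial_mul_pow_le_factorial (m := k) (n := k)
  rw [← two_mul] at h
  have h' : (k.factorial : ℝ) * ((k : ℝ) + 1) ^ k ≤ (2 * k).factorial := by exact_mod_cast h
  have : (k : ℝ) ^ k ≤ ((k : ℝ) + 1) ^ k := by gcongr; linarith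
  nlinarith [(Nat.cast_pos (α := ℝ)).2 k.factorial_pos]

section Truncation

variable {Ω : Type*} [MeasurableSpace Ω] {P : Measure Ω} [IsProbabilityMeasure P]

theorem integral_pow_even_le_of_abs_le {X Y : Ω → ℝ} {k : ℕ} {B : ℝ}
    (hX : Integrable (fun ω => |X ω| ^ ((2 * k : ℕ) : ℝ)) P)
    (hB : ∫ ω, |X ω| ^ ((2 * k : ℕ) : ℝ) ∂P ≤ B) (hY : ∀ ω, |Y ω| ≤ |X ω|) :
    ∫ ω, Y ω ^ (2 * k) ∂P ≤ B := by
  refine le_trans (integral_mono_of_nonneg (Filter.Eventually.of_forall fun ω =>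
    Even.pow_nonneg ⟨k, by ring⟩ _) hX (Filter.Eventually.of_forall fun ω => ?_)) hB
  simp only [Real.rpow_natCast]
  rw [← Even.pow_abs ⟨k, by ring⟩]
  exact pow_le_pow_left₀ (abs_nonneg _) (hY ω) _

/-- Truncating a variable with `L` sub-Gaussian moments at a multiple of `√L` gives a variable
all of whose moments are sub-Gaussian. -/
theorem integral_trunc_pow_le {X : Ω → ℝ} (hX : Measurable X) {K L ρ : ℝ} (hK : 0 < K)
    (hL : 2 ≤ L) (hρ : 1 ≤ ρ)
    (hmom : ∀ p : ℝ, 1 ≤ p → p ≤ L → eLpNorm X (ENNReal.ofReal p) P ≤ ENNReal.ofReal (K * √p))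
    (k : ℕ) : ∫ ω, trunc (K * ρ * √L) (X ω) ^ (2 * k) ∂P ≤ (2 * K ^ 2 * ρ ^ 2) ^ k * k ^ k := by
  have hρ0 : 0 < ρ := by linarith
  have hM : 0 ≤ K * ρ * √L := by positivity
  rcases Nat.eq_zero_or_pos k with rfl | hk
  · simp
  have hk1 : (1 : ℝ) ≤ k := by exact_mod_cast hk
  -- Orders up to `L` are given. For larger orders the truncation level suffices, since there `L ≤
  -- 2k`.
  rcases le_total (((2 * k : ℕ) : ℝ)) L with h | h
  · have h1 : (1 : ℝ) ≤ ((2 * k : ℕ) : ℝ) := by push_cast; linarith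
    obtain ⟨hi, hB⟩ := integrable_and_integral_rpow_le hX (by linarith) (by positivity)
      (hmom _ h1 h)
    refine (integral_pow_even_le_of_abs_le hi hB fun ω => abs_trunc_le_abs _ _).trans ?_
    rw [Real.rpow_natCast, pow_mul, mul_pow, Real.sq_sqrt (by positivity), ← mul_pow]
    refine pow_le_pow_left₀ (by positivity) ?_ _
    push_cast
    have : (1 : ℝ) ≤ ρ ^ 2 := one_le_pow₀ hρ
    have h2 : 0 ≤ 2 * K ^ 2 * k := by positivity
    nlinarith
  · calc ∫ ω, trunc (K * ρ * √L) (X ω) ^ (2 * k) ∂P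
        ≤ ∫ _ω, (K * ρ * √L) ^ (2 * k) ∂P := by
          refine integral_mono_of_nonneg (Filter.Eventually.of_forall fun ω =>
            Even.pow_nonneg ⟨k, by ring⟩ _) (integrable_const _)
            (Filter.Eventually.of_forall fun ω => ?_)
          simp only
          rw [← Even.pow_abs ⟨k, by ring⟩]
          exact pow_le_pow_left₀ (abs_nonneg _) (abs_trunc_le hM _) _
      _ = (K ^ 2 * ρ ^ 2 * L) ^ k := by
          rw [integral_const, probReal_univ, one_smul, pow_mul, mul_pow, mul_pow,
            Real.sq_sqrt (by linarith), ← mul_pow, mul_pow K]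
      _ ≤ (2 * K ^ 2 * ρ ^ 2 * k) ^ k := by
          refine pow_le_pow_left₀ (by positivity) ?_ _
          push_cast at h
          have h2 : 0 ≤ K ^ 2 * ρ ^ 2 := by positivity
          nlinarith
      _ = _ := mul_pow _ _ _

/-- The centered truncation of a variable with law `X`. -/
noncomputable def light (P : Measure Ω) (X : Ω → ℝ) (M x : ℝ) : ℝ :=
  trunc M x - ∫ ω, trunc M (X ω) ∂P

theorem measurable_light (X : Ω → ℝ) (M : ℝ) : Measurable (light P X M) :=
  (measurable_trunc M).sub_const _

theorem integrable_trunc {X : Ω → ℝ} (hX : Measurable X) {M : ℝ} (hM : 0 ≤ M) :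
    Integrable (fun ω => trunc M (X ω)) P :=
  integrable_of_forall_abs_le ((measurable_trunc M).comp hX) fun _ => abs_trunc_le hM _

theorem integral_light {X : Ω → ℝ} (hX : Measurable X) {M : ℝ} (hM : 0 ≤ M) :
    ∫ ω, light P X M (X ω) ∂P = 0 := by
  unfold light
  rw [integral_sub (integrable_trunc hX hM) (integrable_const _)]
  simp

/-- Centering at most doubles the `L^{2k}`-norm, by Jensen for the mean; this factor `4 ^ k` turns
`2K²ρ²` into `8K²ρ²`. -/
theorem subGaussMoments_light {X : Ω → ℝ} (hX : Measurable X) {K L ρ : ℝ} (hK : 0 < K)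
    (hL : 2 ≤ L) (hρ : 1 ≤ ρ)
    (hmom : ∀ p : ℝ, 1 ≤ p → p ≤ L → eLpNorm X (ENNReal.ofReal p) P ≤ ENNReal.ofReal (K * √p)) :
    SubGaussMoments P (fun ω => light P X (K * ρ * √L) (X ω)) (8 * K ^ 2 * ρ ^ 2) := by
  have hM : 0 ≤ K * ρ * √L := by positivity
  set M := K * ρ * √L with hMdef
  have hmeas : Measurable fun ω => trunc M (X ω) := (measurable_trunc M).comp hX
  have hbd : ∃ B, ∀ ω, |trunc M (X ω)| ≤ B := ⟨M, fun ω => abs_trunc_le hM _⟩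
  set β := ∫ ω, trunc M (X ω) ∂P with hβ
  refine ⟨(measurable_light X M).comp hX, ⟨M + |β|, fun ω => ?_⟩, fun k => ?_⟩
  · exact (abs_sub _ _).trans (add_le_add (abs_trunc_le hM _) le_rfl)
  rcases Nat.eq_zero_or_pos k with rfl | hk
  · simp
  have ib := integrable_pow_of_bounded (P := P) hmeas hbd (2 * k)
  have hβk : β ^ (2 * k) ≤ ∫ ω, trunc M (X ω) ^ (2 * k) ∂P :=
    (Even.convexOn_pow (𝕜 := ℝ) (⟨k, by ring⟩ : Even (2 * k))).map_integral_le
      (continuous_pow _).continuousOn isClosed_univ (Filter.Eventually.of_forall fun _ => trivial)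
      (integrable_trunc hX hM) ib
  have htr := integral_trunc_pow_le hX hK hL hρ hmom k
  have hfac := pow_self_le_factorial_div k
  calc ∫ ω, light P X M (X ω) ^ (2 * k) ∂P
      ≤ ∫ ω, 2 ^ (2 * k - 1) * (trunc M (X ω) ^ (2 * k) + β ^ (2 * k)) ∂P := by
        refine integral_mono_of_nonneg (Filter.Eventually.of_forall fun ω =>
          Even.pow_nonneg ⟨k, by ring⟩ _) ((ib.add (integrable_const _)).const_mul _)
          (Filter.Eventually.of_forall fun ω => ?_)
        have := Even.add_pow_le (⟨k, by ring⟩ : Even (2 * k)) (a := trunc M (X ω)) (b := -β)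
        rw [Even.neg_pow ⟨k, by ring⟩] at this
        simpa [light, sub_eq_add_neg] using this
    _ = 2 ^ (2 * k - 1) * (∫ ω, trunc M (X ω) ^ (2 * k) ∂P + β ^ (2 * k)) := by
        rw [integral_const_mul, integral_add ib (integrable_const _)]; simp
    _ ≤ 2 ^ (2 * k - 1) * (2 * ((2 * K ^ 2 * ρ ^ 2) ^ k * k ^ k)) := by
        gcongr; linarith
    _ ≤ 2 ^ (2 * k) * ((2 * K ^ 2 * ρ ^ 2) ^ k * k ^ k) := by
        rw [← mul_assoc, ← pow_succ, show 2 * k - 1 + 1 = 2 * k by omega]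
    _ = (8 * K ^ 2 * ρ ^ 2) ^ k * k ^ k := by
        rw [pow_mul, ← mul_assoc, ← mul_pow]; norm_num; ring
    _ ≤ _ := by
        rw [mul_comm]
        gcongr

/-- The part of a variable that is removed by the centered truncation is small in `L²`. -/
theorem integral_sq_sub_light_le {X : Ω → ℝ} (hX : Measurable X) (h0 : ∫ ω, X ω ∂P = 0)
    {K L ρ : ℝ} (hK : 0 < K) (hL : 2 ≤ L) (hρ : 1 ≤ ρ)
    (hmom : ∀ p : ℝ, 1 ≤ p → p ≤ L → eLpNorm X (ENNReal.ofReal p) P ≤ ENNReal.ofReal (K * √p)) :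
    MemLp (fun ω => X ω - light P X (K * ρ * √L) (X ω)) 2 P ∧
    ∫ ω, X ω - light P X (K * ρ * √L) (X ω) ∂P = 0 ∧
    ∫ ω, (X ω - light P X (K * ρ * √L) (X ω)) ^ 2 ∂P ≤ K ^ 2 * L * ρ ^ (2 - L) := by
  have hρ0 : 0 < ρ := by linarith
  have hL0 : 0 < L := by linarith
  have hM : 0 < K * ρ * √L := by positivity
  set M := K * ρ * √L with hMdef
  have hmem : MemLp X 2 P := by
    refine ⟨hX.aestronglyMeasurable, ?_⟩
    have := hmom 2 (by norm_num) hL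
    rw [ENNReal.ofReal_ofNat] at this
    exact this.trans_lt ENNReal.ofReal_lt_top
  have htm : MemLp (fun ω => trunc M (X ω)) 2 P :=
    MemLp.of_bound ((measurable_trunc M).comp hX).aestronglyMeasurable M
      (Filter.Eventually.of_forall fun ω => abs_trunc_le hM.le _)
  have hlm : MemLp (fun ω => light P X M (X ω)) 2 P := htm.sub (memLp_const _)
  have hiX := hmem.integrable one_le_two
  have hil := hlm.integrable one_le_two
  have hmean : ∫ ω, X ω - light P X M (X ω) ∂P = 0 := by
    rw [integral_sub hiX hil, h0, integral_light hX hM.le, sub_zero]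
  refine ⟨hmem.sub hlm, hmean, ?_⟩
  obtain ⟨hi, hB⟩ := integrable_and_integral_rpow_le hX hL0 (by positivity)
    (hmom L (by linarith) le_rfl)
  -- the variance of the removed part is at most its second moment before centering
  set W : Ω → ℝ := fun ω => X ω - trunc M (X ω) with hW
  have hWm : MemLp W 2 P := hmem.sub htm
  have hWi := hWm.integrable one_le_two
  have hEW : ∫ ω, W ω ∂P = -∫ ω, trunc M (X ω) ∂P := by
    rw [hW, integral_sub hiX (htm.integrable one_le_two), h0, zero_sub]
  have h1 : ∫ ω, (X ω - light P X M (X ω)) ^ 2 ∂P = variance W P := by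
    rw [variance_eq_integral hWm.1.aemeasurable]
    congr 1; ext ω
    rw [hEW, light, hW]
    ring
  have h2 : variance W P ≤ ∫ ω, W ω ^ 2 ∂P := variance_le_expectation_sq hWm.1
  rw [h1]
  calc variance W P ≤ ∫ ω, W ω ^ 2 ∂P := h2
    _ ≤ ∫ ω, M ^ (2 - L) * |X ω| ^ L ∂P :=
        integral_mono hWm.integrable_sq (hi.const_mul _) fun ω => sq_sub_trunc_le hM hL _
    _ = M ^ (2 - L) * ∫ ω, |X ω| ^ L ∂P := integral_const_mul _ _
    _ ≤ M ^ (2 - L) * (K * √L) ^ L := by gcongr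
    _ = _ := by
        have hKL : 0 < K * √L := by positivity
        rw [hMdef, show K * ρ * √L = ρ * (K * √L) by ring, Real.mul_rpow hρ0.le hKL.le,
          mul_assoc, ← Real.rpow_add hKL, show 2 - L + L = 2 by ring, Real.rpow_two, mul_pow,
          Real.sq_sqrt hL0.le]
        ring

/-- The truncation level can be chosen so that the removed part is negligible at every polynomial
scale in `n`. -/
theorem exists_truncation_level (K lam : ℝ) (hK : 0 < K) :
    ∃ ρ : ℝ, 1 ≤ ρ ∧ ∀ n : ℕ, 8 ≤ n →
      2 * lam ^ 2 * (n : ℝ) ^ 3 * (K ^ 2 * Real.log n * ρ ^ (2 - Real.log n)) ≤ 1 := by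
  set q := Real.log (1 + 2 * lam ^ 2 * K ^ 2) with hq
  have hq1 : 0 < 1 + 2 * lam ^ 2 * K ^ 2 := by positivity
  have hq0 : 0 ≤ q := Real.log_nonneg (by nlinarith [sq_nonneg (lam * K)])
  -- With `L = log n > 2.07` one has `30 (4 + q) (L - 2) ≥ 4L + q`, so the power of `ρ` beats `n⁴ (1
  -- + 2 lam² K²)`. Three powers of `n` are asked for, and the fourth absorbs `log n`.
  refine ⟨Real.exp (30 * (4 + q)), Real.one_le_exp (by positivity), fun n hn => ?_⟩
  have hn8 : (8 : ℝ) ≤ n := by exact_mod_cast hn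
  have hn0 : (0 : ℝ) < n := by linarith
  set L := Real.log n with hL
  have hL8 : 2.07 < L := log_eight_gt.trans_le (Real.log_le_log (by norm_num) hn8)
  have hLn : L ≤ n := (Real.log_le_sub_one_of_pos hn0).trans (by linarith)
  have hnL : (n : ℝ) = Real.exp L := (Real.exp_log hn0).symm
  rw [← Real.exp_mul]
  have h1 : Real.exp (30 * (4 + q) * (2 - L)) ≤ Real.exp (-(4 * L) + -q) := by
    refine Real.exp_le_exp.2 ?_
    nlinarith
  have h2 : Real.exp (-(4 * L) + -q) * ((n : ℝ) ^ 4 * (1 + 2 * lam ^ 2 * K ^ 2)) = 1 := by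
    have e1 : (n : ℝ) ^ 4 = Real.exp (4 * L) := by
      rw [hnL, ← Real.exp_nat_mul]; norm_num
    have e2 : 1 + 2 * lam ^ 2 * K ^ 2 = Real.exp q := (Real.exp_log hq1).symm
    rw [e1, e2, ← Real.exp_add, ← Real.exp_add]
    rw [show -(4 * L) + -q + (4 * L + q) = 0 by ring, Real.exp_zero]
  rw [← h2]
  calc 2 * lam ^ 2 * (n : ℝ) ^ 3 * (K ^ 2 * L * Real.exp (30 * (4 + q) * (2 - L)))
      = Real.exp (30 * (4 + q) * (2 - L)) * ((n : ℝ) ^ 3 * L * (2 * lam ^ 2 * K ^ 2)) := by ring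
    _ ≤ Real.exp (-(4 * L) + -q) * ((n : ℝ) ^ 3 * n * (1 + 2 * lam ^ 2 * K ^ 2)) := by
        gcongr
        linarith
    _ = _ := by ring

end Truncation

/-! ### Soft thresholding and the width of the null space set -/

section SoftThreshold

variable {n : ℕ}

/-- The squared norm of the soft thresholding of `h` at level `t`. -/
noncomputable def softSq (t : ℝ) (h : Fin n → ℝ) : ℝ := ∑ j, max 0 (|h j| - t) ^ 2

theorem softSq_nonneg (t : ℝ) (h : Fin n → ℝ) : 0 ≤ softSq t h :=
  Finset.sum_nonneg fun _ _ => sq_nonneg _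

theorem continuous_softSq (t : ℝ) : Continuous (softSq t : (Fin n → ℝ) → ℝ) := by
  unfold softSq; fun_prop

theorem softSq_le (t : ℝ) (ht : 0 ≤ t) (h : Fin n → ℝ) : softSq t h ≤ ∑ j, h j ^ 2 := by
  refine Finset.sum_le_sum fun j _ => ?_
  rw [← sq_abs (h j)]
  exact pow_le_pow_left₀ (le_max_left _ _) (max_le (abs_nonneg _) (by linarith)) 2

/-- The part of each `|h j|` below `t` is paired with the `ℓ¹`-norm of `v`, the excess with its
Euclidean norm. Vectors of the null space set have both norms controlled. -/
theorem abs_sum_mul_le_softSq (t : ℝ) (h : Fin n → ℝ) (v : EuclideanSpace ℝ (Fin n)) :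
    |∑ j, h j * v j| ≤ √(softSq t h) * ‖v‖ + t * l1Norm v := by
  calc |∑ j, h j * v j| ≤ ∑ j, |h j * v j| := Finset.abs_sum_le_sum_abs _ _
    _ ≤ ∑ j, (max 0 (|h j| - t) * |v j| + t * |v j|) := by
        refine Finset.sum_le_sum fun j _ => ?_
        rw [abs_mul, ← add_mul]
        refine mul_le_mul_of_nonneg_right ?_ (abs_nonneg _)
        linarith [le_max_right 0 (|h j| - t)]
    _ = ∑ j, max 0 (|h j| - t) * |v j| + t * l1Norm v := by
        rw [Finset.sum_add_distrib, l1Norm, Finset.mul_sum]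
    _ ≤ _ := by
        have := Real.sum_mul_le_sqrt_mul_sqrt Finset.univ (fun j => max 0 (|h j| - t))
          (fun j => |v j|)
        rw [EuclideanSpace.norm_eq]
        simpa [softSq] using this

/-- For `|x| ≥ t` one has `(|x| - t)² ≤ x² ≤ 2x² - t²`. Each coordinate thus costs only the small
factor `exp (-c t²)` beyond 1. -/
theorem exp_soft_le {c t : ℝ} (hc : 0 ≤ c) (ht : 0 ≤ t) (x : ℝ) :
    Real.exp (c * max 0 (|x| - t) ^ 2) ≤
      1 + Real.exp (-(c * t ^ 2)) * Real.exp (2 * c * x ^ 2) := by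
  rcases le_total (|x|) t with h | h
  · rw [max_eq_left (by linarith)]
    have : 0 < Real.exp (-(c * t ^ 2)) * Real.exp (2 * c * x ^ 2) := by positivity
    simp only [ne_eq, OfNat.ofNat_ne_zero, not_false_eq_true, zero_pow, mul_zero, Real.exp_zero]
    linarith
  · rw [max_eq_right (by linarith), ← Real.exp_add]
    have h1 : (|x| - t) ^ 2 ≤ x ^ 2 := by
      rw [← sq_abs x]; exact pow_le_pow_left₀ (by linarith) (by linarith) 2
    have h2 : t ^ 2 ≤ x ^ 2 := by rw [← sq_abs x]; exact pow_le_pow_left₀ ht h 2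
    have : Real.exp (c * (|x| - t) ^ 2) ≤ Real.exp (-(c * t ^ 2) + 2 * c * x ^ 2) :=
      Real.exp_le_exp.2 (by nlinarith)
    linarith

variable {Ω : Type*} [MeasurableSpace Ω] {P : Measure Ω} [IsProbabilityMeasure P]

theorem integrable_exp_sq {X : Ω → ℝ} (hX : Measurable X) (hB : ∃ B, ∀ ω, |X ω| ≤ B) {c : ℝ}
    (hc : 0 ≤ c) : Integrable (fun ω => Real.exp (c * X ω ^ 2)) P := by
  obtain ⟨B, hB⟩ := hB
  refine integrable_of_forall_abs_le (by fun_prop) (B := Real.exp (c * B ^ 2)) fun ω => ?_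
  rw [abs_of_pos (Real.exp_pos _)]
  refine Real.exp_le_exp.2 (mul_le_mul_of_nonneg_left ?_ hc)
  rw [← sq_abs]
  exact pow_le_pow_left₀ (abs_nonneg _) (hB ω) 2

/-- Exponential moments of the soft thresholding of a vector with independent sub-Gaussian
coordinates. -/
theorem integral_exp_softSq_le {H : Fin n → Ω → ℝ} {u c t : ℝ} (hu : 0 ≤ u) (hc : 0 ≤ c)
    (hcu : 16 * c * u ≤ 1) (ht : 0 ≤ t) (hH : ∀ j, SubGaussMoments P (H j) u)
    (hind : iIndepFun H P) :
    ∫ ω, Real.exp (c * softSq t fun j => H j ω) ∂P ≤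
      Real.exp (2 * n * Real.exp (-(c * t ^ 2))) := by
  have hone : ∀ j, ∫ ω, Real.exp (c * max 0 (|H j ω| - t) ^ 2) ∂P ≤
      Real.exp (2 * Real.exp (-(c * t ^ 2))) := by
    intro j
    have ie : Integrable (fun ω => Real.exp (2 * c * H j ω ^ 2)) P :=
      integrable_exp_sq (hH j).measurable (hH j).bounded (by positivity)
    calc ∫ ω, Real.exp (c * max 0 (|H j ω| - t) ^ 2) ∂P
        ≤ ∫ ω, (1 + Real.exp (-(c * t ^ 2)) * Real.exp (2 * c * H j ω ^ 2)) ∂P :=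
          integral_mono_of_nonneg (Filter.Eventually.of_forall fun ω => (Real.exp_pos _).le)
            ((integrable_const _).add (ie.const_mul _))
            (Filter.Eventually.of_forall fun ω => exp_soft_le hc ht _)
      _ = 1 + Real.exp (-(c * t ^ 2)) * ∫ ω, Real.exp (2 * c * H j ω ^ 2) ∂P := by
          rw [integral_add (integrable_const _) (ie.const_mul _), integral_const_mul]; simp
      _ ≤ 1 + Real.exp (-(c * t ^ 2)) * 2 := by
          gcongr
          exact (hH j).integral_exp_sq_le hu (by positivity) (by linarith)
      _ ≤ _ := by
          have := Real.add_one_le_exp (2 * Real.exp (-(c * t ^ 2)))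
          linarith
  have hprod : ∫ ω, Real.exp (c * softSq t fun j => H j ω) ∂P =
      ∏ j, ∫ ω, Real.exp (c * max 0 (|H j ω| - t) ^ 2) ∂P := by
    rw [← hind.integral_fun_prod_comp (fun j => (hH j).measurable.aemeasurable)
      (f := fun j x => Real.exp (c * max 0 (|x| - t) ^ 2)) (fun j => by fun_prop)]
    congr 1; ext ω
    rw [softSq, Finset.mul_sum, Real.exp_sum]
  rw [hprod]
  calc _ ≤ ∏ _j : Fin n, Real.exp (2 * Real.exp (-(c * t ^ 2))) :=
        Finset.prod_le_prod (fun j _ => integral_nonneg fun ω => (Real.exp_pos _).le)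
          fun j _ => hone j
    _ = _ := by
        rw [Finset.prod_const, Finset.card_univ, Fintype.card_fin, ← Real.exp_nat_mul]
        congr 1; ring

end SoftThreshold

/-! ### Independence of rows and columns, and orthogonality -/

section Grouping

variable {Ω : Type*} [MeasurableSpace Ω] {P : Measure Ω} [IsProbabilityMeasure P]

/-- The rows of an array of independent random variables are independent. -/
theorem iIndepFun_curry {ι κ 𝓧 : Type*} [Fintype ι] [Fintype κ] [MeasurableSpace 𝓧]
    {X : ι → κ → Ω → 𝓧} (hX : ∀ i j, Measurable (X i j))
    (h : iIndepFun (fun p : ι × κ => X p.1 p.2) P) :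
    iIndepFun (fun i ω j => X i j ω) P := by
  have hpr : ∀ i j, IsProbabilityMeasure (P.map (X i j)) := fun i j =>
    Measure.isProbabilityMeasure_map (hX i j).aemeasurable
  have hrow : ∀ i, P.map (fun ω j => X i j ω) = Measure.infinitePi fun j => P.map (X i j) := by
    intro i
    have hi : iIndepFun (fun j => X i j) P :=
      h.precomp (g := fun j => (i, j)) fun _ _ hj => (Prod.mk.inj hj).2
    exact hi.map_fun_eq_infinitePi_map (hX i)
  have hall := h.map_fun_eq_infinitePi_map (fun p : ι × κ => hX p.1 p.2)
  rw [iIndepFun_iff_map_fun_eq_infinitePi_map fun i => measurable_pi_iff.2 fun j => hX i j]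
  simp_rw [hrow]
  rw [← Measure.infinitePi_map_curry (fun i j => P.map (X i j)), ← hall,
    Measure.map_map (MeasurableEquiv.measurable _) (measurable_pi_iff.2 fun p : ι × κ => hX p.1 p.2)]
  rfl

theorem iIndepFun_curry_swap {ι κ 𝓧 : Type*} [Fintype ι] [Fintype κ] [MeasurableSpace 𝓧]
    {X : ι → κ → Ω → 𝓧} (hX : ∀ i j, Measurable (X i j))
    (h : iIndepFun (fun p : ι × κ => X p.1 p.2) P) :
    iIndepFun (fun j ω i => X i j ω) P :=
  iIndepFun_curry (X := fun j i => X i j) (fun j i => hX i j)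
    (h.precomp (g := Prod.swap) Prod.swap_injective)

/-- Independent centered square integrable variables are orthogonal. -/
theorem integral_sq_sum_eq {ι : Type*} {X : ι → Ω → ℝ} (hX : ∀ i, MemLp (X i) 2 P)
    (h0 : ∀ i, ∫ ω, X i ω ∂P = 0) (hind : iIndepFun X P) (s : Finset ι) :
    ∫ ω, (∑ i ∈ s, X i ω) ^ 2 ∂P = ∑ i ∈ s, ∫ ω, X i ω ^ 2 ∂P := by
  have hv := IndepFun.variance_sum (s := s) (fun i _ => hX i)
    fun i _ j _ hij => hind.indepFun hij
  have hsum : MemLp (∑ i ∈ s, X i) 2 P := memLp_finsetSum' s fun i _ => hX i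
  rw [variance_of_integral_eq_zero hsum.1.aemeasurable (by
    simp only [Finset.sum_apply]
    rw [integral_finsetSum _ fun i _ => (hX i).integrable one_le_two]
    exact Finset.sum_eq_zero fun i _ => h0 i)] at hv
  simp only [Finset.sum_apply] at hv
  rw [hv]
  exact Finset.sum_congr rfl fun i _ => variance_of_integral_eq_zero (hX i).1.aemeasurable (h0 i)

/-- Jensen's inequality for the square root, read off from the nonnegativity of the variance. -/
theorem integral_sqrt_le {f : Ω → ℝ} (hf : Integrable f P) (h0 : ∀ ω, 0 ≤ f ω) :
    Integrable (fun ω => √(f ω)) P ∧ ∫ ω, √(f ω) ∂P ≤ √(∫ ω, f ω ∂P) := by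
  have hm : MemLp (fun ω => √(f ω)) 2 P := by
    rw [memLp_two_iff_integrable_sq
      (Real.continuous_sqrt.comp_aestronglyMeasurable hf.aestronglyMeasurable)]
    simpa only [Real.sq_sqrt (h0 _)] using hf
  refine ⟨hm.integrable one_le_two, Real.le_sqrt_of_sq_le ?_⟩
  have h1 := variance_nonneg (fun ω => √(f ω)) P
  rw [variance_eq_sub hm] at h1
  simp only [Pi.pow_apply, Real.sq_sqrt (h0 _)] at h1
  linarith

end Grouping

theorem SubGaussMoments.mono {Ω : Type*} [MeasurableSpace Ω] {P : Measure Ω} {X : Ω → ℝ}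
    {u v : ℝ} (h : SubGaussMoments P X u) (hu : 0 ≤ u) (huv : u ≤ v) : SubGaussMoments P X v where
  measurable := h.measurable
  bounded := h.bounded
  moment k := (h.moment k).trans (by gcongr)

/-! ### Light and heavy parts of the dictionary -/

section Entries

variable {Ω : Type*} [MeasurableSpace Ω] {P : Measure Ω} [IsProbabilityMeasure P]
  {d n : ℕ} {a : Fin d → Fin n → Ω → ℝ} {K σ : ℝ}

/-- The truncation level. -/
noncomputable def level (K ρ : ℝ) (n : ℕ) : ℝ := K * ρ * √(Real.log n)

/-- The bounded part of the entries of an array. -/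
noncomputable def lightPart (P : Measure Ω) (a : Fin d → Fin n → Ω → ℝ) (K ρ : ℝ)
    (x : Fin d → Fin n → ℝ) (i : Fin d) (j : Fin n) : ℝ :=
  light P (a i j) (level K ρ n) (x i j)

/-- The remaining part of the entries of an array. -/
noncomputable def heavyPart (P : Measure Ω) (a : Fin d → Fin n → Ω → ℝ) (K ρ : ℝ)
    (x : Fin d → Fin n → ℝ) (i : Fin d) (j : Fin n) : ℝ :=
  x i j - lightPart P a K ρ x i j

theorem measurable_lightPart (K ρ : ℝ) (i : Fin d) (j : Fin n) :
    Measurable fun x => lightPart P a K ρ x i j :=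
  (measurable_light _ _).comp (by fun_prop)

theorem measurable_heavyPart (K ρ : ℝ) (i : Fin d) (j : Fin n) :
    Measurable fun x => heavyPart P a K ρ x i j := by
  unfold heavyPart
  exact Measurable.sub (by fun_prop) (measurable_lightPart K ρ i j)

theorem two_le_log {n : ℕ} (hn : 8 ≤ n) : 2 ≤ Real.log n := by
  have : Real.log 8 ≤ Real.log n := Real.log_le_log (by norm_num) (by exact_mod_cast hn)
  linarith [log_eight_gt]

/-- Light coordinates of a combination of rows. -/
theorem IsLogSubgaussianFamily.subGaussMoments_light_sum (ha : IsLogSubgaussianFamily P a K σ)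
    (hK : 0 < K) (hn : 8 ≤ n) {ρ : ℝ} (hρ : 1 ≤ ρ) (y : Fin d → ℝ) (hy : ∑ i, y i ^ 2 ≤ 1)
    (j : Fin n) :
    SubGaussMoments P (fun ω => ∑ i, y i * lightPart P a K ρ (fun i j => a i j ω) i j)
      (32 * K ^ 2 * ρ ^ 2) := by
  have hind : iIndepFun (fun i => a i j) P :=
    ha.indep.precomp (g := fun i => (i, j)) fun _ _ h => (Prod.mk.inj h).1
  have hM : 0 ≤ level K ρ n := by
    have : 0 ≤ ρ := by linarith
    unfold level; positivity
  have h := SubGaussMoments.sum (P := P) (u := 8 * K ^ 2 * ρ ^ 2) (by positivity)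
    (fun i => subGaussMoments_light (ha.measurable i j) hK (two_le_log hn) hρ (ha.moment_le i j))
    (hind.comp (fun i x => light P (a i j) (level K ρ n) x) fun i => measurable_light _ _)
    (fun i => integral_light (ha.measurable i j) hM) y Finset.univ
  refine SubGaussMoments.mono h (by positivity) ?_
  have h2 : 0 ≤ K ^ 2 * ρ ^ 2 := by positivity
  nlinarith

theorem IsLogSubgaussianFamily.iIndepFun_column (ha : IsLogSubgaussianFamily P a K σ)
    (F : Fin n → (Fin d → ℝ) → ℝ) (hF : ∀ j, Measurable (F j)) :
    iIndepFun (fun j ω => F j fun i => a i j ω) P :=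
  (iIndepFun_curry_swap ha.measurable ha.indep).comp F hF

/-- Exponential moments of the light coordinates of a combination of rows. -/
theorem IsLogSubgaussianFamily.integral_exp_softSq (ha : IsLogSubgaussianFamily P a K σ)
    (hK : 0 < K) (hn : 8 ≤ n) {ρ : ℝ} (hρ : 1 ≤ ρ) (y : Fin d → ℝ) (hy : ∑ i, y i ^ 2 ≤ 1)
    {c t : ℝ} (hc : 0 ≤ c) (hcu : 16 * c * (32 * K ^ 2 * ρ ^ 2) ≤ 1) (ht : 0 ≤ t) :
    ∫ ω, Real.exp (c * softSq t fun j =>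
      ∑ i, y i * lightPart P a K ρ (fun i j => a i j ω) i j) ∂P ≤
      Real.exp (2 * n * Real.exp (-(c * t ^ 2))) := by
  refine integral_exp_softSq_le (u := 32 * K ^ 2 * ρ ^ 2) (by positivity) hc hcu ht
    (fun j => ha.subGaussMoments_light_sum hK hn hρ y hy j) ?_
  exact ha.iIndepFun_column (fun j x => ∑ i, y i * light P (a i j) (level K ρ n) (x i)) fun j =>
    Finset.measurable_sum _ fun i _ => ((measurable_light _ _).comp (measurable_pi_apply i)).const_mul _

/-- Second moments of the heavy coordinates of a combination of rows. -/
theorem IsLogSubgaussianFamily.integral_sq_heavy_sum (ha : IsLogSubgaussianFamily P a K σ)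
    (hK : 0 < K) (hn : 8 ≤ n) {ρ : ℝ} (hρ : 1 ≤ ρ) (y : Fin d → ℝ) (j : Fin n) :
    MemLp (fun ω => ∑ i, y i * heavyPart P a K ρ (fun i j => a i j ω) i j) 2 P ∧
    ∫ ω, (∑ i, y i * heavyPart P a K ρ (fun i j => a i j ω) i j) ^ 2 ∂P ≤
      (∑ i, y i ^ 2) * (K ^ 2 * Real.log n * ρ ^ (2 - Real.log n)) := by
  have hind : iIndepFun (fun i => a i j) P :=
    ha.indep.precomp (g := fun i => (i, j)) fun _ _ h => (Prod.mk.inj h).1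
  have hE := fun i => integral_sq_sub_light_le (ha.measurable i j) (ha.centered i j) hK
    (two_le_log hn) hρ (ha.moment_le i j)
  have hm : ∀ i, MemLp (fun ω => y i * heavyPart P a K ρ (fun i j => a i j ω) i j) 2 P :=
    fun i => (hE i).1.const_mul (y i)
  refine ⟨memLp_finsetSum _ fun i _ => hm i, ?_⟩
  rw [integral_sq_sum_eq hm (fun i => by
      rw [integral_const_mul]
      exact mul_eq_zero_of_right _ (hE i).2.1)
    (hind.comp (fun i x => y i * (x - light P (a i j) (level K ρ n) x)) fun i =>
      (measurable_id.sub (measurable_light _ _)).const_mul _) Finset.univ, Finset.sum_mul]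
  refine Finset.sum_le_sum fun i _ => ?_
  simp_rw [mul_pow]
  rw [integral_const_mul]
  exact mul_le_mul_of_nonneg_left (hE i).2.2 (sq_nonneg _)

end Entries

/-- Comparison of the complexity parameters with `s log (n / s)`. -/
theorem exists_width_constant (c κ θ : ℝ) (hc : 0 < c) (hκ : 0 ≤ κ) (hθ : 0 < θ) (hθ1 : θ < 1) :
    ∃ C₁ : ℝ, 0 < C₁ ∧ ∀ n s : ℕ, 1 ≤ s → (s : ℝ) ≤ θ * n →
      0 < Real.log (n / s) ∧
      Real.exp (-(c * √(Real.log (n / s) / c) ^ 2)) = s / n ∧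
      √(2 * s / c) + √(Real.log (n / s) / c) * (κ * √(s : ℝ)) + 1 ≤
        C₁ * √(s * Real.log (n / s)) := by
  set q := Real.log (1 / θ) with hq
  have hq0 : 0 < q := Real.log_pos (by rw [lt_div_iff₀ hθ]; linarith)
  -- Since `s ≤ θ n`, the logarithm is at least `q = log (1/θ)`. The first and the last summand
  -- absorb `√s` and the constant 1 with this bound; the middle one matches the `ℓ¹`-term exactly.
  refine ⟨√(2 / (c * q)) + κ * √(1 / c) + √(1 / q), by positivity, fun n s hs hsn => ?_⟩
  have hs1 : (1 : ℝ) ≤ s := by exact_mod_cast hs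
  have hs0 : (0 : ℝ) < s := by linarith
  have hn0 : (0 : ℝ) < n := by
    by_contra h
    push Not at h
    nlinarith
  have hqL : q ≤ Real.log (n / s) := by
    refine Real.log_le_log (by positivity) ?_
    rw [div_le_div_iff₀ hθ hs0]; linarith
  set Λ := Real.log (n / s) with hΛ
  have hΛ0 : 0 < Λ := hq0.trans_le hqL
  refine ⟨hΛ0, ?_, ?_⟩
  · rw [Real.sq_sqrt (by positivity), mul_div_cancel₀ _ hc.ne', Real.exp_neg, hΛ,
      Real.exp_log (by positivity), inv_div]
  · have h1 : √(2 * s / c) ≤ √(2 / (c * q)) * √(s * Λ) := by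
      rw [← Real.sqrt_mul (by positivity)]
      refine Real.sqrt_le_sqrt ?_
      rw [div_mul_eq_mul_div, div_le_div_iff₀ hc (by positivity)]
      have := mul_le_mul_of_nonneg_left hqL (by positivity : 0 ≤ 2 * (s : ℝ) * c)
      linarith
    have h2 : √(Λ / c) * (κ * √(s : ℝ)) = κ * √(1 / c) * √(s * Λ) := by
      have e : √(Λ / c) * √(s : ℝ) = √(1 / c) * √(s * Λ) := by
        rw [← Real.sqrt_mul (by positivity), ← Real.sqrt_mul (by positivity)]
        congr 1; ring
      calc _ = κ * (√(Λ / c) * √(s : ℝ)) := by ring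
        _ = _ := by rw [e]; ring
    have h3 : 1 ≤ √(1 / q) * √(s * Λ) := by
      rw [← Real.sqrt_mul (by positivity)]
      refine Real.one_le_sqrt.2 ?_
      rw [div_mul_eq_mul_div, le_div_iff₀ hq0]
      nlinarith
    rw [h2]
    linarith

/-- The random rows of the array, as vectors. -/
noncomputable def rowVec {Ω : Type*} {d n : ℕ} (a : Fin d → Fin n → Ω → ℝ) (i : Fin d) (ω : Ω) :
    EuclideanSpace ℝ (Fin n) := WithLp.toLp 2 fun j => a i j ω

theorem norm_sq_mulCLM_div {k n : ℕ} (x : Fin k → EuclideanSpace ℝ (Fin n))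
    (v : EuclideanSpace ℝ (Fin n)) :
    ‖mulCLM (Matrix.of fun i j => x i j / √(k : ℝ)) v‖ ^ 2 =
      (∑ i, inner ℝ (x i) v ^ 2) / k := by
  rw [EuclideanSpace.norm_sq_eq, Finset.sum_div]
  refine Finset.sum_congr rfl fun i _ => ?_
  have : (mulCLM (Matrix.of fun i j => x i j / √(k : ℝ)) v) i = inner ℝ (x i) v / √(k : ℝ) := by
    simp only [mulCLM, LinearMap.coe_toContinuousLinearMap', Matrix.toLpLin_apply, Matrix.mulVec,
      dotProduct, Matrix.of_apply, PiLp.inner_apply, RCLike.inner_apply, conj_trivial,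
      Finset.sum_div]
    exact Finset.sum_congr rfl fun j _ => by ring
  rw [this, Real.norm_eq_abs, sq_abs, div_pow, Real.sq_sqrt (Nat.cast_nonneg k)]

/-- Normalizing the conclusion of the small ball method; the constants `τ` of both null space
properties have the form `1 / (u √(c/2))`. -/
theorem le_norm_mulCLM_div {k n : ℕ} (hk : 0 < k) (x : Fin k → EuclideanSpace ℝ (Fin n))
    (v : EuclideanSpace ℝ (Fin n)) {u c : ℝ} (hc : 0 ≤ c)
    (h : u ^ 2 * (c * k / 2) ≤ ∑ i, inner ℝ (x i) v ^ 2) :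
    u * √(c / 2) ≤ ‖mulCLM (Matrix.of fun i j => x i j / √(k : ℝ)) v‖ := by
  have hk0 : (0 : ℝ) < k := by exact_mod_cast hk
  refine le_of_sq_le_sq ?_ (norm_nonneg _)
  rw [norm_sq_mulCLM_div, le_div_iff₀ hk0, mul_pow, Real.sq_sqrt (by positivity)]
  linarith

/-! ### The null space property of the dictionary -/

section Dictionary

variable {Ω : Type*} [MeasurableSpace Ω] {P : Measure Ω} [IsProbabilityMeasure P]
  {d n : ℕ} {a : Fin d → Fin n → Ω → ℝ} {K σ : ℝ}

theorem IsLogSubgaussianFamily.memLp_two (ha : IsLogSubgaussianFamily P a K σ) (hn : 8 ≤ n)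
    (i : Fin d) (j : Fin n) : MemLp (a i j) 2 P := by
  refine ⟨(ha.measurable i j).aestronglyMeasurable, ?_⟩
  have := ha.moment_le i j 2 (by norm_num) (two_le_log hn)
  rw [ENNReal.ofReal_ofNat] at this
  exact this.trans_lt ENNReal.ofReal_lt_top

theorem IsLogSubgaussianFamily.measurable_rowVec (ha : IsLogSubgaussianFamily P a K σ)
    (i : Fin d) : Measurable (rowVec a i) :=
  (WithLp.measurable_toLp 2 _).comp (measurable_pi_iff.2 fun j => ha.measurable i j)

theorem IsLogSubgaussianFamily.map_rowVec (ha : IsLogSubgaussianFamily P a K σ) (i₀ : Fin d) :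
    P.map (fun ω i => rowVec a i ω) = Measure.pi fun _ : Fin d => P.map (rowVec a i₀) := by
  have hr : iIndepFun (rowVec a) P :=
    (iIndepFun_curry ha.measurable ha.indep).comp (fun _ x => WithLp.toLp 2 x)
      fun _ => WithLp.measurable_toLp 2 _
  rw [hr.map_fun_eq_pi_map fun i => (ha.measurable_rowVec i).aemeasurable]
  congr 1
  ext i : 1
  have hmap : ∀ i, P.map (rowVec a i) = (Measure.pi fun j => P.map (a i j)).map (WithLp.toLp 2) := by
    intro i
    have hi : iIndepFun (fun j => a i j) P :=
      ha.indep.precomp (g := fun j => (i, j)) fun _ _ hj => (Prod.mk.inj hj).2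
    rw [← hi.map_fun_eq_pi_map fun j => (ha.measurable i j).aemeasurable,
      Measure.map_map (WithLp.measurable_toLp 2 _) (measurable_pi_iff.2 fun j => ha.measurable i j)]
    rfl
  rw [hmap, hmap]
  congr 2
  ext j : 1
  exact (ha.identDistrib i j i₀ j).map_eq

end Dictionary

section SoftIntegral

variable {Ω : Type*} [MeasurableSpace Ω] {P : Measure Ω} [IsProbabilityMeasure P] {n : ℕ}

theorem exists_softSq_bound {t : ℝ} (ht : 0 ≤ t) {H : Fin n → Ω → ℝ}
    (hH : ∀ j, ∃ B, ∀ ω, |H j ω| ≤ B) : ∃ B, ∀ ω, softSq t (fun j => H j ω) ≤ B := by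
  choose B hB using hH
  refine ⟨∑ j, B j ^ 2, fun ω => (softSq_le t ht _).trans (Finset.sum_le_sum fun j _ => ?_)⟩
  rw [← sq_abs]
  exact pow_le_pow_left₀ (abs_nonneg _) (hB j ω) 2

/-- Jensen's inequality, via the tangent of the exponential at `r`. -/
theorem integral_le_of_integral_exp_le {f : Ω → ℝ} {c r : ℝ} (hf : Integrable f P)
    (he : Integrable (fun ω => Real.exp (c * f ω)) P)
    (h : ∫ ω, Real.exp (c * f ω) ∂P ≤ Real.exp r) : c * ∫ ω, f ω ∂P ≤ r := by
  have h1 : ∫ ω, Real.exp r * (1 - r + c * f ω) ∂P ≤ ∫ ω, Real.exp (c * f ω) ∂P := by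
    refine integral_mono (((integrable_const _).add (hf.const_mul c)).const_mul _) he fun ω => ?_
    have h2 := Real.add_one_le_exp (c * f ω - r)
    have h3 : Real.exp (c * f ω) = Real.exp r * Real.exp (c * f ω - r) := by
      rw [← Real.exp_add]; congr 1; ring
    simp only
    rw [h3]
    exact mul_le_mul_of_nonneg_left (by linarith) (Real.exp_pos _).le
  rw [integral_const_mul, integral_add (integrable_const _) (hf.const_mul c),
    integral_const_mul] at h1
  simp only [integral_const, probReal_univ, one_smul] at h1
  have h4 := h1.trans h
  nlinarith [Real.exp_pos r]

end SoftIntegral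

section Dictionary

variable {Ω : Type*} [MeasurableSpace Ω] {P : Measure Ω} [IsProbabilityMeasure P]
  {d n : ℕ} {a : Fin d → Fin n → Ω → ℝ} {K σ : ℝ}

/-- Mean of the soft thresholding of the light coordinates. -/
theorem IsLogSubgaussianFamily.integral_softSq_le (ha : IsLogSubgaussianFamily P a K σ)
    (hK : 0 < K) (hn : 8 ≤ n) {ρ : ℝ} (hρ : 1 ≤ ρ) (y : Fin d → ℝ) (hy : ∑ i, y i ^ 2 ≤ 1)
    {c t : ℝ} {s : ℕ} (hc : 0 < c) (hcu : 16 * c * (32 * K ^ 2 * ρ ^ 2) ≤ 1) (ht : 0 ≤ t)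
    (hst : Real.exp (-(c * t ^ 2)) = s / n) :
    Integrable (fun ω => softSq t fun j =>
      ∑ i, y i * lightPart P a K ρ (fun i j => a i j ω) i j) P ∧
    ∫ ω, (softSq t fun j => ∑ i, y i * lightPart P a K ρ (fun i j => a i j ω) i j) ∂P ≤
      2 * s / c := by
  have hH := fun j => ha.subGaussMoments_light_sum hK hn hρ y hy j
  obtain ⟨B, hB⟩ := exists_softSq_bound ht fun j => (hH j).bounded
  have hm : Measurable fun ω => softSq t fun j =>
      ∑ i, y i * lightPart P a K ρ (fun i j => a i j ω) i j :=
    (continuous_softSq t).measurable.comp (measurable_pi_iff.2 fun j => (hH j).measurable)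
  have hi : Integrable (fun ω => softSq t fun j =>
      ∑ i, y i * lightPart P a K ρ (fun i j => a i j ω) i j) P :=
    integrable_of_forall_abs_le hm (B := B) fun ω => by
      rw [abs_of_nonneg (softSq_nonneg _ _)]; exact hB ω
  refine ⟨hi, ?_⟩
  have he : Integrable (fun ω => Real.exp (c * softSq t fun j =>
      ∑ i, y i * lightPart P a K ρ (fun i j => a i j ω) i j)) P :=
    integrable_of_forall_abs_le (Real.measurable_exp.comp (hm.const_mul c))
      (B := Real.exp (c * B)) fun ω => by
        rw [abs_of_pos (Real.exp_pos _)]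
        exact Real.exp_le_exp.2 (mul_le_mul_of_nonneg_left (hB ω) hc.le)
  have h := ha.integral_exp_softSq hK hn hρ y hy hc.le hcu ht
  have hn0 : (n : ℝ) ≠ 0 := by
    have : (8 : ℝ) ≤ n := by exact_mod_cast hn
    linarith
  rw [hst, mul_assoc, mul_div_cancel₀ _ hn0] at h
  have := integral_le_of_integral_exp_le hi he h
  rw [le_div_iff₀ hc]
  linarith

/-- The small ball method for the rows, with centre 0. The normalized column sums split into a light
part, estimated by soft thresholding against the `ℓ¹`-bound of the null space set, and a heavy part,
whose Euclidean norm has mean at most 1 by `hlev`. Only means of suprema enter, so no control of the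
tail of the heavy part is needed. -/
theorem IsLogSubgaussianFamily.measureReal_not_robustNSP (ha : IsLogSubgaussianFamily P a K σ)
    (hK : 0 < K) (hn : 8 ≤ n) (hd : 0 < d) {ρ : ℝ} (hρ : 1 ≤ ρ)
    (hlev : n * (K ^ 2 * Real.log n * ρ ^ (2 - Real.log n)) ≤ 1)
    {ce t : ℝ} {s : ℕ} (hs : 1 ≤ s) (hce : 0 < ce) (hcu : 16 * ce * (32 * K ^ 2 * ρ ^ 2) ≤ 1)
    (ht : 0 ≤ t) (hst : Real.exp (-(ce * t ^ 2)) = s / n) {γ : ℝ} (hγ : 0 < γ)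
    {u c : ℝ} (hu : 0 < u) (hc : 0 < c)
    (hsb : ∀ i, ∀ v : EuclideanSpace ℝ (Fin n), ‖v‖ = 1 →
      c ≤ P.real {ω | 2 * u ≤ |∑ j, a i j ω * v j|})
    (hwidth : √(2 * s / ce) + t * ((1 + 1 / γ) * √(s : ℝ)) + 1 ≤ u * c / 16 * √(d : ℝ)) :
    P.real {ω | ¬ RobustNSP (dictMatrix a ω) s γ (1 / (u * √(c / 2)))} ≤
      Real.exp (-(c ^ 2 * d / 8)) := by
  have hd0 : (0 : ℝ) < d := by exact_mod_cast hd
  have hn0 : (0 : ℝ) < n := by exact_mod_cast (by omega : 0 < n)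
  set i₀ : Fin d := ⟨0, hd⟩
  set μ := P.map (rowVec a i₀) with hμ
  have hrm := ha.measurable_rowVec
  have hμp : IsProbabilityMeasure μ := Measure.isProbabilityMeasure_map (hrm i₀).aemeasurable
  have hinner : ∀ i ω (v : EuclideanSpace ℝ (Fin n)),
      inner ℝ (rowVec a i ω) v = ∑ j, a i j ω * v j := by
    intro i ω v
    simp [rowVec, PiLp.inner_apply, mul_comm]
  have hinti : ∀ v : EuclideanSpace ℝ (Fin n), Integrable (fun ω => ∑ j, a i₀ j ω * v j) P :=
    fun v => integrable_finsetSum _ fun j _ =>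
      ((ha.memLp_two hn i₀ j).integrable one_le_two).mul_const _
  have hμi : ∀ v, Integrable (fun y => inner ℝ y v) μ := by
    intro v
    rw [hμ, integrable_map_measure (by fun_prop) (hrm i₀).aemeasurable]
    simpa only [Function.comp_def, hinner] using hinti v
  have hμ0 : ∀ v, ∫ y, inner ℝ y v ∂μ = 0 := by
    intro v
    rw [hμ, integral_map (hrm i₀).aemeasurable (by fun_prop)]
    simp only [hinner]
    rw [integral_finsetSum _ fun j _ =>
      ((ha.memLp_two hn i₀ j).integrable one_le_two).mul_const _]
    refine Finset.sum_eq_zero fun j _ => ?_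
    rw [integral_mul_const, ha.centered, zero_mul]
  set δ : ℝ := 1 / √(d : ℝ) with hδ
  have hδd : δ * √(d : ℝ) = 1 := by rw [hδ]; field_simp
  have hδ2 : ∑ _i : Fin d, δ ^ 2 = 1 := by
    rw [Finset.sum_const, Finset.card_univ, Fintype.card_fin, nsmul_eq_mul, hδ, div_pow,
      Real.sq_sqrt hd0.le]
    field_simp
  -- the light and the heavy part of the column sums
  set Hl : (Fin d → Fin n → ℝ) → Fin n → ℝ := fun x j => ∑ i, δ * lightPart P a K ρ x i j with hHl
  set Hh : (Fin d → Fin n → ℝ) → Fin n → ℝ := fun x j => ∑ i, δ * heavyPart P a K ρ x i j with hHh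
  have hHlm : Measurable Hl := measurable_pi_iff.2 fun j => Finset.measurable_sum _ fun i _ =>
    (measurable_lightPart K ρ i j).const_mul δ
  have hHhm : Measurable Hh := measurable_pi_iff.2 fun j => Finset.measurable_sum _ fun i _ =>
    (measurable_heavyPart K ρ i j).const_mul δ
  -- A majorant of the linear process over the whole null space set; `√d` undoes the normalization
  -- `δ`.
  set g : (Fin d → Fin n → ℝ) → ℝ := fun x => √(d : ℝ) *
    (√(softSq t (Hl x)) + t * ((1 + 1 / γ) * √(s : ℝ)) + √(∑ j, Hh x j ^ 2)) with hg
  have hgm : Measurable g := by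
    have h1 : Measurable fun x => softSq t (Hl x) := (continuous_softSq t).measurable.comp hHlm
    have h2 : Measurable fun x => ∑ j, Hh x j ^ 2 :=
      Finset.measurable_sum _ fun j _ => ((measurable_pi_apply j).comp hHhm).pow_const 2
    exact ((h1.sqrt.add_const _).add h2.sqrt).const_mul _
  have hl := ha.integral_softSq_le hK hn hρ (fun _ => δ) hδ2.le hce hcu ht hst
  have hsl := integral_sqrt_le hl.1 fun ω => softSq_nonneg _ _
  have hh := fun j => ha.integral_sq_heavy_sum hK hn hρ (fun _ => δ) j
  have hhi : Integrable (fun ω => ∑ j, Hh (fun i j => a i j ω) j ^ 2) P :=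
    integrable_finsetSum _ fun j _ => (hh j).1.integrable_sq
  have hhb : ∫ ω, ∑ j, Hh (fun i j => a i j ω) j ^ 2 ∂P ≤ 1 := by
    rw [integral_finsetSum _ fun j _ => (hh j).1.integrable_sq]
    refine (Finset.sum_le_sum fun j _ => (hh j).2).trans ?_
    rw [hδ2, Finset.sum_const, Finset.card_univ, Fintype.card_fin, nsmul_eq_mul, one_mul]
    exact hlev
  have hsh := integral_sqrt_le hhi fun ω => Finset.sum_nonneg fun _ _ => sq_nonneg _
  have hlaw := ha.map_rowVec i₀
  have hallm : Measurable fun ω (i : Fin d) => rowVec a i ω := measurable_pi_iff.2 hrm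
  have hGm : Measurable fun y : Fin d → EuclideanSpace ℝ (Fin n) => g fun i j => y i j :=
    hgm.comp (measurable_pi_iff.2 fun i => measurable_pi_iff.2 fun j => by fun_prop)
  have hgi : Integrable (fun ω => g fun i j => a i j ω) P :=
    ((hsl.1.add (integrable_const _)).add hsh.1).const_mul _
  have hgb : ∫ ω, g (fun i j => a i j ω) ∂P ≤ u * c * d / 16 := by
    have e1 : ∫ ω, g (fun i j => a i j ω) ∂P = √(d : ℝ) *
        (∫ ω, √(softSq t (Hl fun i j => a i j ω)) ∂P + t * ((1 + 1 / γ) * √(s : ℝ)) +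
          ∫ ω, √(∑ j, Hh (fun i j => a i j ω) j ^ 2) ∂P) := by
      have i1 : Integrable (fun ω => √(softSq t (Hl fun i j => a i j ω)) +
          t * ((1 + 1 / γ) * √(s : ℝ))) P := hsl.1.add (integrable_const _)
      rw [hg, integral_const_mul, integral_add i1 hsh.1, integral_add hsl.1 (integrable_const _)]
      simp only [integral_const, probReal_univ, one_smul]
      rfl
    have h1 : ∫ ω, √(softSq t (Hl fun i j => a i j ω)) ∂P ≤ √(2 * s / ce) :=
      hsl.2.trans (Real.sqrt_le_sqrt hl.2)
    have h2 : ∫ ω, √(∑ j, Hh (fun i j => a i j ω) j ^ 2) ∂P ≤ 1 :=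
      hsh.2.trans (Real.sqrt_le_one.2 hhb)
    rw [e1]
    calc _ ≤ √(d : ℝ) * (u * c / 16 * √(d : ℝ)) :=
          mul_le_mul_of_nonneg_left (by linarith) (Real.sqrt_nonneg _)
      _ = u * c / 16 * (√(d : ℝ) * √(d : ℝ)) := by ring
      _ = _ := by rw [Real.mul_self_sqrt hd0.le]; ring
  have hmain := measureReal_exists_mem_lt (μ := μ) (m := d) hd hμi hμ0 (nspSet n s γ) 0 hu hc.le
    (fun v hv => by
      rw [hμ, map_measureReal_apply (hrm i₀) (measurableSet_le measurable_const (by fun_prop))]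
      simpa only [Set.preimage_ofPred_eq, hinner] using hsb i₀ v hv.1)
    (G := fun y => g fun i j => y i j)
    (by
      rw [← hlaw, integrable_map_measure hGm.aestronglyMeasurable hallm.aemeasurable]
      exact hgi)
    (fun y v hv => by
      have e1 : inner ℝ (∑ i, y i) (v - 0) = √(d : ℝ) *
          (∑ j, Hl (fun i j => y i j) j * v j + ∑ j, Hh (fun i j => y i j) j * v j) := by
        rw [sub_zero, ← Finset.sum_add_distrib, Finset.mul_sum, PiLp.inner_apply]
        refine Finset.sum_congr rfl fun j _ => ?_
        have e2 : Hl (fun i j => y i j) j + Hh (fun i j => y i j) j = δ * ∑ i, y i j := by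
          rw [hHl, hHh, ← Finset.sum_add_distrib, Finset.mul_sum]
          refine Finset.sum_congr rfl fun i _ => ?_
          simp only [heavyPart]
          ring
        rw [← add_mul, e2]
        simp only [RCLike.inner_apply, conj_trivial, WithLp.ofLp_sum, Finset.sum_apply]
        calc v j * ∑ i, y i j = (δ * √(d : ℝ)) * (v j * ∑ i, y i j) := by rw [hδd, one_mul]
          _ = _ := by ring
      rw [e1, abs_mul, abs_of_nonneg (Real.sqrt_nonneg _)]
      refine mul_le_mul_of_nonneg_left ((abs_add_le _ _).trans (add_le_add ?_ ?_))
        (Real.sqrt_nonneg _)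
      · refine (abs_sum_mul_le_softSq t _ v).trans ?_
        rw [hv.1, mul_one]
        gcongr
        exact l1Norm_le_of_mem_nspSet hs hγ hv
      · have h1 := Real.sum_mul_le_sqrt_mul_sqrt Finset.univ
          (fun j => |Hh (fun i j => y i j) j|) (fun j => |v j|)
        have h2 : √(∑ j, |v j| ^ 2) = 1 := by
          rw [← hv.1, EuclideanSpace.norm_eq]; simp
        rw [h2, mul_one] at h1
        simp only [sq_abs] at h1
        refine ((Finset.abs_sum_le_sum_abs _ _).trans (le_of_eq ?_)).trans h1
        exact Finset.sum_congr rfl fun j _ => abs_mul _ _)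
    (by
      rw [← hlaw, integral_map hallm.aemeasurable hGm.aestronglyMeasurable]
      exact hgb)
  refine le_trans ?_ hmain
  rw [← hlaw]
  -- The failure event is a union over uncountably many vectors; the inequality between a measure
  -- and its image used here holds for arbitrary sets.
  refine ENNReal.toReal_mono (measure_ne_top _ _) ?_
  refine (measure_mono fun ω hω => ?_).trans (Measure.le_map_apply hallm.aemeasurable _)
  by_contra hcon
  refine hω fun v hv => ?_
  rw [one_div_one_div]
  have h1 : u ^ 2 * (c * d / 2) ≤ ∑ i, inner ℝ (rowVec a i ω) v ^ 2 := by
    by_contra h2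
    push Not at h2
    exact hcon ⟨v, hv, h2⟩
  exact le_norm_mulCLM_div hd (fun i => rowVec a i ω) v hc.le h1

end Dictionary

/-! ### A net adapted to weights -/

section Net

/-- Rounding towards zero, so that the integer stays within `⌊B⌋`; rounding down could leave this
range for negative `x`. -/
theorem exists_int_abs_sub_le {x B : ℝ} (hx : |x| ≤ B) :
    ∃ k : ℤ, |k| ≤ ⌊B⌋ ∧ |x - k| ≤ 1 := by
  rcases le_total 0 x with h | h
  · refine ⟨⌊x⌋, ?_, ?_⟩
    · rw [abs_of_nonneg (Int.floor_nonneg.2 h)]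
      exact Int.floor_le_floor (by rwa [abs_of_nonneg h] at hx)
    · rw [abs_le]
      constructor <;> linarith [Int.floor_le x, Int.lt_floor_add_one x]
  · refine ⟨-⌊-x⌋, ?_, ?_⟩
    · rw [abs_neg, abs_of_nonneg (Int.floor_nonneg.2 (by linarith))]
      exact Int.floor_le_floor (by rwa [abs_of_nonpos h] at hx)
    · push_cast
      rw [abs_le]
      constructor <;> linarith [Int.floor_le (-x), Int.lt_floor_add_one (-x)]

/-- A light coordinate (`x < 1`) needs a single grid point. The quadratic bound expresses this and
has a mean computable from second moments. -/
theorem floor_le_sq {x : ℝ} (hx : 0 ≤ x) : (⌊x⌋ : ℝ) ≤ x ^ 2 := by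
  rcases lt_or_ge x 1 with h | h
  · have : ⌊x⌋ = 0 := Int.floor_eq_zero_iff.2 ⟨hx, h⟩
    rw [this]
    simpa using sq_nonneg x
  · have := Int.floor_le x
    nlinarith

/-- The mesh width of a coordinate with weight `y`. -/
noncomputable def mesh (N y : ℝ) : ℝ := if y = 0 then 1 else 1 / (N * y)

theorem mesh_nonneg {N y : ℝ} (hN : 0 ≤ N) (hy : 0 ≤ y) : 0 ≤ mesh N y := by
  unfold mesh; split_ifs <;> positivity

theorem mesh_mul_le {N y : ℝ} (hN : 0 < N) : mesh N y * y ≤ 1 / N := by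
  unfold mesh
  split_ifs with h
  · rw [h]; simp only [mul_zero]; positivity
  · exact le_of_eq (by field_simp)

/-- A coordinatewise net of the unit cube, with mesh adapted to the weights `y`. -/
theorem exists_weighted_net {n : ℕ} (y : Fin n → ℝ) (hy : ∀ j, 0 ≤ y j) {N : ℝ} (hN : 0 < N) :
    ∃ I : Finset (Fin n → ℝ), (I.card : ℝ) ≤ ∏ j, (1 + 2 * (N * y j) ^ 2) ∧
      ∀ v : Fin n → ℝ, (∀ j, |v j| ≤ 1) → ∃ w ∈ I, ∀ j, |v j - w j| ≤ mesh N (y j) := by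
  classical
  have hNy : ∀ j, 0 ≤ N * y j := fun j => mul_nonneg hN.le (hy j)
  -- Integer multiples of `1 / (N y j)`. For `y j = 0` division by zero gives the single point 0, in
  -- accordance with mesh 1.
  let J : Finset (Fin n → ℤ) :=
    Fintype.piFinset fun j => Finset.Icc (-⌊N * y j⌋) ⌊N * y j⌋
  refine ⟨J.image fun k j => k j / (N * y j), ?_, fun v hv => ?_⟩
  · have h1 : ((J.image fun k j => (k j : ℝ) / (N * y j)).card : ℝ) ≤ (J.card : ℝ) := by
      exact_mod_cast Finset.card_image_le
    refine h1.trans ?_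
    rw [Fintype.card_piFinset, Nat.cast_prod]
    refine Finset.prod_le_prod (fun _ _ => Nat.cast_nonneg _) fun j _ => ?_
    have hf := Int.floor_nonneg.2 (hNy j)
    rw [Int.card_Icc]
    have h2 : (((⌊N * y j⌋ + 1 - -⌊N * y j⌋).toNat : ℤ) : ℝ) = 2 * (⌊N * y j⌋ : ℝ) + 1 := by
      rw [Int.toNat_of_nonneg (by linarith)]
      push_cast; ring
    rw [Int.cast_natCast] at h2
    rw [h2]
    linarith [floor_le_sq (hNy j)]
  · have hx : ∀ j, |v j * (N * y j)| ≤ N * y j := fun j => by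
      rw [abs_mul, abs_of_nonneg (hNy j)]
      exact mul_le_of_le_one_left (hNy j) (hv j)
    choose k hk1 hk2 using fun j => exists_int_abs_sub_le (hx j)
    refine ⟨_, Finset.mem_image_of_mem _ (Fintype.mem_piFinset.2 fun j =>
      Finset.mem_Icc.2 (abs_le.1 (hk1 j)) : k ∈ J), fun j => ?_⟩
    unfold mesh
    split_ifs with h
    · simpa [h] using hv j
    · have h0 : 0 < N * y j := mul_pos hN ((hy j).lt_of_ne' h)
      have : v j - k j / (N * y j) = (v j * (N * y j) - k j) / (N * y j) := by
        field_simp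
      rw [this, abs_div, abs_of_pos h0]
      exact div_le_div_of_nonneg_right (hk2 j) h0.le

end Net

/-! ### Sums of independent measurement vectors -/

section Sums

variable {E : Type*} [MeasurableSpace E] {μ : Measure E} [IsProbabilityMeasure μ]

theorem memLp_sum_comp_eval {m : ℕ} {f : E → ℝ} (hf : MemLp f 2 μ) :
    MemLp (fun y : Fin m → E => ∑ i, f (y i)) 2 (Measure.pi fun _ => μ) :=
  memLp_finsetSum _ fun i _ => hf.comp_measurePreserving (measurePreserving_eval (fun _ => μ) i)

theorem integral_sq_sum_comp_eval {m : ℕ} {f : E → ℝ} (hfm : Measurable f) (hf : MemLp f 2 μ)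
    (h0 : ∫ x, f x ∂μ = 0) :
    ∫ y : Fin m → E, (∑ i, f (y i)) ^ 2 ∂(Measure.pi fun _ => μ) = m * ∫ x, f x ^ 2 ∂μ := by
  rw [integral_sq_sum_eq (X := fun i (y : Fin m → E) => f (y i))
    (fun i => hf.comp_measurePreserving (measurePreserving_eval (fun _ => μ) i))
    (fun i => by rw [integral_comp_eval (μ := fun _ : Fin m => μ) hf.1, h0])
    (iIndepFun_pi fun _ => hfm.aemeasurable) Finset.univ]
  have : ∀ i : Fin m, ∫ y : Fin m → E, f (y i) ^ 2 ∂(Measure.pi fun _ => μ) = ∫ x, f x ^ 2 ∂μ :=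
    fun i => integral_comp_eval (μ := fun _ : Fin m => μ) (hf.1.pow 2)
  simp [this]

theorem integral_abs_sum_comp_eval_le {m : ℕ} {f : E → ℝ} (hfm : Measurable f)
    (hf : MemLp f 2 μ) (h0 : ∫ x, f x ∂μ = 0) :
    ∫ y : Fin m → E, |∑ i, f (y i)| ∂(Measure.pi fun _ => μ) ≤
      √(m : ℝ) * √(∫ x, f x ^ 2 ∂μ) := by
  have h := (integral_sqrt_le (memLp_sum_comp_eval (m := m) hf).integrable_sq
    fun _ => sq_nonneg _).2
  rw [integral_sq_sum_comp_eval hfm hf h0, Real.sqrt_mul (Nat.cast_nonneg m)] at h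
  simpa only [Real.sqrt_sq_eq_abs] using h

end Sums

/-- A centered law on `ℝᵈ` whose coordinates have second moment at most `lam ^ 2`. -/
structure HasBoundedCoordinates {d : ℕ} (μ : Measure (EuclideanSpace ℝ (Fin d))) (lam : ℝ) :
    Prop where
  memLp : ∀ k, MemLp (fun y : EuclideanSpace ℝ (Fin d) => y k) 2 μ
  centered : ∀ k, ∫ y, y k ∂μ = 0
  sq_le : ∀ k, ∫ y, y k ^ 2 ∂μ ≤ lam ^ 2

/-- The soft thresholding of the products of the columns of `L` with the direction of `y`. -/
noncomputable def dirSoft {d n : ℕ} (t : ℝ) (L : Fin d → Fin n → ℝ)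
    (y : EuclideanSpace ℝ (Fin d)) : ℝ :=
  softSq t fun j => ∑ i, (‖y‖⁻¹ * y i) * L i j

/-- The normalized columns of an array. -/
noncomputable def column {d n : ℕ} (H : Fin d → Fin n → ℝ) (j : Fin n) :
    EuclideanSpace ℝ (Fin d) := WithLp.toLp 2 fun i => H i j / √(d : ℝ)

/-! ### Small ball method for the measurements of a fixed dictionary -/

section Law

variable {d n : ℕ} {μ : Measure (EuclideanSpace ℝ (Fin d))} [IsProbabilityMeasure μ] {lam : ℝ}

theorem inner_eq_sum (y b : EuclideanSpace ℝ (Fin d)) : inner ℝ y b = ∑ k, b k * y k := by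
  simp [PiLp.inner_apply]

theorem HasBoundedCoordinates.memLp_inner (hμ : HasBoundedCoordinates μ lam)
    (b : EuclideanSpace ℝ (Fin d)) : MemLp (fun y => inner ℝ y b) 2 μ := by
  simp only [inner_eq_sum]
  exact memLp_finsetSum _ fun k _ => (hμ.memLp k).const_mul (b k)

theorem HasBoundedCoordinates.integral_inner (hμ : HasBoundedCoordinates μ lam)
    (b : EuclideanSpace ℝ (Fin d)) : ∫ y, inner ℝ y b ∂μ = 0 := by
  simp only [inner_eq_sum]
  rw [integral_finsetSum _ fun k _ => ((hμ.memLp k).const_mul (b k)).integrable one_le_two]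
  refine Finset.sum_eq_zero fun k _ => ?_
  rw [integral_const_mul, hμ.centered, mul_zero]

theorem sum_sq_direction_le (y : EuclideanSpace ℝ (Fin d)) :
    ∑ i, (‖y‖⁻¹ * y i) ^ 2 ≤ 1 := by
  simp_rw [mul_pow]
  rw [← Finset.mul_sum, ← EuclideanSpace.real_norm_sq_eq]
  rcases eq_or_ne ‖y‖ 0 with h | h
  · simp [h]
  · rw [← mul_pow, inv_mul_cancel₀ h, one_pow]

theorem abs_direction_le (y : EuclideanSpace ℝ (Fin d)) (i : Fin d) : |‖y‖⁻¹ * y i| ≤ 1 := by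
  rw [← sq_le_one_iff_abs_le_one]
  exact (Finset.single_le_sum (f := fun i => (‖y‖⁻¹ * y i) ^ 2) (fun _ _ => sq_nonneg _)
    (Finset.mem_univ i)).trans (sum_sq_direction_le y)

theorem dirSoft_nonneg (t : ℝ) (L : Fin d → Fin n → ℝ) (y : EuclideanSpace ℝ (Fin d)) :
    0 ≤ dirSoft t L y := softSq_nonneg _ _

theorem dirSoft_le {t : ℝ} (ht : 0 ≤ t) (L : Fin d → Fin n → ℝ) (y : EuclideanSpace ℝ (Fin d)) :
    dirSoft t L y ≤ ∑ j, (∑ i, |L i j|) ^ 2 := by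
  refine (softSq_le t ht _).trans (Finset.sum_le_sum fun j _ => ?_)
  rw [← sq_abs]
  refine pow_le_pow_left₀ (abs_nonneg _) ((Finset.abs_sum_le_sum_abs _ _).trans
    (Finset.sum_le_sum fun i _ => ?_)) 2
  rw [abs_mul]
  exact mul_le_of_le_one_left (abs_nonneg _) (abs_direction_le y i)

theorem measurable_dirSoft {X : Type*} [MeasurableSpace X] (t : ℝ) {L : X → Fin d → Fin n → ℝ}
    (hL : ∀ i j, Measurable fun x => L x i j) {y : X → EuclideanSpace ℝ (Fin d)}
    (hy : Measurable y) : Measurable fun x => dirSoft t (L x) (y x) := by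
  refine (continuous_softSq t).measurable.comp (measurable_pi_iff.2 fun j =>
    Finset.measurable_sum _ fun i _ => ?_)
  exact ((hy.norm.inv).mul (by fun_prop)).mul (hL i j)

theorem measurable_sum_vec {m : ℕ} :
    Measurable fun y : Fin m → EuclideanSpace ℝ (Fin d) => ∑ i, y i :=
  Finset.measurable_sum _ fun i _ => measurable_pi_apply i

theorem measurable_dirSoft_sum {m : ℕ} (t : ℝ) (L : Fin d → Fin n → ℝ) :
    Measurable fun y : Fin m → EuclideanSpace ℝ (Fin d) => dirSoft t L (∑ i, y i) :=
  measurable_dirSoft (L := fun _ => L) t (fun _ _ => measurable_const) measurable_sum_vec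

theorem integrable_dirSoft {m : ℕ} {t : ℝ} (ht : 0 ≤ t) (L : Fin d → Fin n → ℝ) :
    Integrable (fun y : Fin m → EuclideanSpace ℝ (Fin d) => dirSoft t L (∑ i, y i))
      (Measure.pi fun _ => μ) :=
  integrable_of_forall_abs_le (measurable_dirSoft_sum t L) (B := ∑ j, (∑ i, |L i j|) ^ 2) fun y => by
      rw [abs_of_nonneg (dirSoft_nonneg _ _ _)]
      exact dirSoft_le ht _ _

theorem HasBoundedCoordinates.integral_norm_sq_sum_le (hμ : HasBoundedCoordinates μ lam) (m : ℕ) :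
    Integrable (fun y : Fin m → EuclideanSpace ℝ (Fin d) => ‖∑ i, y i‖ ^ 2)
      (Measure.pi fun _ => μ) ∧
    ∫ y : Fin m → EuclideanSpace ℝ (Fin d), ‖∑ i, y i‖ ^ 2 ∂(Measure.pi fun _ => μ) ≤
      m * d * lam ^ 2 := by
  have h : ∀ y : Fin m → EuclideanSpace ℝ (Fin d), ‖∑ i, y i‖ ^ 2 = ∑ k, (∑ i, y i k) ^ 2 := by
    intro y
    rw [EuclideanSpace.real_norm_sq_eq]
    simp
  have hi : ∀ k, Integrable (fun y : Fin m → EuclideanSpace ℝ (Fin d) => (∑ i, y i k) ^ 2)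
      (Measure.pi fun _ => μ) := fun k => (memLp_sum_comp_eval (hμ.memLp k)).integrable_sq
  simp_rw [h]
  refine ⟨integrable_finsetSum _ fun k _ => hi k, ?_⟩
  rw [integral_finsetSum _ fun k _ => hi k]
  calc _ ≤ ∑ _k : Fin d, (m : ℝ) * lam ^ 2 := Finset.sum_le_sum fun k _ => by
        rw [integral_sq_sum_comp_eval (f := fun y : EuclideanSpace ℝ (Fin d) => y k)
          (by fun_prop) (hμ.memLp k) (hμ.centered k)]
        exact mul_le_mul_of_nonneg_left (hμ.sq_le k) (Nat.cast_nonneg m)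
    _ = _ := by
      rw [Finset.sum_const, Finset.card_univ, Fintype.card_fin, nsmul_eq_mul]; ring

/-- In the light part the length of `y` is factored out, which leaves weights of Euclidean norm at
most 1, as the sub-Gaussian bounds require. The heavy part is kept column by column for the net. -/
theorem inner_mulCLM_eq (L H : Fin d → Fin n → ℝ) (y : EuclideanSpace ℝ (Fin d))
    (v : EuclideanSpace ℝ (Fin n)) :
    inner ℝ y (mulCLM (Matrix.of fun i j => (L i j + H i j) / √(d : ℝ)) v) =
      ‖y‖ / √(d : ℝ) * ∑ j, (∑ i, (‖y‖⁻¹ * y i) * L i j) * v j +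
        ∑ j, inner ℝ y (column H j) * v j := by
  have hy : ∀ i, y i = ‖y‖ * (‖y‖⁻¹ * y i) := by
    intro i
    rcases eq_or_ne ‖y‖ 0 with h | h
    · rw [norm_eq_zero] at h
      simp [h]
    · rw [mul_inv_cancel_left₀ h]
  have h1 : ∀ i, (mulCLM (Matrix.of fun i j => (L i j + H i j) / √(d : ℝ)) v) i =
      ∑ j, (L i j + H i j) / √(d : ℝ) * v j := by
    intro i
    simp [mulCLM, Matrix.toLpLin_apply, Matrix.mulVec, dotProduct]
  simp only [inner_eq_sum, h1, column]
  simp only [Finset.sum_mul, Finset.mul_sum]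
  rw [Finset.sum_comm, ← Finset.sum_add_distrib]
  refine Finset.sum_congr rfl fun j _ => ?_
  rw [← Finset.sum_add_distrib]
  refine Finset.sum_congr rfl fun i _ => ?_
  have := hy i
  calc _ = y i * (L i j / √(d : ℝ) * v j) + H i j / √(d : ℝ) * y i * v j := by ring
    _ = ‖y‖ * (‖y‖⁻¹ * y i) * (L i j / √(d : ℝ) * v j) + H i j / √(d : ℝ) * y i * v j := by
      rw [← this]
    _ = _ := by ring

/-- The lower tail of the quadratic process of the rows over the image of `nspSet`. -/
theorem HasBoundedCoordinates.measureReal_exists_lt (hμ : HasBoundedCoordinates μ lam)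
    {m s : ℕ} (hm : 0 < m) (hd : 0 < d) (hn : 0 < n) (hs : 1 ≤ s) {γ : ℝ} (hγ : 0 < γ)
    (L H : Fin d → Fin n → ℝ) {D : Matrix (Fin d) (Fin n) ℝ}
    (hD : D = Matrix.of fun i j => (L i j + H i j) / √(d : ℝ))
    {t u c β : ℝ} (ht : 0 ≤ t) (hu : 0 < u) (hc : 0 ≤ c)
    (hsb : ∀ v ∈ nspSet n s γ, c ≤ μ.real {y | 2 * u ≤ |inner ℝ y (mulCLM D v)|})
    (hlam : 0 < lam) (hβ : 0 < β) (hβu : lam * β ≤ u * c / 32)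
    (hS : ∫ y : Fin m → EuclideanSpace ℝ (Fin d), dirSoft t L (∑ i, y i)
      ∂(Measure.pi fun _ => μ) ≤ β ^ 2 * m)
    (hw : lam * (t * ((1 + 1 / γ) * √(s : ℝ))) + 1 ≤ u * c / 32 * √(m : ℝ)) :
    (Measure.pi fun _ : Fin m => μ).real
        {y | ∃ v ∈ nspSet n s γ, ∑ i, inner ℝ (y i) (mulCLM D v) ^ 2 < u ^ 2 * (c * m / 2)} ≤
      (∏ j, (1 + 2 * (n : ℝ) ^ 2 * ∫ y, inner ℝ y (column H j) ^ 2 ∂μ)) *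
        Real.exp (-(c ^ 2 * m / 8)) := by
  have hn0 : (0 : ℝ) < n := by exact_mod_cast hn
  have hd0 : (0 : ℝ) < d := by exact_mod_cast hd
  set π := (Measure.pi fun _ : Fin m => μ) with hπ
  set b := column H with hb
  set q : Fin n → ℝ := fun j => √(∫ y, inner ℝ y (b j) ^ 2 ∂μ) with hq
  have hq0 : ∀ j, 0 ≤ q j := fun j => Real.sqrt_nonneg _
  obtain ⟨I, hI, hnet⟩ := exists_weighted_net q hq0 hn0
  set κ := (1 + 1 / γ) * √(s : ℝ) with hκ
  have hκ0 : 0 ≤ κ := by positivity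
  -- The first summand dominates the light part on the whole null space set, the second the heavy
  -- part inside a single cell.
  let G : (Fin m → EuclideanSpace ℝ (Fin d)) → ℝ := fun y =>
    ‖∑ i, y i‖ / √(d : ℝ) * (√(dirSoft t L (∑ i, y i)) + t * κ) +
      ∑ j, mesh n (q j) * |∑ i, inner ℝ (y i) (b j)|
  -- an integrable majorant of `G`
  let G' : (Fin m → EuclideanSpace ℝ (Fin d)) → ℝ := fun y =>
    ((β / lam) * (‖∑ i, y i‖ ^ 2 / d) + (lam / β) * dirSoft t L (∑ i, y i)) / 2 +
      t * κ / √(d : ℝ) * ‖∑ i, y i‖ + ∑ j, mesh n (q j) * |∑ i, inner ℝ (y i) (b j)|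
  have hN := hμ.integral_norm_sq_sum_le m
  have hN1 := integral_sqrt_le hN.1 fun _ => sq_nonneg _
  simp only [Real.sqrt_sq (norm_nonneg _)] at hN1
  have hDs := integrable_dirSoft (μ := μ) (m := m) ht L
  have hbi : ∀ j, Integrable (fun y : Fin m → EuclideanSpace ℝ (Fin d) =>
      |∑ i, inner ℝ (y i) (b j)|) π := fun j =>
    ((memLp_sum_comp_eval (hμ.memLp_inner (b j))).integrable one_le_two).abs
  have i1 : Integrable (fun y : Fin m → EuclideanSpace ℝ (Fin d) =>
      ((β / lam) * (‖∑ i, y i‖ ^ 2 / d) + (lam / β) * dirSoft t L (∑ i, y i)) / 2) π :=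
    (((hN.1.div_const _).const_mul _).add (hDs.const_mul _)).div_const _
  have i2 : Integrable (fun y : Fin m → EuclideanSpace ℝ (Fin d) =>
      t * κ / √(d : ℝ) * ‖∑ i, y i‖) π := hN1.1.const_mul _
  have i3 : Integrable (fun y : Fin m → EuclideanSpace ℝ (Fin d) =>
      ∑ j, mesh n (q j) * |∑ i, inner ℝ (y i) (b j)|) π :=
    integrable_finsetSum _ fun j _ => (hbi j).const_mul _
  have hG'i : Integrable G' π := (i1.add i2).add i3
  have hmesh0 : ∀ j, 0 ≤ mesh n (q j) := fun j => mesh_nonneg hn0.le (hq0 j)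
  have hG'b : ∫ y, G' y ∂π ≤ u * c * m / 16 := by
    have e1 : ∫ y, ((β / lam) * (‖∑ i, y i‖ ^ 2 / d) + (lam / β) * dirSoft t L (∑ i, y i)) / 2 ∂π ≤
        lam * β * m := by
      rw [integral_div, integral_add ((hN.1.div_const _).const_mul _) (hDs.const_mul _),
        integral_const_mul, integral_const_mul, integral_div]
      have a1 := div_le_div_of_nonneg_right hN.2 hd0.le
      have a2 : (m * d * lam ^ 2 / d : ℝ) = m * lam ^ 2 := by field_simp
      rw [a2] at a1
      have a3 := mul_le_mul_of_nonneg_left a1 (div_pos hβ hlam).le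
      have a4 := mul_le_mul_of_nonneg_left hS (div_pos hlam hβ).le
      have a5 : β / lam * (m * lam ^ 2) = lam * β * m := by field_simp
      have a6 : lam / β * (β ^ 2 * m) = lam * β * m := by field_simp
      linarith
    have e2 : ∫ y : Fin m → EuclideanSpace ℝ (Fin d), t * κ / √(d : ℝ) * ‖∑ i, y i‖ ∂π ≤
        √(m : ℝ) * (lam * (t * κ)) := by
      rw [integral_const_mul]
      have a1 := hN1.2.trans (Real.sqrt_le_sqrt hN.2)
      rw [Real.sqrt_mul (by positivity), Real.sqrt_sq hlam.le, Real.sqrt_mul (by positivity)] at a1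
      refine (mul_le_mul_of_nonneg_left a1 (by positivity)).trans (le_of_eq ?_)
      field_simp
    -- The mesh times the `L²`-size of a heavy column is at most `1/n`, so the `n` columns together
    -- contribute only `√m`.
    have e3 : ∫ y : Fin m → EuclideanSpace ℝ (Fin d),
        ∑ j, mesh n (q j) * |∑ i, inner ℝ (y i) (b j)| ∂π ≤ √(m : ℝ) := by
      rw [integral_finsetSum _ fun j _ => (hbi j).const_mul _]
      have : ∀ j, ∫ y : Fin m → EuclideanSpace ℝ (Fin d),
          mesh n (q j) * |∑ i, inner ℝ (y i) (b j)| ∂π ≤ √(m : ℝ) * (1 / n) := by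
        intro j
        rw [integral_const_mul]
        refine (mul_le_mul_of_nonneg_left (integral_abs_sum_comp_eval_le (by fun_prop)
          (hμ.memLp_inner (b j)) (hμ.integral_inner (b j))) (hmesh0 j)).trans ?_
        calc _ = √(m : ℝ) * (mesh n (q j) * q j) := by rw [hq]; ring
          _ ≤ _ := mul_le_mul_of_nonneg_left (mesh_mul_le hn0) (Real.sqrt_nonneg _)
      refine (Finset.sum_le_sum fun j _ => this j).trans (le_of_eq ?_)
      rw [Finset.sum_const, Finset.card_univ, Fintype.card_fin, nsmul_eq_mul]
      field_simp
    have e4 : ∫ y, G' y ∂π = _ := (integral_add (i1.add i2) i3).trans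
      (congrArg (· + _) (integral_add i1 i2))
    rw [e4]
    have hmm := Real.mul_self_sqrt (Nat.cast_nonneg (α := ℝ) m)
    have h5 := mul_le_mul_of_nonneg_left hw (Real.sqrt_nonneg (m : ℝ))
    have h6 := mul_le_mul_of_nonneg_right hβu (Nat.cast_nonneg (α := ℝ) m)
    have h7 : √(m : ℝ) * (u * c / 32 * √(m : ℝ)) = u * c / 32 * m := by
      rw [← hmm]; ring_nf; rw [Real.sqrt_sq (Real.sqrt_nonneg _)]
    linarith
  have hGm : Measurable G := by
    have m1 := measurable_dirSoft_sum (m := m) t L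
    have m2 : Measurable fun y : Fin m → EuclideanSpace ℝ (Fin d) => ‖∑ i, y i‖ :=
      measurable_sum_vec.norm
    exact ((m2.div_const _).mul (m1.sqrt.add_const _)).add (Finset.measurable_sum _ fun j _ =>
      (Measurable.abs (Finset.measurable_sum _ fun i _ => by fun_prop)).const_mul _)
  have hG0 : ∀ y, 0 ≤ G y := fun y => add_nonneg (by positivity)
    (Finset.sum_nonneg fun j _ => mul_nonneg (hmesh0 j) (abs_nonneg _))
  have hGG' : ∀ y, G y ≤ G' y := by
    intro y
    refine add_le_add ?_ le_rfl
    set r := ‖∑ i, y i‖ / √(d : ℝ) with hr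
    set w := √(dirSoft t L (∑ i, y i)) with hw'
    have h1 : ‖∑ i, y i‖ ^ 2 / d = r ^ 2 := by rw [hr, div_pow, Real.sq_sqrt hd0.le]
    have h2 : dirSoft t L (∑ i, y i) = w ^ 2 := (Real.sq_sqrt (dirSoft_nonneg _ _ _)).symm
    have h3 : t * κ / √(d : ℝ) * ‖∑ i, y i‖ = r * (t * κ) := by rw [hr]; ring
    rw [h1, h2, h3, mul_add]
    refine add_le_add ?_ le_rfl
    -- Weighted AM-GM replaces the product `r w` by squares with known means; the weights make both
    -- mean bounds equal to `lam β m`.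
    have h4 : 0 ≤ (β * r - lam * w) ^ 2 / (2 * lam * β) := by positivity
    have h5 : (β * r - lam * w) ^ 2 / (2 * lam * β) =
        (β / lam * r ^ 2 + lam / β * w ^ 2) / 2 - r * w := by field_simp; ring
    linarith
  have hGi : Integrable G π := hG'i.mono' hGm.aestronglyMeasurable
    (Filter.Eventually.of_forall fun y => by
      rw [Real.norm_eq_abs, abs_of_nonneg (hG0 y)]; exact hGG' y)
  have hGb : ∫ y, G y ∂π ≤ u * c * m / 16 := (integral_mono hGi hG'i hGG').trans hG'b
  -- The images of the null space vectors in the cell around `w`. Recentering at `∑ wⱼ bⱼ` leaves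
  -- only `v - w` paired with the heavy columns.
  let T : (Fin n → ℝ) → Set (EuclideanSpace ℝ (Fin d)) := fun w =>
    {z | ∃ v ∈ nspSet n s γ, (∀ j, |v j - w j| ≤ mesh n (q j)) ∧ z = mulCLM D v}
  let F : (Fin n → ℝ) → Set (Fin m → EuclideanSpace ℝ (Fin d)) := fun w =>
    {y | ∃ z ∈ T w, ∑ i, inner ℝ (y i) z ^ 2 < u ^ 2 * (c * m / 2)}
  have hcell : ∀ w ∈ I, π.real (F w) ≤ Real.exp (-(c ^ 2 * m / 8)) := by
    intro w _
    refine measureReal_exists_mem_lt hm (fun z => (hμ.memLp_inner z).integrable one_le_two)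
      hμ.integral_inner (T w) (∑ j, w j • b j) hu hc ?_ hGi ?_ hGb
    · rintro z ⟨v, hv, -, rfl⟩
      exact hsb v hv
    · rintro y z ⟨v, hv, hvw, rfl⟩
      set Y := ∑ i, y i with hY
      have h1 : inner ℝ Y (mulCLM D v - ∑ j, w j • b j) =
          ‖Y‖ / √(d : ℝ) * (∑ j, (∑ i, (‖Y‖⁻¹ * Y i) * L i j) * v j) +
            ∑ j, inner ℝ Y (b j) * (v j - w j) := by
        rw [inner_sub_right, hD, inner_mulCLM_eq, inner_sum]
        simp only [inner_smul_right, mul_sub, Finset.sum_sub_distrib]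
        rw [add_sub_assoc]
        congr 3
        exact funext fun j => mul_comm _ _
      rw [h1]
      refine (abs_add_le _ _).trans (add_le_add ?_ ?_)
      · rw [abs_mul, abs_of_nonneg (by positivity : 0 ≤ ‖Y‖ / √(d : ℝ))]
        refine mul_le_mul_of_nonneg_left ((abs_sum_mul_le_softSq t _ v).trans ?_) (by positivity)
        rw [hv.1, mul_one]
        exact add_le_add le_rfl (mul_le_mul_of_nonneg_left (l1Norm_le_of_mem_nspSet hs hγ hv) ht)
      · refine (Finset.abs_sum_le_sum_abs _ _).trans (Finset.sum_le_sum fun j _ => ?_)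
        rw [abs_mul, mul_comm, hY, sum_inner]
        exact mul_le_mul_of_nonneg_right (hvw j) (abs_nonneg _)
  have hsub : {y : Fin m → EuclideanSpace ℝ (Fin d) | ∃ v ∈ nspSet n s γ,
      ∑ i, inner ℝ (y i) (mulCLM D v) ^ 2 < u ^ 2 * (c * m / 2)} ⊆
      ⋃ w ∈ I, F w := by
    rintro y ⟨v, hv, hlt⟩
    obtain ⟨w, hw, hvw⟩ := hnet v fun j => by
      have := PiLp.norm_apply_le v j
      rwa [hv.1] at this
    simp only [Set.mem_iUnion]
    exact ⟨w, hw, _, ⟨v, hv, hvw, rfl⟩, hlt⟩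
  calc _ ≤ π.real (⋃ w ∈ I, F w) :=
        measureReal_mono hsub (measure_ne_top _ _)
    _ ≤ ∑ w ∈ I, π.real (F w) :=
        measureReal_biUnion_finset_le _ _
    _ ≤ ∑ _w ∈ I, Real.exp (-(c ^ 2 * m / 8)) := Finset.sum_le_sum hcell
    _ = I.card * Real.exp (-(c ^ 2 * m / 8)) := by rw [Finset.sum_const, nsmul_eq_mul]
    _ ≤ _ := by
        refine mul_le_mul_of_nonneg_right (hI.trans (le_of_eq ?_)) (Real.exp_pos _).le
        refine Finset.prod_congr rfl fun j _ => ?_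
        rw [mul_pow, hq, Real.sq_sqrt (integral_nonneg fun _ => sq_nonneg _), mul_assoc]

end Law

/-! ### Products of independent variables and exponential tails -/

section Products

variable {Ω : Type*} [MeasurableSpace Ω] {P : Measure Ω} [IsProbabilityMeasure P]

theorem integrable_prod_of_iIndepFun {ι : Type*} [Fintype ι] {X : ι → Ω → ℝ}
    (hX : ∀ i, Measurable (X i)) (hind : iIndepFun X P) (hi : ∀ i, Integrable (X i) P) :
    Integrable (fun ω => ∏ i, X i ω) P := by
  have hpr : ∀ i, IsProbabilityMeasure (P.map (X i)) := fun i =>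
    Measure.isProbabilityMeasure_map (hX i).aemeasurable
  have h := Integrable.fintype_prod (μ := fun i => P.map (X i)) (f := fun _ (x : ℝ) => x)
    fun i => (integrable_map_measure (by fun_prop) (hX i).aemeasurable).2 (hi i)
  rw [← hind.map_fun_eq_pi_map fun i => (hX i).aemeasurable,
    integrable_map_measure (by fun_prop) (measurable_pi_iff.2 hX).aemeasurable] at h
  exact h

theorem measureReal_le_of_integral_exp_le {f : Ω → ℝ} {r R : ℝ}
    (he : Integrable (fun ω => Real.exp (f ω)) P) (h : ∫ ω, Real.exp (f ω) ∂P ≤ Real.exp R) :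
    P.real {ω | r ≤ f ω} ≤ Real.exp (R - r) := by
  have h1 := mul_meas_ge_le_integral_of_nonneg
    (Filter.Eventually.of_forall fun ω => (Real.exp_pos (f ω)).le) he (Real.exp r)
  simp only [Real.exp_le_exp] at h1
  rw [Real.exp_sub, le_div_iff₀ (Real.exp_pos r), mul_comm]
  exact h1.trans h

/-- Exponential tail of a mean over an independent variable, by Jensen's inequality. -/
theorem measureReal_le_integral_le {Z : Type*} [MeasurableSpace Z] {ν : Measure Z}
    [IsProbabilityMeasure ν] {f : Ω → Z → ℝ} (hfm : Measurable (Function.uncurry f)) {S c R : ℝ}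
    (hf0 : ∀ ω z, 0 ≤ f ω z) (hfS : ∀ ω z, f ω z ≤ S) (hc : 0 ≤ c)
    (hR : ∀ z, ∫ ω, Real.exp (c * f ω z) ∂P ≤ Real.exp R) (r : ℝ) :
    P.real {ω | r ≤ c * ∫ z, f ω z ∂ν} ≤ Real.exp (R - r) := by
  have hfi : ∀ ω, Integrable (f ω) ν := fun ω =>
    integrable_of_forall_abs_le (hfm.comp measurable_prodMk_left) (B := S) fun z => by
      rw [abs_of_nonneg (hf0 ω z)]; exact hfS ω z
  have hem : Measurable (Function.uncurry fun ω z => Real.exp (c * f ω z)) :=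
    Real.measurable_exp.comp (hfm.const_mul c)
  have heB : ∀ ω z, |Real.exp (c * f ω z)| ≤ Real.exp (c * S) := fun ω z => by
    rw [abs_of_pos (Real.exp_pos _)]
    exact Real.exp_le_exp.2 (mul_le_mul_of_nonneg_left (hfS ω z) hc)
  have hei : Integrable (Function.uncurry fun ω z => Real.exp (c * f ω z)) (P.prod ν) :=
    integrable_of_forall_abs_le hem fun p => heB p.1 p.2
  have hei' : ∀ ω, Integrable (fun z => Real.exp (c * f ω z)) ν := fun ω =>
    integrable_of_forall_abs_le (hem.comp measurable_prodMk_left) (heB ω)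
  have hjen : ∀ ω, Real.exp (c * ∫ z, f ω z ∂ν) ≤ ∫ z, Real.exp (c * f ω z) ∂ν := by
    intro ω
    rw [← integral_const_mul]
    exact convexOn_exp.map_integral_le Real.continuous_exp.continuousOn isClosed_univ
      (Filter.Eventually.of_forall fun _ => trivial) ((hfi ω).const_mul c) (hei' ω)
  have hWm : Measurable fun ω => ∫ z, f ω z ∂ν :=
    hfm.stronglyMeasurable.integral_prod_right.measurable
  have hWi : Integrable (fun ω => Real.exp (c * ∫ z, f ω z ∂ν)) P :=
    hei.integral_prod_left.mono' (Real.measurable_exp.comp (hWm.const_mul c)).aestronglyMeasurable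
      (Filter.Eventually.of_forall fun ω => by
        rw [Real.norm_eq_abs, abs_of_pos (Real.exp_pos _)]; exact hjen ω)
  refine measureReal_le_of_integral_exp_le hWi ?_
  calc _ ≤ ∫ ω, ∫ z, Real.exp (c * f ω z) ∂ν ∂P := integral_mono hWi hei.integral_prod_left hjen
    _ = ∫ z, ∫ ω, Real.exp (c * f ω z) ∂P ∂ν := integral_integral_swap hei
    _ ≤ ∫ _z, Real.exp R ∂ν := integral_mono hei.integral_prod_right (integrable_const _) hR
    _ = _ := by simp

end Products

/-! ### Rare events for the frozen dictionary -/

section Dictionary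

variable {Ω : Type*} [MeasurableSpace Ω] {P : Measure Ω} [IsProbabilityMeasure P]
  {d n : ℕ} {a : Fin d → Fin n → Ω → ℝ} {K σ : ℝ}
  {μ : Measure (EuclideanSpace ℝ (Fin d))} [IsProbabilityMeasure μ] {lam : ℝ}

/-- The second moment of the products with a vector. -/
noncomputable def energy (μ : Measure (EuclideanSpace ℝ (Fin d))) (b : EuclideanSpace ℝ (Fin d)) :
    ℝ := ∫ y, inner ℝ y b ^ 2 ∂μ

theorem energy_nonneg (b : EuclideanSpace ℝ (Fin d)) : 0 ≤ energy μ b :=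
  integral_nonneg fun _ => sq_nonneg _

theorem measurable_energy : Measurable (energy μ) := by
  have : StronglyMeasurable fun p : EuclideanSpace ℝ (Fin d) × EuclideanSpace ℝ (Fin d) =>
      inner ℝ p.2 p.1 ^ 2 := by
    apply Measurable.stronglyMeasurable
    fun_prop
  exact this.integral_prod_right'.measurable

theorem measurable_column {X : Type*} [MeasurableSpace X] {H : X → Fin d → Fin n → ℝ} {j : Fin n}
    (hH : ∀ i, Measurable fun x => H x i j) : Measurable fun x => column (H x) j :=
  (WithLp.measurable_toLp 2 _).comp (measurable_pi_iff.2 fun i => (hH i).div_const _)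

/-- Mean energy of the heavy columns. -/
theorem IsLogSubgaussianFamily.integral_energy_le (ha : IsLogSubgaussianFamily P a K σ)
    (hμ : HasBoundedCoordinates μ lam) (hK : 0 < K) (hn : 8 ≤ n) (hd : 0 < d) {ρ : ℝ}
    (hρ : 1 ≤ ρ) (j : Fin n) :
    Integrable (fun ω => energy μ (column (heavyPart P a K ρ fun i j => a i j ω) j)) P ∧
    ∫ ω, energy μ (column (heavyPart P a K ρ fun i j => a i j ω) j) ∂P ≤
      lam ^ 2 * (K ^ 2 * Real.log n * ρ ^ (2 - Real.log n)) := by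
  have hd0 : (0 : ℝ) < d := by exact_mod_cast hd
  set η := K ^ 2 * Real.log n * ρ ^ (2 - Real.log n) with hη
  have hη0 : 0 ≤ η := by
    have := two_le_log hn
    have : 0 ≤ ρ := by linarith
    positivity
  have hin : ∀ ω (y : EuclideanSpace ℝ (Fin d)),
      inner ℝ y (column (heavyPart P a K ρ fun i j => a i j ω) j) =
        ∑ i, (y i / √(d : ℝ)) * heavyPart P a K ρ (fun i j => a i j ω) i j := by
    intro ω y
    rw [inner_eq_sum]
    exact Finset.sum_congr rfl fun i _ => by simp only [column]; ring
  have hh2 : ∀ i, MemLp (fun ω => heavyPart P a K ρ (fun i j => a i j ω) i j) 2 P := fun i =>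
    (integral_sq_sub_light_le (ha.measurable i j) (ha.centered i j) hK (two_le_log hn) hρ
      (ha.moment_le i j)).1
  have hI : Integrable (Function.uncurry fun ω (y : EuclideanSpace ℝ (Fin d)) =>
      (∑ i, (y i / √(d : ℝ)) * heavyPart P a K ρ (fun i j => a i j ω) i j) ^ 2) (P.prod μ) := by
    have hm : ∀ i, MemLp (fun p : Ω × EuclideanSpace ℝ (Fin d) =>
        (p.2 i / √(d : ℝ)) * heavyPart P a K ρ (fun i j => a i j p.1) i j) 2 (P.prod μ) := by
      intro i
      have hs : AEStronglyMeasurable (fun p : Ω × EuclideanSpace ℝ (Fin d) =>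
          (p.2 i / √(d : ℝ)) * heavyPart P a K ρ (fun i j => a i j p.1) i j) (P.prod μ) := by
        refine AEStronglyMeasurable.mul ?_ (hh2 i).1.comp_fst
        exact Measurable.aestronglyMeasurable (by fun_prop)
      rw [memLp_two_iff_integrable_sq hs]
      have := (hh2 i).integrable_sq.mul_prod ((hμ.memLp i).integrable_sq.div_const (d : ℝ))
      refine this.congr (Filter.Eventually.of_forall fun p => ?_)
      simp only [mul_pow, div_pow, Real.sq_sqrt hd0.le]
      ring
    exact (memLp_finsetSum _ fun i _ => hm i).integrable_sq
  simp only [energy, hin]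
  refine ⟨hI.integral_prod_left, ?_⟩
  rw [integral_integral_swap hI]
  have hb : ∀ y : EuclideanSpace ℝ (Fin d), ∑ i, (y i / √(d : ℝ)) ^ 2 = (∑ i, y i ^ 2) / d := by
    intro y
    simp only [div_pow, Real.sq_sqrt hd0.le, Finset.sum_div]
  have hyi : Integrable (fun y : EuclideanSpace ℝ (Fin d) => (∑ i, y i ^ 2) / d * η) μ :=
    ((integrable_finsetSum _ fun i _ => (hμ.memLp i).integrable_sq).div_const _).mul_const _
  calc _ ≤ ∫ y : EuclideanSpace ℝ (Fin d), (∑ i, y i ^ 2) / d * η ∂μ := by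
        refine integral_mono hI.integral_prod_right hyi fun y => ?_
        have := (ha.integral_sq_heavy_sum hK hn hρ (fun i => y i / √(d : ℝ)) j).2
        rw [hb] at this
        exact this
    _ = (∑ i, ∫ y : EuclideanSpace ℝ (Fin d), y i ^ 2 ∂μ) / d * η := by
        rw [integral_mul_const, integral_div,
          integral_finsetSum _ fun i _ => (hμ.memLp i).integrable_sq]
    _ ≤ (∑ _i : Fin d, lam ^ 2) / d * η := by
        gcongr with i
        exact hμ.sq_le i
    _ = _ := by
        rw [Finset.sum_const, Finset.card_univ, Fintype.card_fin, nsmul_eq_mul]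
        field_simp

/-- The number of cells which the heavy columns require is at most exponential. -/
theorem IsLogSubgaussianFamily.measureReal_prod_energy_le (ha : IsLogSubgaussianFamily P a K σ)
    (hμ : HasBoundedCoordinates μ lam) (hK : 0 < K) (hn : 8 ≤ n) (hd : 0 < d) {ρ : ℝ}
    (hρ : 1 ≤ ρ)
    (hlev : 2 * lam ^ 2 * (n : ℝ) ^ 3 * (K ^ 2 * Real.log n * ρ ^ (2 - Real.log n)) ≤ 1) (r : ℝ) :
    P.real {ω | Real.exp r ≤ ∏ j, (1 + 2 * (n : ℝ) ^ 2 *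
      energy μ (column (heavyPart P a K ρ fun i j => a i j ω) j))} ≤ Real.exp (1 - r) := by
  have hn0 : (0 : ℝ) < n := by exact_mod_cast (by omega : 0 < n)
  set X : Fin n → Ω → ℝ := fun j ω => 1 + 2 * (n : ℝ) ^ 2 *
      energy μ (column (heavyPart P a K ρ fun i j => a i j ω) j) with hX
  have hE := fun j => ha.integral_energy_le hμ hK hn hd hρ j
  have hXi : ∀ j, Integrable (X j) P := fun j =>
    (integrable_const _).add ((hE j).1.const_mul _)
  have hXm : ∀ j, Measurable (X j) := fun j =>
    ((measurable_energy.comp (measurable_column fun i => (measurable_heavyPart K ρ i j).comp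
      (measurable_pi_iff.2 fun i => measurable_pi_iff.2 fun j => ha.measurable i j))).const_mul
        _).const_add _
  have hind : iIndepFun X P := by
    refine ha.iIndepFun_column (fun j x => 1 + 2 * (n : ℝ) ^ 2 * energy μ
      (WithLp.toLp 2 fun i => (x i - light P (a i j) (level K ρ n) (x i)) / √(d : ℝ))) fun j => ?_
    refine ((measurable_energy.comp ((WithLp.measurable_toLp 2 _).comp
      (measurable_pi_iff.2 fun i => Measurable.div_const ?_ _))).const_mul _).const_add _
    exact (measurable_pi_apply i).sub ((measurable_light _ _).comp (measurable_pi_apply i))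
  -- The truncation level makes the mean energy so small that each factor has mean at most `1 +
  -- 1/n`; by independence of the columns the product has mean at most `e`.
  have hX1 : ∀ j, ∫ ω, X j ω ∂P ≤ Real.exp (1 / n) := by
    intro j
    rw [hX]
    simp only
    rw [integral_add (integrable_const _) ((hE j).1.const_mul _), integral_const_mul]
    simp only [integral_const, probReal_univ, one_smul]
    have h1 := mul_le_mul_of_nonneg_left (hE j).2 (by positivity : (0 : ℝ) ≤ 2 * (n : ℝ) ^ 2)
    have h2 : 2 * (n : ℝ) ^ 2 * (lam ^ 2 * (K ^ 2 * Real.log n * ρ ^ (2 - Real.log n))) ≤ 1 / n := by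
      rw [le_div_iff₀ hn0]
      refine le_trans (le_of_eq ?_) hlev
      ring
    linarith [Real.add_one_le_exp (1 / (n : ℝ))]
  have h0 : ∀ j ω, 0 ≤ X j ω := fun j ω => by
    have := energy_nonneg (μ := μ) (column (heavyPart P a K ρ fun i j => a i j ω) j)
    rw [hX]; positivity
  have hm := mul_meas_ge_le_integral_of_nonneg
    (Filter.Eventually.of_forall fun ω => Finset.prod_nonneg fun j _ => h0 j ω)
    (integrable_prod_of_iIndepFun hXm hind hXi) (Real.exp r)
  rw [hind.integral_fun_prod_eq_prod_integral fun j => (hXm j).aestronglyMeasurable] at hm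
  rw [Real.exp_sub, le_div_iff₀ (Real.exp_pos r), mul_comm]
  refine hm.trans ?_
  calc ∏ j, ∫ ω, X j ω ∂P ≤ ∏ _j : Fin n, Real.exp (1 / n) :=
        Finset.prod_le_prod (fun j _ => integral_nonneg (h0 j)) fun j _ => hX1 j
    _ = Real.exp 1 := by
        rw [Finset.prod_const, Finset.card_univ, Fintype.card_fin, ← Real.exp_nat_mul]
        congr 1
        field_simp

theorem exists_lightPart_bound (P : Measure Ω) (a : Fin d → Fin n → Ω → ℝ) {K ρ : ℝ}
    (hK : 0 ≤ K) (hρ : 0 ≤ ρ) (i : Fin d) (j : Fin n) :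
    ∃ B, ∀ x, |lightPart P a K ρ x i j| ≤ B := by
  have hM : 0 ≤ level K ρ n := by unfold level; positivity
  exact ⟨level K ρ n + |∫ ω, trunc (level K ρ n) (a i j ω) ∂P|, fun x =>
    (abs_sub _ _).trans (add_le_add (abs_trunc_le hM _) le_rfl)⟩

/-- The mean of the soft thresholding over an independent direction is rarely large. -/
theorem IsLogSubgaussianFamily.measureReal_integral_dirSoft_le
    (ha : IsLogSubgaussianFamily P a K σ) (hK : 0 < K) (hn : 8 ≤ n) {ρ : ℝ} (hρ : 1 ≤ ρ)
    {c t : ℝ} {s : ℕ} (hc : 0 ≤ c) (hcu : 16 * c * (32 * K ^ 2 * ρ ^ 2) ≤ 1) (ht : 0 ≤ t)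
    (hst : Real.exp (-(c * t ^ 2)) = s / n) {Z : Type*} [MeasurableSpace Z] (ν : Measure Z)
    [IsProbabilityMeasure ν] {Y : Z → EuclideanSpace ℝ (Fin d)} (hY : Measurable Y) (r : ℝ) :
    P.real {ω | r ≤ c * ∫ z, dirSoft t (lightPart P a K ρ fun i j => a i j ω) (Y z) ∂ν} ≤
      Real.exp (2 * s - r) := by
  have hn0 : (n : ℝ) ≠ 0 := by
    have : (8 : ℝ) ≤ n := by exact_mod_cast hn
    linarith
  choose B hB using fun i j => exists_lightPart_bound P a hK.le (by linarith : 0 ≤ ρ) i j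
  set S := ∑ j, (∑ i, B i j) ^ 2 with hS
  set f : Ω → Z → ℝ := fun ω z => dirSoft t (lightPart P a K ρ fun i j => a i j ω) (Y z) with hf
  have hfS : ∀ ω z, f ω z ≤ S := fun ω z => (dirSoft_le ht _ _).trans
    (Finset.sum_le_sum fun j _ => pow_le_pow_left₀ (Finset.sum_nonneg fun _ _ => abs_nonneg _)
      (Finset.sum_le_sum fun i _ => hB i j _) 2)
  have hf0 : ∀ ω z, 0 ≤ f ω z := fun ω z => dirSoft_nonneg _ _ _
  have ham : Measurable fun ω (i : Fin d) (j : Fin n) => a i j ω :=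
    measurable_pi_iff.2 fun i => measurable_pi_iff.2 fun j => ha.measurable i j
  have hfm : Measurable (Function.uncurry f) :=
    measurable_dirSoft (L := fun p : Ω × Z => lightPart P a K ρ fun i j => a i j p.1) t
      (fun i j => (measurable_lightPart K ρ i j).comp (ham.comp measurable_fst))
      (hY.comp measurable_snd)
  refine measureReal_le_integral_le (f := f) hfm hf0 hfS hc (fun z => ?_) r
  have h := ha.integral_exp_softSq hK hn hρ (fun i => ‖Y z‖⁻¹ * Y z i)
    (sum_sq_direction_le (Y z)) hc hcu ht
  rw [hst, mul_assoc, mul_div_cancel₀ _ hn0] at h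
  exact h

end Dictionary

/-! ### Laws of the measurement vectors and conditioning -/

section Law

variable {Ω : Type*} [MeasurableSpace Ω] {P : Measure Ω} [IsProbabilityMeasure P]
  {m d n : ℕ} {φ : Fin m → Ω → EuclideanSpace ℝ (Fin d)} {A c₀ lam : ℝ}

theorem integral_sq_le_of_eLpNorm_le {X : Ω → ℝ} (hX : Measurable X) (hlam : 0 ≤ lam)
    (h : eLpNorm X 2 P ≤ ENNReal.ofReal lam) : MemLp X 2 P ∧ ∫ ω, X ω ^ 2 ∂P ≤ lam ^ 2 := by
  have hm : MemLp X 2 P := ⟨hX.aestronglyMeasurable, h.trans_lt ENNReal.ofReal_lt_top⟩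
  refine ⟨hm, ?_⟩
  rw [hm.eLpNorm_eq_integral_rpow_norm (by norm_num) (by norm_num),
    ENNReal.ofReal_le_ofReal_iff hlam] at h
  simp only [ENNReal.toReal_ofNat, Real.rpow_two, Real.norm_eq_abs, sq_abs] at h
  have h0 : 0 ≤ ∫ ω, X ω ^ 2 ∂P := integral_nonneg fun _ => sq_nonneg _
  have h1 := pow_le_pow_left₀ (Real.rpow_nonneg h0 _) h 2
  rwa [← Real.rpow_natCast, ← Real.rpow_mul h0, Nat.cast_ofNat, inv_mul_cancel₀ (by norm_num),
    Real.rpow_one] at h1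

theorem IsSmallBallFamily.hasBoundedCoordinates (h : IsSmallBallFamily P φ A c₀ lam)
    (hlam : 0 ≤ lam) (i : Fin m) : HasBoundedCoordinates (P.map (φ i)) lam := by
  have hφ := (h.measurable i).aemeasurable (μ := P)
  have hk := fun k => integral_sq_le_of_eLpNorm_le (X := fun ω => φ i ω k)
    (by have := h.measurable i; fun_prop) hlam (h.variance_le i k)
  have hs : ∀ k, AEStronglyMeasurable (fun y : EuclideanSpace ℝ (Fin d) => y k) (P.map (φ i)) :=
    fun k => Measurable.aestronglyMeasurable (by fun_prop)
  refine ⟨fun k => (memLp_map_measure_iff (hs k) hφ).2 (hk k).1, fun k => ?_, fun k => ?_⟩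
  · rw [integral_map hφ (hs k)]
    exact h.centered i k
  · rw [integral_map hφ (Measurable.aestronglyMeasurable (by fun_prop))]
    exact (hk k).2

theorem IsSmallBallFamily.mono (h : IsSmallBallFamily P φ A c₀ lam) {lam' : ℝ}
    (hl : lam ≤ lam') : IsSmallBallFamily P φ A c₀ lam' :=
  { h with variance_le := fun i k => (h.variance_le i k).trans (ENNReal.ofReal_le_ofReal hl) }

theorem IsSmallBallFamily.map_eq_pi (h : IsSmallBallFamily P φ A c₀ lam) (i₀ : Fin m) :
    P.map (fun ω i => φ i ω) = Measure.pi fun _ : Fin m => P.map (φ i₀) := by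
  rw [h.indep.map_fun_eq_pi_map fun i => (h.measurable i).aemeasurable]
  congr 1
  ext i : 1
  exact (h.identDistrib i i₀).map_eq

/-- Homogeneity extends the small ball condition from unit vectors to those bounded below in norm,
such as `Dv` under the null space property of `D`. -/
theorem IsSmallBallFamily.le_measureReal (h : IsSmallBallFamily P φ A c₀ lam) (i : Fin m)
    {r : ℝ} (hA : 0 < A) (hr : 0 < r) {z : EuclideanSpace ℝ (Fin d)} (hz : r ≤ ‖z‖) :
    c₀ ≤ (P.map (φ i)).real {y | A * r ≤ |inner ℝ y z|} := by
  have hz0 : 0 < ‖z‖ := hr.trans_le hz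
  rw [map_measureReal_apply (h.measurable i) (measurableSet_le measurable_const (by fun_prop))]
  refine (h.smallBall i (‖z‖⁻¹ • z) ?_).trans (measureReal_mono (fun ω hω => ?_) (measure_ne_top _ _))
  · rw [norm_smul, norm_inv, norm_norm, inv_mul_cancel₀ hz0.ne']
  · have hω' : A ≤ |inner ℝ (φ i ω) (‖z‖⁻¹ • z)| := hω
    rw [inner_smul_right, abs_mul, abs_of_pos (inv_pos.2 hz0), ← div_eq_inv_mul,
      le_div_iff₀ hz0] at hω'
    exact (mul_le_mul_of_nonneg_left hz hA.le).trans hω'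

/-- Conditioning on the second of two independent variables. -/
theorem IndepFun.measureReal_le_of_forall {𝓧 𝓨 : Type*} [MeasurableSpace 𝓧] [MeasurableSpace 𝓨]
    {f : Ω → 𝓧} {g : Ω → 𝓨} (hf : Measurable f) (hg : Measurable g) (h : IndepFun f g P)
    {B : Set (𝓧 × 𝓨)} (hB : MeasurableSet B) {p : ℝ}
    (hp : ∀ y, (P.map f).real {x | (x, y) ∈ B} ≤ p) :
    P.real {ω | (f ω, g ω) ∈ B} ≤ p := by
  have hpf : IsProbabilityMeasure (P.map f) := Measure.isProbabilityMeasure_map hf.aemeasurable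
  have hpg : IsProbabilityMeasure (P.map g) := Measure.isProbabilityMeasure_map hg.aemeasurable
  have hm := (indepFun_iff_map_prod_eq_prod_map_map hf.aemeasurable hg.aemeasurable).1 h
  have hne : Nonempty 𝓨 := nonempty_of_isProbabilityMeasure (P.map g)
  have hp0 : 0 ≤ p := measureReal_nonneg.trans (hp hne.some)
  have h1 : P {ω | (f ω, g ω) ∈ B} = (P.map fun ω => (f ω, g ω)) B :=
    (Measure.map_apply (hf.prodMk hg) hB).symm
  rw [measureReal_def, h1, hm, Measure.prod_apply_symm hB]
  refine ENNReal.toReal_le_of_le_ofReal hp0 ?_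
  calc _ ≤ ∫⁻ _y, ENNReal.ofReal p ∂(P.map g) := lintegral_mono fun y => by
        rw [ENNReal.le_ofReal_iff_toReal_le (measure_ne_top _ _) hp0]
        exact hp y
    _ = _ := by simp

end Law

/-! ### Measurability of the null space property -/

section Measurability

/-- An intersection of closed conditions, one for each vector; closedness makes the uncountable
intersection measurable. -/
theorem isClosed_robustNSP {k n : ℕ} (s : ℕ) (γ τ : ℝ) :
    IsClosed {M : Fin k → Fin n → ℝ | RobustNSP (Matrix.of M) s γ τ} := by
  simp only [RobustNSP, Set.ofPred_forall]
  refine isClosed_iInter fun v => isClosed_iInter fun _ => isClosed_le continuous_const ?_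
  refine Continuous.norm ?_
  have : (fun M : Fin k → Fin n → ℝ => mulCLM (Matrix.of M) v) = fun M =>
      WithLp.toLp 2 fun i => ∑ j, M i j * v j := by
    ext M i
    simp [mulCLM, Matrix.toLpLin_apply, Matrix.mulVec, dotProduct]
  rw [this]
  exact (PiLp.continuous_toLp 2 _).comp (by fun_prop)

theorem measurableSet_robustNSP {X : Type*} [MeasurableSpace X] {k n : ℕ}
    {M : X → Matrix (Fin k) (Fin n) ℝ} (hM : ∀ i j, Measurable fun x => M x i j) (s : ℕ)
    (γ τ : ℝ) : MeasurableSet {x | RobustNSP (M x) s γ τ} :=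
  (isClosed_robustNSP s γ τ).measurableSet.preimage
    (f := fun x i j => M x i j) (measurable_pi_iff.2 fun i => measurable_pi_iff.2 fun j => hM i j)

end Measurability

/-! ### The null space property of the compressed dictionary -/

section Measurements

variable {Ω : Type*} [MeasurableSpace Ω] {P : Measure Ω} [IsProbabilityMeasure P]
  {m d n : ℕ} {φ : Fin m → Ω → EuclideanSpace ℝ (Fin d)} {a : Fin d → Fin n → Ω → ℝ}
  {A c₀ lam K σ : ℝ}

/-- For a fixed dictionary which satisfies the complexity bounds. -/
theorem IsSmallBallFamily.measureReal_not_robustNSP_le (h : IsSmallBallFamily P φ A c₀ lam)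
    (hA : 0 < A) (hc₀ : 0 < c₀) (hlam : 0 < lam) (i₀ : Fin m) (hd : 0 < d) (hn : 0 < n) {s : ℕ}
    (hs : 1 ≤ s) {γ τ t β : ℝ} (hγ : 0 < γ) (hτ : 0 < τ) (ht : 0 ≤ t) (hβ : 0 < β)
    (hβu : lam * β ≤ A / (2 * τ) * c₀ / 32)
    (hw : lam * (t * ((1 + 1 / γ) * √(s : ℝ))) + 1 ≤ A / (2 * τ) * c₀ / 32 * √(m : ℝ))
    {L H : Fin d → Fin n → ℝ} {D : Matrix (Fin d) (Fin n) ℝ}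
    (hD : D = Matrix.of fun i j => (L i j + H i j) / √(d : ℝ)) (hDn : RobustNSP D s γ τ)
    (hX : ∏ j, (1 + 2 * (n : ℝ) ^ 2 * energy (P.map (φ i₀)) (column H j)) ≤
      Real.exp (c₀ ^ 2 * m / 16))
    (hS : ∫ y, dirSoft t L (∑ i, y i) ∂(P.map fun ω i => φ i ω) ≤ β ^ 2 * m) :
    (P.map fun ω i => φ i ω).real {y | ¬ RobustNSP
      ((Matrix.of fun i k => y i k / √(m : ℝ)) * D) s γ (1 / (A / (2 * τ) * √(c₀ / 2)))} ≤
      Real.exp (-(c₀ ^ 2 * m / 16)) := by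
  have hm : 0 < m := i₀.pos
  have hpr : IsProbabilityMeasure (P.map (φ i₀)) :=
    Measure.isProbabilityMeasure_map (h.measurable i₀).aemeasurable
  rw [h.map_eq_pi i₀] at hS ⊢
  have hmain := (h.hasBoundedCoordinates hlam.le i₀).measureReal_exists_lt hm hd hn hs hγ L H hD ht
    (u := A / (2 * τ)) (by positivity) hc₀.le (fun v hv => by
      have := h.le_measureReal i₀ hA (by positivity) (hDn v hv)
      have e : A * (1 / τ) = 2 * (A / (2 * τ)) := by field_simp
      rwa [e] at this) hlam hβ hβu hS hw
  refine (measureReal_mono (fun y hy => ?_) (measure_ne_top _ _)).trans (hmain.trans ?_)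
  · by_contra hcon
    refine hy fun v hv => ?_
    rw [one_div_one_div, mulCLM_mul]
    refine le_norm_mulCLM_div hm y (mulCLM D v) hc₀.le ?_
    by_contra h2
    push Not at h2
    exact hcon ⟨v, hv, h2⟩
  -- The cell count uses up half of the exponent `c₀² m / 8`.
  · refine (mul_le_mul_of_nonneg_right hX (Real.exp_pos _).le).trans (le_of_eq ?_)
    rw [← Real.exp_add]
    congr 1; ring

/-- The failure probability of the robust null space property of the compressed dictionary. -/
theorem IsSmallBallFamily.measureReal_not_robustNSP_mul (h : IsSmallBallFamily P φ A c₀ lam)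
    (ha : IsLogSubgaussianFamily P a K σ)
    (hind : IndepFun (fun ω i => φ i ω) (fun ω i j => a i j ω) P)
    (hA : 0 < A) (hc₀ : 0 < c₀) (hlam : 0 < lam) (hK : 0 < K) (i₀ : Fin m) (hd : 0 < d)
    (hn : 8 ≤ n) {s : ℕ} (hs : 1 ≤ s) {γ τ t β c ρ : ℝ} (hρ : 1 ≤ ρ)
    (hlev : 2 * lam ^ 2 * (n : ℝ) ^ 3 * (K ^ 2 * Real.log n * ρ ^ (2 - Real.log n)) ≤ 1)
    (hc : 0 < c) (hcu : 16 * c * (32 * K ^ 2 * ρ ^ 2) ≤ 1)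
    (hst : Real.exp (-(c * t ^ 2)) = s / n)
    (hγ : 0 < γ) (hτ : 0 < τ) (ht : 0 ≤ t) (hβ : 0 < β)
    (hβu : lam * β ≤ A / (2 * τ) * c₀ / 32)
    (hw : lam * (t * ((1 + 1 / γ) * √(s : ℝ))) + 1 ≤ A / (2 * τ) * c₀ / 32 * √(m : ℝ)) :
    P.real {ω | RobustNSP (dictMatrix a ω) s γ τ ∧ ¬ RobustNSP (measMatrix φ ω * dictMatrix a ω)
      s γ (1 / (A / (2 * τ) * √(c₀ / 2)))} ≤
      Real.exp (1 - c₀ ^ 2 * m / 16) + Real.exp (2 * s - c * (β ^ 2 * m)) +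
        Real.exp (-(c₀ ^ 2 * m / 16)) := by
  have hpr : IsProbabilityMeasure (P.map (φ i₀)) :=
    Measure.isProbabilityMeasure_map (h.measurable i₀).aemeasurable
  have hφm : Measurable fun ω (i : Fin m) => φ i ω := measurable_pi_iff.2 h.measurable
  have ham : Measurable fun ω (i : Fin d) (j : Fin n) => a i j ω :=
    measurable_pi_iff.2 fun i => measurable_pi_iff.2 fun j => ha.measurable i j
  have hpφ : IsProbabilityMeasure (P.map fun ω i => φ i ω) :=
    Measure.isProbabilityMeasure_map hφm.aemeasurable
  let X : (Fin d → Fin n → ℝ) → ℝ := fun x =>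
    ∏ j, (1 + 2 * (n : ℝ) ^ 2 * energy (P.map (φ i₀)) (column (heavyPart P a K ρ x) j))
  let W : (Fin d → Fin n → ℝ) → ℝ := fun x =>
    ∫ y, dirSoft t (lightPart P a K ρ x) (∑ i, y i) ∂(P.map fun ω i => φ i ω)
  have hXm : Measurable X := Finset.measurable_prod _ fun j _ =>
    ((measurable_energy.comp (measurable_column fun i => measurable_heavyPart K ρ i j)).const_mul
      _).const_add _
  have hWm : Measurable W := by
    have : Measurable fun p : (Fin d → Fin n → ℝ) × (Fin m → EuclideanSpace ℝ (Fin d)) =>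
        dirSoft t (lightPart P a K ρ p.1) (∑ i, p.2 i) :=
      measurable_dirSoft (L := fun p : (Fin d → Fin n → ℝ) × (Fin m → EuclideanSpace ℝ (Fin d)) =>
        lightPart P a K ρ p.1) t
        (fun i j => (measurable_lightPart K ρ i j).comp measurable_fst)
        (measurable_sum_vec.comp measurable_snd)
    exact this.stronglyMeasurable.integral_prod_right'.measurable
  let Dx : (Fin d → Fin n → ℝ) → Matrix (Fin d) (Fin n) ℝ := fun x =>
    Matrix.of fun i j => x i j / √(d : ℝ)
  let Φx : (Fin m → EuclideanSpace ℝ (Fin d)) → Matrix (Fin m) (Fin d) ℝ := fun y =>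
    Matrix.of fun i k => y i k / √(m : ℝ)
  set τ₂ := 1 / (A / (2 * τ) * √(c₀ / 2)) with hτ₂
  -- Failure for the compressed dictionary although the dictionary is good: it has the null space
  -- property, few cells and a small mean soft threshold. Conditionally on any dictionary this is
  -- rare; the three error terms are the two exceptional dictionary events and this one.
  let B : Set ((Fin m → EuclideanSpace ℝ (Fin d)) × (Fin d → Fin n → ℝ)) :=
    {p | ¬ RobustNSP (Φx p.1 * Dx p.2) s γ τ₂} ∩
      {p | RobustNSP (Dx p.2) s γ τ ∧ X p.2 ≤ Real.exp (c₀ ^ 2 * m / 16) ∧ W p.2 ≤ β ^ 2 * m}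
  have hBm : MeasurableSet B := by
    refine MeasurableSet.inter (MeasurableSet.compl (measurableSet_robustNSP (fun i j => ?_) s γ τ₂))
      (MeasurableSet.inter (measurableSet_robustNSP (fun i j => ?_) s γ τ) (MeasurableSet.inter
        (measurableSet_le (hXm.comp measurable_snd) measurable_const)
        (measurableSet_le (hWm.comp measurable_snd) measurable_const)))
    · simp only [Φx, Dx, Matrix.mul_apply, Matrix.of_apply]
      fun_prop
    · simp only [Dx, Matrix.of_apply]
      fun_prop
  have hBp : P.real {ω | ((fun i => φ i ω), fun i j => a i j ω) ∈ B} ≤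
      Real.exp (-(c₀ ^ 2 * m / 16)) := by
    refine IndepFun.measureReal_le_of_forall hφm ham hind hBm fun x => ?_
    by_cases hx : RobustNSP (Dx x) s γ τ ∧ X x ≤ Real.exp (c₀ ^ 2 * m / 16) ∧ W x ≤ β ^ 2 * m
    · refine (measureReal_mono (fun y hy => hy.1) (measure_ne_top _ _)).trans
        (h.measureReal_not_robustNSP_le hA hc₀ hlam i₀ hd (by omega) hs hγ hτ ht hβ hβu hw
          (L := lightPart P a K ρ x) (H := heavyPart P a K ρ x) ?_ hx.1 hx.2.1 hx.2.2)
      ext i j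
      simp [Dx, heavyPart]
    · have : {y | (y, x) ∈ B} = ∅ := Set.eq_empty_of_forall_notMem fun y hy => hx hy.2
      rw [this, measureReal_empty]
      exact (Real.exp_pos _).le
  have h1 := ha.measureReal_prod_energy_le (h.hasBoundedCoordinates hlam.le i₀) hK hn hd hρ hlev
    (c₀ ^ 2 * m / 16)
  have h2 := ha.measureReal_integral_dirSoft_le hK hn hρ hc.le hcu ht hst
    (P.map fun ω i => φ i ω) measurable_sum_vec (c * (β ^ 2 * m))
  refine le_trans ?_ (add_le_add (add_le_add h1 h2) hBp)
  refine (measureReal_mono (fun ω hω => ?_) (measure_ne_top _ _)).trans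
    ((measureReal_union_le _ _).trans (add_le_add (measureReal_union_le _ _) le_rfl))
  by_contra hcon
  simp only [Set.mem_union, not_or] at hcon
  obtain ⟨⟨hc1, hc2⟩, hc3⟩ := hcon
  refine hc3 ⟨hω.2, hω.1, ?_, ?_⟩
  · exact (not_le.1 hc1).le
  · exact le_of_mul_le_mul_left (not_le.1 hc2).le hc

end Measurements

/-! ### Integrability of the norm and measurability of the good event -/

section Norm

variable {Ω : Type*} [MeasurableSpace Ω] {P : Measure Ω} [IsProbabilityMeasure P]
  {m d n : ℕ} {φ : Fin m → Ω → EuclideanSpace ℝ (Fin d)} {a : Fin d → Fin n → Ω → ℝ}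
  {A c₀ lam K σ : ℝ}

theorem norm_mulCLM_le {k n : ℕ} (M : Matrix (Fin k) (Fin n) ℝ) :
    ‖mulCLM M‖ ≤ ∑ i, ∑ j, |M i j| := by
  refine ContinuousLinearMap.opNorm_le_bound _ (Finset.sum_nonneg fun i _ =>
    Finset.sum_nonneg fun j _ => abs_nonneg _) fun v => ?_
  refine (norm_le_l1Norm _).trans ?_
  unfold l1Norm
  rw [Finset.sum_mul]
  refine Finset.sum_le_sum fun i _ => ?_
  have : (mulCLM M v) i = ∑ j, M i j * v j := by
    simp [mulCLM, Matrix.toLpLin_apply, Matrix.mulVec, dotProduct]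
  rw [this, Finset.sum_mul]
  refine (Finset.abs_sum_le_sum_abs _ _).trans (Finset.sum_le_sum fun j _ => ?_)
  rw [abs_mul]
  exact mul_le_mul_of_nonneg_left (PiLp.norm_apply_le v j) (abs_nonneg _)

theorem continuous_norm_mulCLM {k n : ℕ} :
    Continuous fun M : Fin k → Fin n → ℝ => ‖mulCLM (Matrix.of M)‖ := by
  refine Continuous.norm ?_
  let f : (Fin k → Fin n → ℝ) →ₗ[ℝ] EuclideanSpace ℝ (Fin n) →L[ℝ] EuclideanSpace ℝ (Fin k) :=
    { toFun := fun M => mulCLM (Matrix.of M)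
      map_add' := fun M N => by
        simp only [mulCLM, ← Matrix.of_add_of, map_add]
      map_smul' := fun r M => by
        simp only [mulCLM, ← Matrix.smul_of, map_smul, RingHom.id_apply] }
  exact f.continuous_of_finiteDimensional

theorem IsLogSubgaussianFamily.integrable_norm (ha : IsLogSubgaussianFamily P a K σ)
    (hn : 8 ≤ n) : Integrable (fun ω => ‖mulCLM (dictMatrix a ω)‖) P := by
  have hm : Measurable fun ω => ‖mulCLM (dictMatrix a ω)‖ :=
    continuous_norm_mulCLM.measurable.comp (measurable_pi_iff.2 fun i => measurable_pi_iff.2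
      fun j => (ha.measurable i j).div_const _)
  have hi : Integrable (fun ω => ∑ i, ∑ j, |a i j ω / √(d : ℝ)|) P :=
    integrable_finsetSum _ fun i _ => integrable_finsetSum _ fun j _ =>
      (((ha.memLp_two hn i j).integrable one_le_two).div_const _).abs
  refine hi.mono' hm.aestronglyMeasurable (Filter.Eventually.of_forall fun ω => ?_)
  rw [norm_norm]
  exact norm_mulCLM_le _

theorem IsSmallBallFamily.measurableSet_good (h : IsSmallBallFamily P φ A c₀ lam)
    (ha : IsLogSubgaussianFamily P a K σ) (s : ℕ) (γ τ τ' : ℝ) :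
    MeasurableSet {ω | RobustNSP (dictMatrix a ω) s γ τ ∧
      RobustNSP (measMatrix φ ω * dictMatrix a ω) s γ τ'} := by
  refine MeasurableSet.inter (measurableSet_robustNSP (fun i j => ?_) s γ τ)
    (measurableSet_robustNSP (fun i j => ?_) s γ τ')
  · exact (ha.measurable i j).div_const _
  · simp only [measMatrix, dictMatrix, Matrix.mul_apply, Matrix.of_apply]
    refine Finset.measurable_sum _ fun k _ => Measurable.mul ?_ ((ha.measurable k j).div_const _)
    have := h.measurable i
    fun_prop

end Norm

theorem RobustNSP.mono_const {k n : ℕ} {M : Matrix (Fin k) (Fin n) ℝ} {s : ℕ} {γ τ τ' : ℝ}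
    (h : RobustNSP M s γ τ) (hτ : 0 < τ) (hτ' : τ ≤ τ') : RobustNSP M s γ τ' := fun v hv =>
  (one_div_le_one_div_of_le hτ hτ').trans (h v hv)

/-! ### Choice of constants and conclusion -/

section Assembly

/-- The prefactor `e + 2 ≤ e²` is absorbed in half of the exponent, which is why `r ≥ 4` is
required. -/
theorem exp_add_exp_add_exp_le {x y z r : ℝ} (hr : 4 ≤ r) (hx : x ≤ 1 - r) (hy : y ≤ -r)
    (hz : z ≤ -r) : Real.exp x + Real.exp y + Real.exp z ≤ Real.exp (-(r / 2)) := by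
  have e1 : Real.exp x ≤ Real.exp 1 * Real.exp (-r) := by
    rw [← Real.exp_add]; exact Real.exp_le_exp.2 (by linarith)
  have e2 := Real.exp_le_exp.2 hy
  have e3 := Real.exp_le_exp.2 hz
  have e4 : Real.exp 1 + 2 ≤ Real.exp 2 := by
    have h2 : Real.exp 2 = Real.exp 1 * Real.exp 1 := by rw [← Real.exp_add]; norm_num
    have h3 := Real.exp_one_gt_d9
    rw [h2]
    nlinarith
  have e5 : Real.exp 2 * Real.exp (-r) ≤ Real.exp (-(r / 2)) := by
    rw [← Real.exp_add]
    exact Real.exp_le_exp.2 (by linarith)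
  have e6 := mul_le_mul_of_nonneg_right e4 (Real.exp_pos (-r)).le
  linarith

set_option maxHeartbeats 800000 in
/-- The robust null space property of the dictionary and of the compressed dictionary. -/
theorem exists_robustNSP_constants (A c₀ lam K σ : ℝ) (hA : 0 < A) (hc₀ : 0 < c₀) (hK : 0 < K)
    (hσ : 0 < σ) :
    ∃ τ : ℝ, 0 < τ ∧ ∀ γ θ : ℝ, 0 < γ → 0 < θ → θ < 1 → ∃ C c : ℝ, 0 < C ∧ 0 < c ∧
    ∀ (n s d m : ℕ), 8 ≤ n → 1 ≤ s → (s : ℝ) ≤ θ * n →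
      C * (s * Real.log (n / s)) ≤ d → C * (s * Real.log (n / s)) ≤ m →
    ∀ (Ω : Type*) [MeasurableSpace Ω] (P : Measure Ω) [IsProbabilityMeasure P]
      (φ : Fin m → Ω → EuclideanSpace ℝ (Fin d)) (a : Fin d → Fin n → Ω → ℝ),
      IsSmallBallFamily P φ A c₀ lam → IsLogSubgaussianFamily P a K σ →
      IndepFun (fun ω i => φ i ω) (fun ω i j => a i j ω) P →
      ∃ E : Set Ω, MeasurableSet E ∧
        1 - Real.exp (-(c * d)) - Real.exp (-(c * m)) ≤ P.real E ∧
        ∀ ω ∈ E, RobustNSP (dictMatrix a ω) s γ τ ∧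
          RobustNSP (measMatrix φ ω * dictMatrix a ω) s γ τ := by
  obtain ⟨uD, cD, huD, hcD, hsb⟩ := exists_smallBall_constants K σ hK hσ
  set τ₁ := 1 / (uD * √(cD / 2)) with hτ₁
  have hτ₁0 : 0 < τ₁ := by positivity
  set u := A / (2 * τ₁) with hu
  have hu0 : 0 < u := by positivity
  set τ₂ := 1 / (u * √(c₀ / 2)) with hτ₂
  have hτ₂0 : 0 < τ₂ := by positivity
  refine ⟨max τ₁ τ₂, lt_max_of_lt_left hτ₁0, fun γ θ hγ hθ hθ1 => ?_⟩
  -- With `l ≥ 1` a single truncation level serves the dictionary alone and the compressed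
  -- dictionary.
  set l := max lam 1 with hl
  have hl1 : 1 ≤ l := le_max_right _ _
  have hl0 : 0 < l := by linarith
  obtain ⟨ρ, hρ, hlev⟩ := exists_truncation_level K l hK
  have hρ0 : 0 < ρ := by linarith
  set ce := 1 / (16 * (32 * K ^ 2 * ρ ^ 2)) with hce
  have hce0 : 0 < ce := by positivity
  have hcu : 16 * ce * (32 * K ^ 2 * ρ ^ 2) ≤ 1 := le_of_eq (by rw [hce]; field_simp)
  set β := u * c₀ / (32 * l) with hβ
  have hβ0 : 0 < β := by positivity
  have hβl : l * β = u * c₀ / 32 := by rw [hβ]; field_simp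
  obtain ⟨C₁, hC₁, hwid⟩ := exists_width_constant ce (1 + 1 / γ) θ hce0 (by positivity) hθ hθ1
  set q := Real.log (1 / θ) with hq
  have hq0 : 0 < q := Real.log_pos (by rw [lt_div_iff₀ hθ]; linarith)
  set c₁ := min (c₀ ^ 2 / 16) (ce * β ^ 2 / 2) with hc₁
  have hc₁0 : 0 < c₁ := lt_min (by positivity) (by positivity)
  -- `CD` and `CM` make the width small against `√d` and `√m`; `CS` absorbs the term `2s` in the
  -- exponent, and `CP` ensures `c₁ m ≥ 4`. None of them affects `τ`, which was fixed before `γ` and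
  -- `θ`.
  set CD := (16 * C₁ / (uD * cD)) ^ 2 with hCD
  set CM := (32 * l * C₁ / (u * c₀)) ^ 2 with hCM
  set CS := 4 / (q * (ce * β ^ 2)) with hCS
  set CP := 4 / (q * c₁) with hCP
  have hCD0 : 0 < CD := by positivity
  have hCM0 : 0 < CM := by positivity
  have hCS0 : 0 < CS := by positivity
  have hCP0 : 0 < CP := by positivity
  refine ⟨CD + CM + CS + CP, min (cD ^ 2 / 8) (c₁ / 2), by positivity,
    lt_min (by positivity) (by positivity), ?_⟩
  intro n s d m hn hs hsn hdC hmC Ω _ P _ φ a hφ ha hind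
  obtain ⟨hΛ0, hst, hwidth⟩ := hwid n s hs hsn
  set Λ := Real.log (n / s) with hΛ
  set t := √(Λ / ce) with ht
  have ht0 : 0 ≤ t := Real.sqrt_nonneg _
  have hn0 : (0 : ℝ) < n := by exact_mod_cast (by omega : 0 < n)
  have hs1 : (1 : ℝ) ≤ s := by exact_mod_cast hs
  have hs0 : (0 : ℝ) < s := by linarith
  have hqΛ : q ≤ Λ := by
    refine Real.log_le_log (by positivity) ?_
    rw [div_le_div_iff₀ hθ hs0]; linarith only [hsn]
  have hsΛ : 0 < s * Λ := by positivity
  have hsq : s * q ≤ s * Λ := mul_le_mul_of_nonneg_left hqΛ hs0.le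
  have hq1 : q ≤ s * q := le_mul_of_one_le_left hq0.le hs1
  have hdr : ∀ C', C' ≤ CD + CM + CS + CP → C' * (s * Λ) ≤ d ∧ C' * (s * Λ) ≤ m :=
    fun C' h => ⟨(mul_le_mul_of_nonneg_right h hsΛ.le).trans hdC,
      (mul_le_mul_of_nonneg_right h hsΛ.le).trans hmC⟩
  have hd0 : 0 < d := by
    have := (hdr CD (by linarith only [hCM0, hCS0, hCP0])).1
    exact_mod_cast (mul_pos hCD0 hsΛ).trans_le this
  have hm0 : 0 < m := by
    have := (hdr CD (by linarith only [hCM0, hCS0, hCP0])).2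
    exact_mod_cast (mul_pos hCD0 hsΛ).trans_le this
  have hsqrt : ∀ {B : ℝ} {k : ℕ}, 0 ≤ B → B ^ 2 * (s * Λ) ≤ k → B * √(s * Λ) ≤ √(k : ℝ) := by
    intro B k hB h
    have := Real.sqrt_le_sqrt h
    rwa [Real.sqrt_mul (sq_nonneg B), Real.sqrt_sq hB] at this
  have hwD : √(2 * s / ce) + t * ((1 + 1 / γ) * √(s : ℝ)) + 1 ≤ uD * cD / 16 * √(d : ℝ) := by
    have h1 := hsqrt (by positivity) (hdr CD (by linarith only [hCM0, hCS0, hCP0])).1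
    have h2 := mul_le_mul_of_nonneg_left h1 (by positivity : 0 ≤ uD * cD / 16)
    have h3 : uD * cD / 16 * (16 * C₁ / (uD * cD) * √(s * Λ)) = C₁ * √(s * Λ) := by field_simp
    linarith only [h2, h3, hwidth]
  have hwM : l * (t * ((1 + 1 / γ) * √(s : ℝ))) + 1 ≤ u * c₀ / 32 * √(m : ℝ) := by
    have h1 := hsqrt (by positivity) (hdr CM (by linarith only [hCD0, hCS0, hCP0])).2
    have h2 := mul_le_mul_of_nonneg_left h1 (by positivity : 0 ≤ u * c₀ / 32)
    have h3 : u * c₀ / 32 * (32 * l * C₁ / (u * c₀) * √(s * Λ)) = l * (C₁ * √(s * Λ)) := by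
      field_simp
    have h4 := mul_le_mul_of_nonneg_left hwidth hl0.le
    have h5 : 0 ≤ l * √(2 * s / ce) := mul_nonneg hl0.le (Real.sqrt_nonneg _)
    rw [mul_add, mul_add, mul_one] at h4
    linarith only [h2, h3, h4, h5, hl1]
  set i₀ : Fin m := ⟨0, hm0⟩
  have hlev1 : n * (K ^ 2 * Real.log n * ρ ^ (2 - Real.log n)) ≤ 1 := by
    refine le_trans ?_ (hlev n hn)
    have hη : 0 ≤ K ^ 2 * Real.log n * ρ ^ (2 - Real.log n) := by
      have := two_le_log hn
      positivity
    refine mul_le_mul_of_nonneg_right ?_ hη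
    have h8 : (8 : ℝ) ≤ n := by exact_mod_cast hn
    have h1 : (n : ℝ) ≤ n ^ 3 := le_self_pow₀ (by linarith only [h8]) (by norm_num)
    have h2 : 1 ≤ 2 * l ^ 2 := by linarith only [one_le_pow₀ hl1 (n := 2)]
    calc (n : ℝ) ≤ n ^ 3 := h1
      _ ≤ 2 * l ^ 2 * n ^ 3 := le_mul_of_one_le_left (by positivity) h2
  have hDfail := ha.measureReal_not_robustNSP hK hn hd0 hρ hlev1 hs hce0 hcu ht0 hst hγ huD hcD
    (fun i v hv => hsb P (fun j => a i j) (fun j => ha.measurable i j)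
      (ha.indep.precomp (g := fun j => (i, j)) fun _ _ hj => (Prod.mk.inj hj).2)
      (fun j => ha.centered i j) (fun j => ha.variance_ge i j)
      (fun j p hp hp8 => ha.moment_le i j p hp (hp8.trans (Real.log_le_log (by norm_num)
        (by exact_mod_cast hn)))) v hv) hwD
  have hMfail := (hφ.mono (le_max_left lam 1)).measureReal_not_robustNSP_mul ha hind hA hc₀ hl0 hK
    i₀ hd0 hn hs hρ (hlev n hn) hce0 hcu hst hγ hτ₁0 ht0 hβ0
    hβl.le hwM
  refine ⟨_, hφ.measurableSet_good ha s γ τ₁ τ₂, ?_, fun ω hω =>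
    ⟨hω.1.mono_const hτ₁0 (le_max_left _ _), hω.2.mono_const hτ₂0 (le_max_right _ _)⟩⟩
  have hcompl := probReal_compl_eq_one_sub (μ := P) (hφ.measurableSet_good ha s γ τ₁ τ₂)
  have hsub : P.real {ω | RobustNSP (dictMatrix a ω) s γ τ₁ ∧
      RobustNSP (measMatrix φ ω * dictMatrix a ω) s γ τ₂}ᶜ ≤
      P.real {ω | ¬ RobustNSP (dictMatrix a ω) s γ τ₁} +
      P.real {ω | RobustNSP (dictMatrix a ω) s γ τ₁ ∧
        ¬ RobustNSP (measMatrix φ ω * dictMatrix a ω) s γ τ₂} := by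
    refine (measureReal_mono (fun ω hω => ?_) (measure_ne_top _ _)).trans
      (measureReal_union_le _ _)
    by_cases h1 : RobustNSP (dictMatrix a ω) s γ τ₁
    · exact Or.inr ⟨h1, fun h2 => hω ⟨h1, h2⟩⟩
    · exact Or.inl h1
  have hmP : 4 ≤ c₁ * m := by
    have h1 := (hdr CP (by linarith only [hCD0, hCM0, hCS0])).2
    have h2 : CP * q ≤ m := (mul_le_mul_of_nonneg_left (hq1.trans hsq) hCP0.le).trans h1
    have h3 : c₁ * (CP * q) = 4 := by rw [hCP]; field_simp
    rw [← h3]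
    exact mul_le_mul_of_nonneg_left h2 hc₁0.le
  have hmS : 2 * s ≤ ce * β ^ 2 / 2 * m := by
    have h1 := (hdr CS (by linarith only [hCD0, hCM0, hCP0])).2
    have h2 : CS * (s * q) ≤ m := (mul_le_mul_of_nonneg_left hsq hCS0.le).trans h1
    have h3 : ce * β ^ 2 / 2 * (CS * (s * q)) = 2 * s := by rw [hCS]; field_simp; norm_num
    rw [← h3]
    exact mul_le_mul_of_nonneg_left h2 (by positivity)
  have hm' : (0 : ℝ) ≤ m := Nat.cast_nonneg m
  have hcδ : c₁ * m ≤ c₀ ^ 2 / 16 * m := mul_le_mul_of_nonneg_right (min_le_left _ _) hm'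
  have hcβ : c₁ * m ≤ ce * β ^ 2 / 2 * m := mul_le_mul_of_nonneg_right (min_le_right _ _) hm'
  have hexp : Real.exp (1 - c₀ ^ 2 * m / 16) + Real.exp (2 * s - ce * (β ^ 2 * m)) +
      Real.exp (-(c₀ ^ 2 * m / 16)) ≤ Real.exp (-(min (cD ^ 2 / 8) (c₁ / 2) * m)) := by
    refine (exp_add_exp_add_exp_le hmP ?_ ?_ ?_).trans (Real.exp_le_exp.2 ?_)
    · linarith only [hcδ]
    · linarith only [hcβ, hmS]
    · linarith only [hcδ]
    · linarith only [mul_le_mul_of_nonneg_right (min_le_right (cD ^ 2 / 8) (c₁ / 2)) hm']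
  have hexpD : Real.exp (-(cD ^ 2 * d / 8)) ≤ Real.exp (-(min (cD ^ 2 / 8) (c₁ / 2) * d)) := by
    refine Real.exp_le_exp.2 (neg_le_neg ?_)
    have := mul_le_mul_of_nonneg_right (min_le_left (cD ^ 2 / 8) (c₁ / 2)) (Nat.cast_nonneg (α := ℝ) d)
    linarith only [this]
  linarith only [hcompl, hsub, hDfail, hMfail, hexp, hexpD]

end Assembly

end DictSparse

theorem mainTheorem5 :
    -- the constant of the error bounds is absolute
    ∃ Crec : ℝ, 0 < Crec ∧
    -- the distribution parameters of the measurements and of the dictionary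
    ∀ A c₀ lam K σ : ℝ, 0 < A → 0 < c₀ → 0 < lam → 0 < K → 0 < σ →
    ∃ τ : ℝ, 0 < τ ∧
    ∀ γ θ : ℝ, 0 < γ → γ < 1 → 0 < θ → θ < 1 →
    ∃ C c : ℝ, 0 < C ∧ 0 < c ∧
    ∀ (n s d m : ℕ), 8 ≤ n → 1 ≤ s → (s : ℝ) ≤ θ * n →
      C * (s * Real.log (n / s)) ≤ d →
      C * (s * Real.log (n / s)) ≤ m →
    ∀ (Ω : Type*) [MeasurableSpace Ω] (P : Measure Ω) [IsProbabilityMeasure P]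
      (φ : Fin m → Ω → EuclideanSpace ℝ (Fin d)) (a : Fin d → Fin n → Ω → ℝ),
      DictSparse.IsSmallBallFamily P φ A c₀ lam →
      DictSparse.IsLogSubgaussianFamily P a K σ →
      IndepFun (fun ω i => φ i ω) (fun ω i j => a i j ω) P →
      Integrable (fun ω => ‖DictSparse.mulCLM (DictSparse.dictMatrix a ω)‖) P ∧
      ∃ E : Set Ω, MeasurableSet E ∧
        1 - Real.exp (-(c * d)) - Real.exp (-(c * m)) ≤ P.real E ∧
        (∀ ω ∈ E,
          DictSparse.RobustNSP (DictSparse.dictMatrix a ω) s γ τ ∧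
          DictSparse.RobustNSP (DictSparse.measMatrix φ ω * DictSparse.dictMatrix a ω) s γ τ ∧
          -- uniform, stable and robust recovery
          ∀ (x₀ : EuclideanSpace ℝ (Fin n)) (z₀ : EuclideanSpace ℝ (Fin d))
            (e y : EuclideanSpace ℝ (Fin m)) (ε : ℝ), ‖e‖ ≤ ε →
            z₀ = DictSparse.mulCLM (DictSparse.dictMatrix a ω) x₀ →
            y = DictSparse.mulCLM (DictSparse.measMatrix φ ω) z₀ + e →
            (∃ xhat, DictSparse.IsL1Synthesis
              (DictSparse.measMatrix φ ω) (DictSparse.dictMatrix a ω) y ε xhat) ∧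
            ∀ (xhat : EuclideanSpace ℝ (Fin n)) (zhat : EuclideanSpace ℝ (Fin d)),
              DictSparse.IsL1Synthesis
                (DictSparse.measMatrix φ ω) (DictSparse.dictMatrix a ω) y ε xhat →
              zhat = DictSparse.mulCLM (DictSparse.dictMatrix a ω) xhat →
              ‖xhat - x₀‖ ≤ Crec * (DictSparse.bestApproxErr s x₀ / √(s : ℝ) + τ * ε) ∧
              ‖zhat - z₀‖ ≤ Crec * (‖DictSparse.mulCLM (DictSparse.dictMatrix a ω)‖ *
                (DictSparse.bestApproxErr s x₀ / √(s : ℝ) + τ * ε))) ∧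
        -- the expected error on the event `E`, for a fixed coefficient vector and possibly random
        -- noise
        (∀ (x₀ : EuclideanSpace ℝ (Fin n)) (e : Ω → EuclideanSpace ℝ (Fin m)) (ε : ℝ)
          (xhat : Ω → EuclideanSpace ℝ (Fin n)),
          (∀ ω ∈ E, ‖e ω‖ ≤ ε) →
          0 ≤ ε →
          (∀ ω ∈ E, DictSparse.IsL1Synthesis
            (DictSparse.measMatrix φ ω) (DictSparse.dictMatrix a ω)
            (DictSparse.mulCLM (DictSparse.measMatrix φ ω)
              (DictSparse.mulCLM (DictSparse.dictMatrix a ω) x₀) + e ω) ε (xhat ω)) →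
          ∫⁻ ω in E, ENNReal.ofReal
              ‖DictSparse.mulCLM (DictSparse.dictMatrix a ω) (xhat ω) -
                DictSparse.mulCLM (DictSparse.dictMatrix a ω) x₀‖ ∂P ≤
            ENNReal.ofReal (Crec * ((∫ ω, ‖DictSparse.mulCLM (DictSparse.dictMatrix a ω)‖ ∂P) *
              (DictSparse.bestApproxErr s x₀ / √(s : ℝ) + τ * ε)))) := by
  refine ⟨9, by norm_num, fun A c₀ lam K σ hA hc₀ _ hK hσ => ?_⟩
  obtain ⟨τ, hτ, hmain⟩ := DictSparse.exists_robustNSP_constants A c₀ lam K σ hA hc₀ hK hσ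
  refine ⟨τ, hτ, fun γ θ hγ _ hθ hθ1 => ?_⟩
  -- Recovery needs parameter at most `1/2`. Since `τ` does not depend on `γ`, passing to the
  -- minimum changes only `C` and `c`.
  have hγ' : 0 < min γ (1 / 2) := lt_min hγ (by norm_num)
  obtain ⟨C, c, hC, hc, hE⟩ := hmain (min γ (1 / 2)) θ hγ' hθ hθ1
  refine ⟨C, c, hC, hc, fun n s d m hn hs hsn hd hm Ω _ P _ φ a hφ ha hind => ?_⟩
  have hint := ha.integrable_norm hn
  obtain ⟨E, hEm, hEp, hEN⟩ := hE n s d m hn hs hsn hd hm Ω P φ a hφ ha hind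
  have hsn' : s ≤ n := by
    have h : (s : ℝ) ≤ n := hsn.trans (mul_le_of_le_one_left (Nat.cast_nonneg n) hθ1.le)
    exact_mod_cast h
  have hrec : ∀ ω ∈ E, ∀ (x₀ xhat : EuclideanSpace ℝ (Fin n)) (e : EuclideanSpace ℝ (Fin m))
      (ε : ℝ), ‖e‖ ≤ ε → DictSparse.IsL1Synthesis (DictSparse.measMatrix φ ω)
        (DictSparse.dictMatrix a ω) (DictSparse.mulCLM (DictSparse.measMatrix φ ω)
          (DictSparse.mulCLM (DictSparse.dictMatrix a ω) x₀) + e) ε xhat →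
      ‖xhat - x₀‖ ≤ 9 * (DictSparse.bestApproxErr s x₀ / √(s : ℝ) + τ * ε) ∧
      ‖DictSparse.mulCLM (DictSparse.dictMatrix a ω) xhat -
        DictSparse.mulCLM (DictSparse.dictMatrix a ω) x₀‖ ≤
        9 * (‖DictSparse.mulCLM (DictSparse.dictMatrix a ω)‖ *
          (DictSparse.bestApproxErr s x₀ / √(s : ℝ) + τ * ε)) := by
    intro ω hω x₀ xhat e ε he hx
    have h := DictSparse.norm_sub_le_of_isL1Synthesis hs hsn' hγ' (min_le_right _ _) hτ
      (hEN ω hω).2 he hx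
    refine ⟨h, ?_⟩
    rw [← map_sub]
    refine ((DictSparse.mulCLM (DictSparse.dictMatrix a ω)).le_opNorm _).trans ?_
    refine (mul_le_mul_of_nonneg_left h (norm_nonneg _)).trans (le_of_eq ?_)
    ring
  refine ⟨hint, E, hEm, hEp, fun ω hω => ⟨(hEN ω hω).1.mono (min_le_left _ _),
    (hEN ω hω).2.mono (min_le_left _ _), ?_⟩, ?_⟩
  · rintro x₀ z₀ e y ε he rfl rfl
    refine ⟨DictSparse.exists_isL1Synthesis _ _ _ ε x₀ ?_, ?_⟩
    · rw [DictSparse.mulCLM_mul, sub_add_cancel_left, norm_neg]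
      exact he
    · rintro xhat zhat hx rfl
      exact hrec ω hω x₀ xhat e ε he hx
  · intro x₀ e ε xhat he hε hx
    set r := DictSparse.bestApproxErr s x₀ / √(s : ℝ) + τ * ε with hr
    have hr0 : 0 ≤ r := add_nonneg
      (div_nonneg (DictSparse.bestApproxErr_nonneg s x₀) (Real.sqrt_nonneg _)) (mul_nonneg hτ.le hε)
    -- The bound is pointwise on the measurable event `E`, so neither the noise nor the selection of
    -- outputs has to be measurable.
    calc _ ≤ ∫⁻ ω in E, ENNReal.ofReal
          (9 * (‖DictSparse.mulCLM (DictSparse.dictMatrix a ω)‖ * r)) ∂P :=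
          setLIntegral_mono' hEm fun ω hω => ENNReal.ofReal_le_ofReal
            (hrec ω hω x₀ (xhat ω) (e ω) ε (he ω hω) (hx ω hω)).2
      _ ≤ ∫⁻ ω, ENNReal.ofReal (9 * (‖DictSparse.mulCLM (DictSparse.dictMatrix a ω)‖ * r)) ∂P :=
          setLIntegral_le_lintegral _ _
      _ = _ := by
          rw [← ofReal_integral_eq_lintegral_ofReal ((hint.mul_const r).const_mul 9)
            (Filter.Eventually.of_forall fun ω => by positivity), integral_const_mul,
            integral_mul_const]
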